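/- **Setting.** Let $\mathcal X$ be a measurable space with a $\sigma$-finite measure $\nu$ (e.g. a Borel subset of $\mathbb R^d$ with Lebesgue measure). One observes i.i.d. $(X_i,Y_i)$, $i=1,\dots,n$, with $$Y_i=\mu(X_i)+\sigma(X_i)\epsilon_i ,$$ where $X_i$ has density $h$ with respect to $\nu$, $\epsilon_i$ is independent of $X_i$ and has a known Lebesgue density $f$ whose $\tau$-th quantile $\inf\{y:F(y)\ge\tau\}$ is $0$, for a given $\tau\in(0,1)$; so $\mu$ is the $\tau$-th conditional quantile function of $Y$ given $X$. The unknown functions satisfy $\mu\in\mathcal U$, $\sigma\in\Sigma$, $h\in\mathcal H$, where $\mathcal U$ and $\Sigma\neq\emptyset$ are classes of measurable functions with $\sup_{\mu\in\mathcal U}\|\mu\|_\infty<\infty$ and $\overline\sigma^{-1}\le\sigma(x)\le\overline\sigma$ for all $\sigma\in\Sigma$, $x\in\mathcal X$ and some $\overline\sigma>1$, and $\mathcal H$ is a class of probability densities with respect to $\nu$. Write $\|u-v\|_{2,h}^2=\int (u-v)^2h\,d\nu$. For a class $\mathcal G$ that is totally bounded in $L_2(h_0)$, let $M_{h_0}(\varepsilon;\mathcal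 G)$ be the logarithm of the maximal cardinality of a finite subset of $\mathcal G$ whose distinct elements have $\|\cdot\|_{2,h_0}$-distance $>\varepsilon$. For nonnegative quantities, $a\asymp b$ means that each is $O$ of the other. **Assumptions.** (a) There are $h_0\in\mathcal H$ and $C<\infty$ with $h(x)\le C\,h_0(x)$ for all $h\in\mathcal H$ and $x\in\mathcal X$. (b) $\mathcal U$ and $\Sigma$ are totally bounded in $L_2(h_0)$, and there is a function $M$ with $M(\varepsilon)\asymp M_{h_0}(\varepsilon;\mathcal U)$ as $\varepsilon\to0^+$ which is rich, i.e. $\liminf_{\varepsilon\to0^+}M(\alpha\varepsilon)/M(\varepsilon)>1$ for some $0<\alpha<1$, and order regular, i.e. $M(c\varepsilon)\asymp M(\varepsilon)$ as $\varepsilon\to0^+$ for every $c>0$. Moreover $M_{h_0}(\varepsilon;\Sigma)=O(M_{h_0}(\varepsilon;\mathcal U))$ as $\varepsilon\to0^+$. (c) With $\rho_\kappa(y)=y(\kappa-I(y<0))$ and $\Gamma(t,k)=\int_k^\infty x^{t-1}e^{-x}dx$, the density $f$ is, for some $\eta\in\mathbb R$, $s>0$ and $0<\kappa<1$, one of the following: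 - asymmetric Laplace: $\frac{\kappa(1-\kappa)}{s}\exp[-\rho_\kappa(\frac{y-\eta}{s})]$; - asymmetric connected double truncated gamma, with $\alpha\ge0$: $\frac{\kappa(1-\kappa)}{s\,\Gamma(\alpha+1,\alpha)}[\alpha+\rho_\kappa(\frac{y-\eta}{s})]^{\alpha}\exp\{-[\alpha+\rho_\kappa(\frac{y-\eta}{s})]\}$; - connected normal-Laplace, with $\beta>0$ and $\frac{1-\kappa}{\beta}=\frac{2\kappa}{\sqrt{2\pi}}$: $\frac{2\kappa}{\sqrt{2\pi}\,s}e^{-(y-\eta)^2/(2s^2)}I(y\le\eta)+\frac{1-\kappa}{\beta s}e^{-(y-\eta)/(\beta s)}I(y>\eta)$; - Cauchy: $\frac{1}{\pi s[1+((y-\eta)/s)^2]}$. (For the first three families the $\tau$-th quantile is $0$ in particular when $\kappa=\tau$ and $\eta=0$; for the Cauchy density when $\tau=1/2$ and $\eta=0$.) **Conclusion.** There is a sequence $\varepsilon_n$, positive for all large $n$, solving $$M_{h_0}(\varepsilon_n;\mathcal U)= n\varepsilon_n^2$$ in order, i.e. $M_{h_0}(\varepsilon_n;\mathcal U)\asymp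 n\varepsilon_n^2$ as $n\to\infty$. For every such sequence (in particular for every exact solution with $\varepsilon_n>0$), $$\inf_{\hat\mu}\ \sup_{\mu\in\mathcal U,\ \sigma\in\Sigma,\ h\in\mathcal H}\mathbb E\,\|\mu-\hat\mu\|_{2,h}^2\ \asymp\ \varepsilon_n^2\qquad(n\to\infty),$$ where the infimum is over all measurable estimators $\hat\mu$ of $\mu$ based on $(X_i,Y_i)_{i=1}^n$. -/

import Mathlib

open MeasureTheory Filter Topology Asymptotics

noncomputable section

namespace LocScale

/-! ### Error densities -/

/-- The check loss `ρ_κ(y) = y (κ - 1{y < 0})`. -/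
def checkLoss (κ y : ℝ) : ℝ := y * (κ - if y < 0 then 1 else 0)

/-- The upper incomplete gamma function `Γ(t, k) = ∫_k^∞ x^(t-1) e^(-x) dx`. -/
def upperGamma (t k : ℝ) : ℝ := ∫ x in Set.Ioi k, x ^ (t - 1) * Real.exp (-x)

/-- Asymmetric Laplace density with location `η`, scale `s`, skewness `κ`. -/
def aldPDF (η s κ y : ℝ) : ℝ :=
  κ * (1 - κ) / s * Real.exp (-checkLoss κ ((y - η) / s))

/-- Asymmetric connected double truncated gamma density with location `η`, scale `s`,
shape `a`, skewness `κ`. -/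
def acdtgPDF (η s a κ y : ℝ) : ℝ :=
  κ * (1 - κ) / (s * upperGamma (a + 1) a) * (a + checkLoss κ ((y - η) / s)) ^ a *
    Real.exp (-(a + checkLoss κ ((y - η) / s)))

/-- Connected normal-Laplace density with location `η`, scale `s`, proportion `κ` and
additional right-hand scale `β`. -/
def cnlPDF (η s κ β y : ℝ) : ℝ :=
  if y ≤ η then
    2 * κ / (√(2 * Real.pi) * s) * Real.exp (-(y - η) ^ 2 / (2 * s ^ 2))
  else
    (1 - κ) / (β * s) * Real.exp (-(1 / (β * s)) * (y - η))

/-- The four families of error densities. -/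
inductive IsErrorDensity : (ℝ → ℝ) → Prop
  | ald (η s κ : ℝ) (hs : 0 < s) (hκ0 : 0 < κ) (hκ1 : κ < 1) :
      IsErrorDensity (aldPDF η s κ)
  | acdtg (η s a κ : ℝ) (hs : 0 < s) (ha : 0 ≤ a) (hκ0 : 0 < κ) (hκ1 : κ < 1) :
      IsErrorDensity (acdtgPDF η s a κ)
  | cnl (η s κ β : ℝ) (hs : 0 < s) (hκ0 : 0 < κ) (hκ1 : κ < 1) (hβ : 0 < β)
      (hc : (1 - κ) / β = 2 * κ / √(2 * Real.pi)) :
      IsErrorDensity (cnlPDF η s κ β)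
  | cauchy (η : ℝ) (s : NNReal) (hs : 0 < s) :
      IsErrorDensity (ProbabilityTheory.cauchyPDFReal η s)

/-- The law on `ℝ` with Lebesgue density `f`. -/
def errorLaw (f : ℝ → ℝ) : Measure ℝ := volume.withDensity fun y => ENNReal.ofReal (f y)

/-- The `τ`-th quantile `inf {y : F(y) ≥ τ}` of a law on `ℝ` with distribution function `F`. -/
def quantile (P : Measure ℝ) (τ : ℝ) : ℝ := sInf {y : ℝ | ENNReal.ofReal τ ≤ P (Set.Iic y)}

/-! ### The regression model and its minimax risk -/

variable {X : Type*} [MeasurableSpace X]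

/-- `h` is a probability density with respect to `ν`. -/
def IsProbDensity (ν : Measure X) (h : X → ℝ) : Prop :=
  Measurable h ∧ (∀ x, 0 ≤ h x) ∧ ∫⁻ x, ENNReal.ofReal (h x) ∂ν = 1

/-- The law of one observation `(x, μ(x) + σ(x) ε)`, where `x` has density `h`, the error `ε`
has density `f`, and `x` and `ε` are independent. -/
def obsLaw (ν : Measure X) (f : ℝ → ℝ) (μ σ h : X → ℝ) : Measure (X × ℝ) :=
  ((ν.withDensity fun x => ENNReal.ofReal (h x)).prod (errorLaw f)).map
    fun p => (p.1, μ p.1 + σ p.1 * p.2)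

/-- The squared `L₂(h)` distance `∫ (u - v)² h dν`. -/
def l2DistSq (ν : Measure X) (h u v : X → ℝ) : ENNReal :=
  ∫⁻ x, ENNReal.ofReal ((u x - v x) ^ 2 * h x) ∂ν

/-- The `L₂(h)` distance. -/
def l2Dist (ν : Measure X) (h u v : X → ℝ) : ENNReal := l2DistSq ν h u v ^ (1 / 2 : ℝ)

/-- Expected squared `L₂(h)` loss of the estimator `m` based on `n` i.i.d. observations. -/
def risk (ν : Measure X) (f : ℝ → ℝ) (n : ℕ) (m : (Fin n → X × ℝ) → X → ℝ) (μ σ h : X → ℝ) :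
    ENNReal :=
  ∫⁻ d, l2DistSq ν h μ (m d) ∂(Measure.pi fun _ : Fin n => obsLaw ν f μ σ h)

/-- The minimax risk: infimum over all (jointly measurable) estimators of the worst-case risk over
`μ ∈ U`, `σ ∈ S`, `h ∈ H`. -/
def minimaxRisk (ν : Measure X) (f : ℝ → ℝ) (U S H : Set (X → ℝ)) (n : ℕ) : ENNReal :=
  ⨅ (m : (Fin n → X × ℝ) → X → ℝ) (_ : Measurable (Function.uncurry m)),
    ⨆ μ ∈ U, ⨆ σ ∈ S, ⨆ h ∈ H, risk ν f n m μ σ h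

/-! ### Metric entropy -/

/-- Maximal cardinality of a finite subset of `U` whose distinct elements are at `L₂(h)` distance
larger than `ε`. -/
def packingNumber (ν : Measure X) (h : X → ℝ) (U : Set (X → ℝ)) (ε : ℝ) : ℕ∞ :=
  ⨆ (N : Finset (X → ℝ)) (_ : (N : Set (X → ℝ)) ⊆ U)
    (_ : (N : Set (X → ℝ)).Pairwise fun u v => ENNReal.ofReal ε < l2Dist ν h u v), (N.card : ℕ∞)

/-- Total boundedness in `L₂(h)`: all packing numbers are finite. -/
def TotallyBoundedL2 (ν : Measure X) (h : X → ℝ) (U : Set (X → ℝ)) : Prop :=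
  ∀ ε : ℝ, 0 < ε → packingNumber ν h U ε ≠ ⊤

/-- Packing `ε`-entropy in `L₂(h)` (used only for totally bounded classes and `ε > 0`). -/
def packingEntropy (ν : Measure X) (h : X → ℝ) (U : Set (X → ℝ)) (ε : ℝ) : ℝ :=
  Real.log ((packingNumber ν h U ε).toNat : ℝ)

/-- Richness: `liminf_{ε → 0} M(αε) / M(ε) > 1` for some `0 < α < 1`; the lower limit is taken in
the extended reals. -/
def IsRich (M : ℝ → ℝ) : Prop :=
  ∃ α : ℝ, 0 < α ∧ α < 1 ∧
    1 < liminf (fun ε : ℝ => ((M (α * ε) / M ε : ℝ) : EReal)) (𝓝[>] (0 : ℝ))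

/-- Order regularity: `M(cε) ≍ M(ε)` as `ε → 0`, for every `c > 0`. -/
def IsOrderRegular (M : ℝ → ℝ) : Prop :=
  ∀ c : ℝ, 0 < c → (fun ε => M (c * ε)) =Θ[𝓝[>] (0 : ℝ)] M

/-- The entropy condition: the `L₂(h₀)` entropy of `U` has an order `M` which is rich and regular,
and the entropy of `S` is at most of the order of the entropy of `U`. -/
def EntropyCondition (ν : Measure X) (h₀ : X → ℝ) (U S : Set (X → ℝ)) : Prop :=
  TotallyBoundedL2 ν h₀ U ∧ TotallyBoundedL2 ν h₀ S ∧
  (∃ M : ℝ → ℝ, M =Θ[𝓝[>] (0 : ℝ)] packingEntropy ν h₀ U ∧ IsRich M ∧ IsOrderRegular M) ∧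
  packingEntropy ν h₀ S =O[𝓝[>] (0 : ℝ)] packingEntropy ν h₀ U

/-- `ε` solves `M_{h₀}(ε_n; U) = n ε_n²` in order. An exact solution satisfies this, and so does
any vanishing solution of `M(ε_n) = n ε_n²` for a function `M` of the order of the entropy. -/
def SolvesEntropyEquation (ν : Measure X) (h₀ : X → ℝ) (U : Set (X → ℝ)) (ε : ℕ → ℝ) : Prop :=
  (∀ᶠ n in atTop, 0 < ε n) ∧
    (fun n => packingEntropy ν h₀ U (ε n)) =Θ[atTop] fun n : ℕ => (n : ℝ) * ε n ^ 2

/-- `R_n ≍ ε_n²` for an extended nonnegative sequence `R`. -/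
def HasSqRate (R : ℕ → ENNReal) (ε : ℕ → ℝ) : Prop :=
  ∃ c C : ℝ, 0 < c ∧ 0 < C ∧ ∀ᶠ n in atTop,
    ENNReal.ofReal (c * ε n ^ 2) ≤ R n ∧ R n ≤ ENNReal.ofReal (C * ε n ^ 2)

end LocScale

end

namespace LocScale

/-! ### Finite products of a probability measure -/

section Products

variable {Z : Type*} [MeasurableSpace Z]

/-! Both bounds rest on one comparison, `exists_kl_le`: for two laws of the model with the same
covariate density, the Kullback-Leibler divergence is at most a constant times the squared `L₂`
distance of the pairs `(μ, σ)`. It needs only that the log-density of the location-scale family is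
Lipschitz in its parameters with a square integrable envelope. `IsRegularError` records this, and it
is checked for each of the four families.

Lower bound (`ofReal_le_minimaxRisk`): fix `σ` and the dominating density `h₀`, and take a maximal
`γ ε_n`-packing `N` and a maximal `ε_n`-packing `N'` of `U`; the latter is also a net. Every `u ∈ N`
has a neighbour in `N'` at divergence `O(n ε_n²)` for the whole sample. A good estimator would yield
disjoint events, one per `u ∈ N`, each likely under its own law, hence each of probability at least
of order `exp(-O(n ε_n²))` under the law of a neighbour. The laws in `N'` have total mass only
`|N'|`, and richness lets `γ` be chosen so small that `|N|` is too large for this.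

Upper bound (`risk_avgEst_le`): put a uniform prior on the product of `ε_n`-nets of `U` and `S`, and
predict each observation by the Bayes mixture of conditional densities. By the chain rule the
cumulative divergence telescopes and is at most the log-cardinality of the net plus `n` times the
divergence from the candidate closest to the truth, so it is `O(n ε_n²)`. Divergence dominates
squared Hellinger distance, which dominates squared total variation. Since the error distribution
function grows linearly around its quantile, the conditional quantile of the predictive density
estimates `μ(x)` with squared error of that order (`exists_predEst_sq_le`). Averaging over the `n`
prediction times divides by `n`. The covariate density cancels from all likelihood ratios, so the
estimator does not need it.

The entropy is a step function, so the entropy equation is solved in order only; order regularity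
absorbs the jumps (`exists_solution`). -/

theorem lintegral_pi_prod {n : ℕ} (P : Measure Z) [IsProbabilityMeasure P]
    {g : Fin n → Z → ENNReal} (hg : ∀ i, Measurable (g i)) :
    ∫⁻ d, ∏ i, g i (d i) ∂(Measure.pi fun _ : Fin n => P) = ∏ i, ∫⁻ z, g i z ∂P := by
  have hind : ProbabilityTheory.iIndepFun (fun (i : Fin n) (d : Fin n → Z) => g i (d i))
      (Measure.pi fun _ : Fin n => P) :=
    ProbabilityTheory.iIndepFun_pi (fun i => (hg i).aemeasurable)
  have h := ProbabilityTheory.lintegral_prod_eq_prod_lintegral_of_indepFun Finset.univ _ hind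
    (fun i => (hg i).comp (measurable_pi_apply i))
  rw [h]
  refine Finset.prod_congr rfl fun i _ => ?_
  exact (measurePreserving_eval (fun _ : Fin n => P) i).lintegral_comp (hg i)

theorem pi_withDensity {n : ℕ} (P : Measure Z) [IsProbabilityMeasure P] {r : Z → ENNReal}
    (hr : Measurable r) [SigmaFinite (P.withDensity r)] :
    Measure.pi (fun _ : Fin n => P.withDensity r) =
      (Measure.pi fun _ : Fin n => P).withDensity fun d => ∏ i, r (d i) := by
  refine Measure.pi_eq fun s hs => ?_
  have hbox : MeasurableSet (Set.univ.pi s) := MeasurableSet.univ_pi hs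
  rw [withDensity_apply _ hbox, ← lintegral_indicator hbox]
  have hpt : ∀ d : Fin n → Z, (Set.univ.pi s).indicator (fun d => ∏ i, r (d i)) d =
      ∏ i, (s i).indicator r (d i) := by
    intro d
    by_cases hd : d ∈ Set.univ.pi s
    · rw [Set.indicator_of_mem hd]
      exact Finset.prod_congr rfl fun i _ =>
        (Set.indicator_of_mem (hd i (Set.mem_univ i)) _).symm
    · rw [Set.indicator_of_notMem hd]
      obtain ⟨i, hi⟩ : ∃ i, d i ∉ s i := by simpa [Set.mem_pi] using hd
      exact (Finset.prod_eq_zero (Finset.mem_univ i) (Set.indicator_of_notMem hi _)).symm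
  simp_rw [hpt]
  rw [lintegral_pi_prod P (fun i => hr.indicator (hs i))]
  exact Finset.prod_congr rfl fun i _ => by
    rw [lintegral_indicator (hs i), withDensity_apply _ (hs i)]

theorem measurePreserving_cons {n : ℕ} (P : Measure Z) [IsProbabilityMeasure P] :
    MeasurePreserving (fun p : Z × (Fin n → Z) => (Fin.cons p.1 p.2 : Fin (n + 1) → Z))
      (P.prod (Measure.pi fun _ : Fin n => P)) (Measure.pi fun _ : Fin (n + 1) => P) := by
  have h := (measurePreserving_piFinSuccAbove (fun _ : Fin (n + 1) => P) 0).symm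
  have he : (fun p : Z × (Fin n → Z) => (Fin.cons p.1 p.2 : Fin (n + 1) → Z)) =
      (MeasurableEquiv.piFinSuccAbove (fun _ : Fin (n + 1) => Z) 0).symm := by
    funext p
    simp [MeasurableEquiv.piFinSuccAbove_symm_apply, Fin.insertNthEquiv]
  rw [he]
  exact h

/-- The upper bound averages estimators that see only the first `i` observations; this reduces their
risk to one under the `i`-fold product. -/
theorem measurePreserving_comp_castLE {i n : ℕ} (h : i ≤ n) (P : Measure Z)
    [IsProbabilityMeasure P] :
    MeasurePreserving (fun (d : Fin n → Z) (k : Fin i) => d (Fin.castLE h k))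
      (Measure.pi fun _ : Fin n => P) (Measure.pi fun _ : Fin i => P) := by
  have hm : Measurable (fun (d : Fin n → Z) (k : Fin i) => d (Fin.castLE h k)) := by fun_prop
  refine ⟨hm, (Measure.pi_eq fun s hs => ?_).symm⟩
  rw [Measure.map_apply hm (MeasurableSet.univ_pi hs)]
  have hset : (fun (d : Fin n → Z) (k : Fin i) => d (Fin.castLE h k)) ⁻¹' Set.univ.pi s =
      ((Finset.univ.map (Fin.castLEEmb h) : Finset (Fin n)) : Set (Fin n)).pi
        fun j => if hj : (j : ℕ) < i then s ⟨j, hj⟩ else Set.univ := by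
    ext d
    simp only [Set.mem_preimage, Set.mem_pi, Set.mem_univ, true_imp_iff, Finset.coe_map,
      Finset.coe_univ, Set.image_univ, Set.forall_mem_range, Fin.castLEEmb_apply,
      Fin.val_castLE, Fin.is_lt, dite_true, Fin.eta]
  rw [hset, Measure.pi_pi_finset, Finset.prod_map]
  exact Finset.prod_congr rfl fun k _ => by simp

theorem integrable_sum_eval {n : ℕ} (P : Measure Z) [IsProbabilityMeasure P] {g : Z → ℝ}
    (hg : Integrable g P) :
    Integrable (fun d : Fin n → Z => ∑ i, g (d i)) (Measure.pi fun _ : Fin n => P) :=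
  integrable_finsetSum _ fun _ _ => integrable_comp_eval hg

theorem integral_sum_eval {n : ℕ} (P : Measure Z) [IsProbabilityMeasure P] {g : Z → ℝ}
    (hg : Integrable g P) :
    ∫ d : Fin n → Z, ∑ i, g (d i) ∂(Measure.pi fun _ : Fin n => P) = n * ∫ z, g z ∂P := by
  rw [integral_finsetSum _ fun i _ => integrable_comp_eval (μ := fun _ : Fin n => P) hg]
  simp_rw [integral_comp_eval (μ := fun _ : Fin n => P) hg.aestronglyMeasurable]
  simp

/-- Change of measure for events under product measures, with an error controlled by the
Kullback-Leibler divergence `-∫ log (dQ/dP) dP` of the factors. -/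
theorem pi_real_le_exp_mul_add (P Q : Measure Z) [IsProbabilityMeasure P] [IsProbabilityMeasure Q]
    {r : Z → ℝ} (hr : Measurable r) (hpos : ∀ z, 0 < r z)
    (hQ : Q = P.withDensity fun z => ENNReal.ofReal (r z))
    (h_int : Integrable (fun z => Real.log (r z)) P) {κ : ℝ} (hκ : -∫ z, Real.log (r z) ∂P ≤ κ)
    (n : ℕ) {A : Set (Fin n → Z)} (hA : MeasurableSet A) {t : ℝ} (ht : 0 < t) :
    (Measure.pi fun _ : Fin n => P).real A ≤
      Real.exp t * (Measure.pi fun _ : Fin n => Q).real A + (1 + n * κ) / t := by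
  set Pn := Measure.pi fun _ : Fin n => P with hPn
  set R : (Fin n → Z) → ℝ := fun d => ∏ i, r (d i) with hR
  have hRm : Measurable R := Finset.measurable_prod _ fun i _ => hr.comp (measurable_pi_apply i)
  have hRpos : ∀ d, 0 < R d := fun d => Finset.prod_pos fun i _ => hpos _
  have hQn : Measure.pi (fun _ : Fin n => Q) = Pn.withDensity fun d => ENNReal.ofReal (R d) := by
    have : SigmaFinite (P.withDensity fun z => ENNReal.ofReal (r z)) := by
      rw [← hQ]; infer_instance
    subst hQ
    rw [pi_withDensity P hr.ennreal_ofReal]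
    congr 1
    ext d
    rw [hR, ENNReal.ofReal_prod_of_nonneg fun i _ => (hpos _).le]
  have hR1 : ∫⁻ d, ENNReal.ofReal (R d) ∂Pn = 1 := by
    have h1 : (Measure.pi fun _ : Fin n => Q) Set.univ = 1 := measure_univ
    rwa [hQn, withDensity_apply _ MeasurableSet.univ, Measure.restrict_univ] at h1
  have hRint : Integrable R Pn := by
    refine ⟨hRm.aestronglyMeasurable, ?_⟩
    rw [hasFiniteIntegral_iff_ofReal (ae_of_all _ fun d => (hRpos d).le), hR1]
    exact ENNReal.one_lt_top
  have hRval : ∫ d, R d ∂Pn = 1 := by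
    rw [integral_eq_lintegral_of_nonneg_ae (ae_of_all _ fun d => (hRpos d).le)
      hRm.aestronglyMeasurable, hR1, ENNReal.toReal_one]
  have hlog : ∀ d, Real.log (R d) = ∑ i, Real.log (r (d i)) := fun d =>
    Real.log_prod fun i _ => (hpos _).ne'
  have hLint : Integrable (fun d => Real.log (R d)) Pn := by
    simp_rw [hlog]; exact integrable_sum_eval P h_int
  have hLval : ∫ d, Real.log (R d) ∂Pn = n * ∫ z, Real.log (r z) ∂P := by
    simp_rw [hlog]; exact integral_sum_eval P h_int
  -- `-log R` has no sign, but `R - log R ≥ 0`, so Markov's inequality applies to it. The price is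
  -- the mean of `R`, which is 1.
  have hΦ : ∫ d, (R d - Real.log (R d)) ∂Pn ≤ 1 + n * κ := by
    rw [integral_sub hRint hLint, hRval, hLval]
    nlinarith [Nat.cast_nonneg (α := ℝ) n]
  have hΦ0 : ∀ d, 0 ≤ R d - Real.log (R d) := fun d => by
    linarith [Real.log_le_sub_one_of_pos (hRpos d)]
  set B : Set (Fin n → Z) := {d | t ≤ R d - Real.log (R d)} with hB
  have hBP : Pn.real B ≤ (1 + n * κ) / t := by
    rw [le_div_iff₀ ht, mul_comm]
    exact (mul_meas_ge_le_integral_of_nonneg (ae_of_all _ hΦ0) (hRint.sub hLint) t).trans hΦ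
  have hBm : MeasurableSet B := measurableSet_le measurable_const (hRm.sub hRm.log)
  -- Off `B`, `-log R < t - R < t`, so the likelihood ratio exceeds `exp(-t)`.
  have hcore : Pn.real (A \ B) ≤ Real.exp t * (Measure.pi fun _ : Fin n => Q).real A := by
    have h1 : ENNReal.ofReal (Real.exp (-t)) * Pn (A \ B) ≤
        (Measure.pi fun _ : Fin n => Q) A := by
      rw [hQn]
      refine le_trans ?_ (measure_mono (Set.sdiff_subset (s := A) (t := B)))
      rw [withDensity_apply _ (hA.diff hBm), ← setLIntegral_const]
      refine setLIntegral_mono hRm.ennreal_ofReal fun d hd => ENNReal.ofReal_le_ofReal ?_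
      have h2 : R d - Real.log (R d) < t := not_le.mp hd.2
      rw [← Real.le_log_iff_exp_le (hRpos d)]
      linarith [hRpos d]
    have h3 := ENNReal.toReal_mono (measure_ne_top _ _) h1
    rw [ENNReal.toReal_mul, ENNReal.toReal_ofReal (Real.exp_pos _).le] at h3
    have h4 : Real.exp t * (Real.exp (-t) * Pn.real (A \ B)) = Pn.real (A \ B) := by
      rw [← mul_assoc, ← Real.exp_add]; simp
    rw [← h4]
    exact mul_le_mul_of_nonneg_left h3 (Real.exp_pos t).le
  calc Pn.real A ≤ Pn.real (A \ B ∪ B) := measureReal_mono (by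
        intro d hd; by_cases h : d ∈ B
        · exact Or.inr h
        · exact Or.inl ⟨hd, h⟩) (measure_ne_top _ _)
    _ ≤ Pn.real (A \ B) + Pn.real B := measureReal_union_le _ _
    _ ≤ _ := add_le_add hcore hBP

end Products

/-! ### Sequential prediction by a finite mixture -/

section Mixture

variable {Z : Type*} {J : Type*} [Fintype J]

/-- Unnormalised mixture likelihood of the functions `r j` at the sample `d`. -/
noncomputable def mixLik (r : J → Z → ℝ) {i : ℕ} (d : Fin i → Z) : ℝ := ∑ j, ∏ k, r j (d k)

/-- Predictive mixture of the functions `r j` at `z`, given the sample `d`. -/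
noncomputable def mixPred (r : J → Z → ℝ) {i : ℕ} (d : Fin i → Z) (z : Z) : ℝ :=
  (∑ j, (∏ k, r j (d k)) * r j z) / mixLik r d

variable {r : J → Z → ℝ}

theorem mixLik_cons {i : ℕ} (d : Fin i → Z) (z : Z) :
    mixLik r (Fin.cons z d : Fin (i + 1) → Z) = ∑ j, (∏ k, r j (d k)) * r j z := by
  simp [mixLik, Fin.prod_univ_succ, mul_comm]

theorem mixLik_pos [Nonempty J] (hpos : ∀ j z, 0 < r j z) {i : ℕ} (d : Fin i → Z) :
    0 < mixLik r d :=
  Finset.sum_pos (fun j _ => Finset.prod_pos fun _ _ => hpos j _) Finset.univ_nonempty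

theorem mixPred_pos [Nonempty J] (hpos : ∀ j z, 0 < r j z) {i : ℕ} (d : Fin i → Z) (z : Z) :
    0 < mixPred r d z := by
  rw [mixPred, ← mixLik_cons]
  exact div_pos (mixLik_pos hpos _) (mixLik_pos hpos _)

variable [MeasurableSpace Z]

theorem measurable_mixLik (hr : ∀ j, Measurable (r j)) (i : ℕ) :
    Measurable (mixLik r : (Fin i → Z) → ℝ) :=
  Finset.measurable_sum _ fun j _ => Finset.measurable_prod _ fun k _ =>
    (hr j).comp (measurable_pi_apply k)

theorem measurable_mixPred (hr : ∀ j, Measurable (r j)) (i : ℕ) :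
    Measurable fun p : (Fin i → Z) × Z => mixPred r p.1 p.2 := by
  refine Measurable.div (Finset.measurable_sum _ fun j _ => Measurable.mul ?_ ?_) ?_
  · exact Finset.measurable_prod _ fun k _ =>
      (hr j).comp ((measurable_pi_apply k).comp measurable_fst)
  · exact (hr j).comp measurable_snd
  · exact (measurable_mixLik hr i).comp measurable_fst

theorem lintegral_mixPred [Nonempty J] (hr : ∀ j, Measurable (r j)) (hpos : ∀ j z, 0 < r j z)
    {P : Measure Z} (hone : ∀ j, ∫⁻ z, ENNReal.ofReal (r j z) ∂P = 1) {i : ℕ} (d : Fin i → Z) :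
    ∫⁻ z, ENNReal.ofReal (mixPred r d z) ∂P = 1 := by
  have hw : ∀ j, 0 ≤ (∏ k, r j (d k)) / mixLik r d := fun j =>
    div_nonneg (Finset.prod_nonneg fun _ _ => (hpos j _).le) (mixLik_pos hpos d).le
  have hpt : ∀ z, ENNReal.ofReal (mixPred r d z) =
      ∑ j, ENNReal.ofReal ((∏ k, r j (d k)) / mixLik r d) * ENNReal.ofReal (r j z) := by
    intro z
    rw [mixPred, Finset.sum_div,
      ENNReal.ofReal_sum_of_nonneg fun j _ => div_nonneg (mul_nonneg
        (Finset.prod_nonneg fun _ _ => (hpos j _).le) (hpos j z).le) (mixLik_pos hpos d).le]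
    refine Finset.sum_congr rfl fun j _ => ?_
    rw [← ENNReal.ofReal_mul (hw j)]
    congr 1
    ring
  simp_rw [hpt]
  rw [lintegral_finsetSum _ fun j _ => (hr j).ennreal_ofReal.const_mul _]
  simp_rw [lintegral_const_mul _ (hr _).ennreal_ofReal, hone, mul_one]
  rw [← ENNReal.ofReal_sum_of_nonneg fun j _ => hw j, ← Finset.sum_div, ← mixLik,
    div_self (mixLik_pos hpos d).ne', ENNReal.ofReal_one]

/-- The mixture lies between any one of its terms and `card J` times a common bound, so its
logarithm is dominated by the sum of all `|log r j|` plus `log (card J)`. -/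
theorem integrable_log_mixLik [Nonempty J] (hr : ∀ j, Measurable (r j))
    (hpos : ∀ j z, 0 < r j z) (P : Measure Z) [IsProbabilityMeasure P]
    (h_int : ∀ j, Integrable (fun z => Real.log (r j z)) P) (i : ℕ) :
    Integrable (fun d : Fin i → Z => Real.log (mixLik r d)) (Measure.pi fun _ : Fin i => P) := by
  have hS : Integrable (fun d : Fin i → Z => Real.log (Fintype.card J) +
      ∑ j, ∑ k, |Real.log (r j (d k))|) (Measure.pi fun _ : Fin i => P) :=
    (integrable_const _).add (integrable_finsetSum _ fun j _ =>
      integrable_sum_eval P (h_int j).abs)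
  refine hS.mono' (measurable_mixLik hr i).log.aestronglyMeasurable (ae_of_all _ fun d => ?_)
  set T := ∑ j, ∑ k, |Real.log (r j (d k))| with hT
  have hlogp : ∀ j, |Real.log (∏ k, r j (d k))| ≤ T := by
    intro j
    rw [Real.log_prod fun k _ => (hpos j _).ne']
    refine (Finset.abs_sum_le_sum_abs _ _).trans ?_
    exact Finset.single_le_sum (f := fun j => ∑ k, |Real.log (r j (d k))|)
      (fun j _ => Finset.sum_nonneg fun _ _ => abs_nonneg _) (Finset.mem_univ j)
  have hcard : (1 : ℝ) ≤ Fintype.card J := by exact_mod_cast Fintype.card_pos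
  have hpp : ∀ j, 0 < ∏ k, r j (d k) := fun j => Finset.prod_pos fun _ _ => hpos j _
  rw [Real.norm_eq_abs, abs_le]
  constructor
  · obtain ⟨j⟩ := (inferInstance : Nonempty J)
    have h1 : ∏ k, r j (d k) ≤ mixLik r d :=
      Finset.single_le_sum (f := fun j => ∏ k, r j (d k)) (fun j _ => (hpp j).le)
        (Finset.mem_univ j)
    have h2 := Real.log_le_log (hpp j) h1
    have h3 := (abs_le.mp (hlogp j)).1
    linarith [Real.log_nonneg hcard]
  · have h1 : mixLik r d ≤ Fintype.card J * Real.exp T := by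
      have : mixLik r d ≤ ∑ _j : J, Real.exp T := Finset.sum_le_sum fun j _ =>
        (Real.log_le_iff_le_exp (hpp j)).mp ((le_abs_self _).trans (hlogp j))
      simpa using this
    have h2 := Real.log_le_log (mixLik_pos hpos d) h1
    rwa [Real.log_mul (by positivity) (Real.exp_pos _).ne', Real.log_exp] at h2

/-- The squared Hellinger discrepancy is at most the Kullback-Leibler divergence, pointwise. -/
theorem one_sub_sqrt_sq_le {x : ℝ} (hx : 0 < x) : (1 - √x) ^ 2 ≤ x - 1 - Real.log x := by
  -- `log x ≤ x - 1` at `√x` reads `log x ≤ 2√x - 2`, which is the claim rearranged.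
  have h1 := Real.log_le_sub_one_of_pos (Real.sqrt_pos.mpr hx)
  rw [Real.log_sqrt hx.le] at h1
  nlinarith [Real.sq_sqrt hx.le]

/-- The predictive ratio `ρ` is the quotient of the mixture likelihoods of `i + 1` and `i`
observations, so `-log ρ` integrates to a difference that telescopes in `i`. As `ρ - 1` has mean
zero, `ρ - 1 - log ρ` has the same integral and dominates the Hellinger integrand pointwise.
Nonnegativity of `a` allows the sum to be taken inside `ENNReal.ofReal`. -/
theorem hellinger_mixPred_le [Nonempty J] (hr : ∀ j, Measurable (r j))
    (hpos : ∀ j z, 0 < r j z) (P : Measure Z) [IsProbabilityMeasure P]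
    (hone : ∀ j, ∫⁻ z, ENNReal.ofReal (r j z) ∂P = 1)
    (h_int : ∀ j, Integrable (fun z => Real.log (r j z)) P) (i : ℕ) :
    ∃ a : ℝ, 0 ≤ a ∧
      a = ∫ d, Real.log (mixLik r d) ∂(Measure.pi fun _ : Fin i => P) -
        ∫ d, Real.log (mixLik r d) ∂(Measure.pi fun _ : Fin (i + 1) => P) ∧
      ∫⁻ d, ∫⁻ z, ENNReal.ofReal ((1 - √(mixPred r d z)) ^ 2) ∂P
        ∂(Measure.pi fun _ : Fin i => P) ≤ ENNReal.ofReal a := by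
  set Pd := Measure.pi fun _ : Fin i => P with hPd
  set ρ : Z × (Fin i → Z) → ℝ := fun p => mixPred r p.2 p.1 with hρ
  have hρm : Measurable ρ :=
    Measurable.comp (g := fun p : (Fin i → Z) × Z => mixPred r p.1 p.2) (f := Prod.swap)
      (measurable_mixPred hr i) measurable_swap
  have hρpos : ∀ p, 0 < ρ p := fun p => mixPred_pos hpos _ _
  have hρ1 : ∫⁻ p, ENNReal.ofReal (ρ p) ∂(P.prod Pd) = 1 := by
    rw [lintegral_prod_symm _ hρm.ennreal_ofReal.aemeasurable]
    simp only [hρ, lintegral_mixPred hr hpos hone]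
    simp
  have hρint : Integrable ρ (P.prod Pd) := by
    refine ⟨hρm.aestronglyMeasurable, ?_⟩
    rw [hasFiniteIntegral_iff_ofReal (ae_of_all _ fun d => (hρpos d).le), hρ1]
    exact ENNReal.one_lt_top
  have hρval : ∫ p, ρ p ∂(P.prod Pd) = 1 := by
    rw [integral_eq_lintegral_of_nonneg_ae (ae_of_all _ fun d => (hρpos d).le)
      hρm.aestronglyMeasurable, hρ1, ENNReal.toReal_one]
  have hlog : ∀ p : Z × (Fin i → Z), Real.log (ρ p) =
      Real.log (mixLik r (Fin.cons p.1 p.2 : Fin (i + 1) → Z)) - Real.log (mixLik r p.2) := by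
    intro p
    simp only [hρ, mixPred]
    rw [← mixLik_cons,
      Real.log_div (mixLik_pos hpos _).ne' (mixLik_pos hpos _).ne']
  have hmp := measurePreserving_cons (n := i) P
  have hmp2 : MeasurePreserving (Prod.snd : Z × (Fin i → Z) → _) (P.prod Pd) Pd :=
    measurePreserving_snd
  have hI1 := integrable_log_mixLik hr hpos P h_int (i + 1)
  have hI0 := integrable_log_mixLik hr hpos P h_int i
  have hJ1 : Integrable (fun p : Z × (Fin i → Z) =>
      Real.log (mixLik r (Fin.cons p.1 p.2 : Fin (i + 1) → Z))) (P.prod Pd) :=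
    hmp.integrable_comp_of_integrable hI1
  have hJ0 : Integrable (fun p : Z × (Fin i → Z) => Real.log (mixLik r p.2)) (P.prod Pd) :=
    hmp2.integrable_comp_of_integrable hI0
  have hV1 : ∫ p : Z × (Fin i → Z), Real.log (mixLik r (Fin.cons p.1 p.2 : Fin (i + 1) → Z))
      ∂(P.prod Pd) = ∫ d, Real.log (mixLik r d) ∂(Measure.pi fun _ : Fin (i + 1) => P) := by
    rw [← hmp.map_eq, integral_map hmp.aemeasurable (by
      rw [hmp.map_eq]; exact hI1.aestronglyMeasurable)]
  have hV0 : ∫ p : Z × (Fin i → Z), Real.log (mixLik r p.2) ∂(P.prod Pd) =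
      ∫ d, Real.log (mixLik r d) ∂Pd := by
    rw [← hmp2.map_eq, integral_map hmp2.aemeasurable (by
      rw [hmp2.map_eq]; exact hI0.aestronglyMeasurable), hmp2.map_eq]
  have hlogint : Integrable (fun p => Real.log (ρ p)) (P.prod Pd) := by
    simp_rw [hlog]; exact hJ1.sub hJ0
  have hρ1int : Integrable (fun p => ρ p - 1) (P.prod Pd) := hρint.sub (integrable_const _)
  have hnn : ∀ p, 0 ≤ ρ p - 1 - Real.log (ρ p) := fun p =>
    (sq_nonneg _).trans (one_sub_sqrt_sq_le (hρpos p))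
  have hval : ∫ p, (ρ p - 1 - Real.log (ρ p)) ∂(P.prod Pd) =
      ∫ d, Real.log (mixLik r d) ∂Pd -
        ∫ d, Real.log (mixLik r d) ∂(Measure.pi fun _ : Fin (i + 1) => P) := by
    rw [integral_sub hρ1int hlogint,
      integral_sub hρint (integrable_const _), hρval]
    simp_rw [hlog]
    rw [integral_sub hJ1 hJ0, hV1, hV0]
    simp
  refine ⟨∫ p, (ρ p - 1 - Real.log (ρ p)) ∂(P.prod Pd), integral_nonneg hnn, hval, ?_⟩
  rw [ofReal_integral_eq_lintegral_ofReal (f := fun p => ρ p - 1 - Real.log (ρ p))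
    (hρ1int.sub hlogint)
    (ae_of_all _ hnn)]
  have hm : Measurable fun p => ENNReal.ofReal ((1 - √(ρ p)) ^ 2) :=
    (((hρm.sqrt).const_sub 1).pow_const 2).ennreal_ofReal
  rw [← lintegral_prod_symm (fun p => ENNReal.ofReal ((1 - √(ρ p)) ^ 2)) hm.aemeasurable]
  exact lintegral_mono fun p => ENNReal.ofReal_le_ofReal (one_sub_sqrt_sq_le (hρpos p))

/-- Cumulative squared Hellinger risk of mixture prediction. The functions `r j` are the densities
of the candidates with respect to the true law `P`, and `κ` bounds the Kullback-Leibler divergence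
of `P` from the candidate `j₀`. -/
theorem sum_hellinger_mixPred_le (hr : ∀ j, Measurable (r j))
    (hpos : ∀ j z, 0 < r j z) (P : Measure Z) [IsProbabilityMeasure P]
    (hone : ∀ j, ∫⁻ z, ENNReal.ofReal (r j z) ∂P = 1)
    (h_int : ∀ j, Integrable (fun z => Real.log (r j z)) P) {j₀ : J} {κ : ℝ}
    (hκ : -∫ z, Real.log (r j₀ z) ∂P ≤ κ) (n : ℕ) :
    ∑ i ∈ Finset.range n, ∫⁻ d, ∫⁻ z, ENNReal.ofReal ((1 - √(mixPred r d z)) ^ 2) ∂P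
        ∂(Measure.pi fun _ : Fin i => P) ≤
      ENNReal.ofReal (Real.log (Fintype.card J) + n * κ) := by
  have : Nonempty J := ⟨j₀⟩
  choose a ha0 ha hale using hellinger_mixPred_le hr hpos P hone h_int
  refine (Finset.sum_le_sum fun i _ => hale i).trans ?_
  rw [← ENNReal.ofReal_sum_of_nonneg fun i _ => ha0 i]
  refine ENNReal.ofReal_le_ofReal ?_
  simp_rw [ha]
  rw [Finset.sum_range_sub' (fun i => ∫ d, Real.log (mixLik r d)
    ∂(Measure.pi fun _ : Fin i => P))]
  -- The mixture is unnormalised: on the empty sample it equals `card J`, which is where the entropy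
  -- term enters.
  have h0 : ∫ d, Real.log (mixLik r d) ∂(Measure.pi fun _ : Fin 0 => P) =
      Real.log (Fintype.card J) := by
    simp [mixLik]
  -- A sum of positive likelihoods is at least its `j₀` term.
  have hn : n * ∫ z, Real.log (r j₀ z) ∂P ≤
      ∫ d, Real.log (mixLik r d) ∂(Measure.pi fun _ : Fin n => P) := by
    rw [← integral_sum_eval P (h_int j₀)]
    refine integral_mono (integrable_sum_eval P (h_int j₀))
      (integrable_log_mixLik hr hpos P h_int n) fun d => ?_
    simp only
    rw [← Real.log_prod fun k _ => (hpos j₀ _).ne']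
    exact Real.log_le_log (Finset.prod_pos fun _ _ => hpos j₀ _)
      (Finset.single_le_sum (f := fun j => ∏ k, r j (d k))
        (fun j _ => Finset.prod_nonneg fun _ _ => (hpos j _).le) (Finset.mem_univ j₀))
  rw [h0]
  nlinarith [Nat.cast_nonneg (α := ℝ) n]

end Mixture

/-! ### Packings -/

section Packing

variable {X : Type*} [MeasurableSpace X] {ν : Measure X} {h : X → ℝ} {U : Set (X → ℝ)}

theorem l2DistSq_comm (u v : X → ℝ) : l2DistSq ν h u v = l2DistSq ν h v u := by
  unfold l2DistSq
  congr 1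
  ext x
  congr 2
  ring

theorem l2Dist_comm (u v : X → ℝ) : l2Dist ν h u v = l2Dist ν h v u := by
  rw [l2Dist, l2Dist, l2DistSq_comm]

theorem l2Dist_le_ofReal {u v : X → ℝ} {ε : ℝ} (hε : 0 ≤ ε) :
    l2Dist ν h u v ≤ ENNReal.ofReal ε ↔ l2DistSq ν h u v ≤ ENNReal.ofReal (ε ^ 2) := by
  rw [l2Dist, one_div, ENNReal.rpow_inv_le_iff (by norm_num), ENNReal.rpow_ofNat,
    ENNReal.ofReal_pow hε]

/-- A packing of maximal cardinality cannot be enlarged, so it is also a net at the same radius. One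
entropy function thus serves separation and approximation alike. -/
theorem exists_packing (hU : TotallyBoundedL2 ν h U) {ε : ℝ} (hε : 0 < ε) :
    ∃ N : Finset (X → ℝ), (N : Set (X → ℝ)) ⊆ U ∧
      ((N : Set (X → ℝ)).Pairwise fun u v => ENNReal.ofReal (ε ^ 2) < l2DistSq ν h u v) ∧
      (∀ u ∈ U, ∃ v ∈ N, l2DistSq ν h u v ≤ ENNReal.ofReal (ε ^ 2)) ∧
      packingEntropy ν h U ε = Real.log N.card := by
  classical
  let p : Finset (X → ℝ) → Prop := fun N => (N : Set (X → ℝ)) ⊆ U ∧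
    (N : Set (X → ℝ)).Pairwise fun u v => ENNReal.ofReal ε < l2Dist ν h u v
  have hle : ∀ N, p N → (N.card : ℕ∞) ≤ packingNumber ν h U ε := fun N hN =>
    le_iSup_of_le N (le_iSup_of_le hN.1 (le_iSup_of_le hN.2 le_rfl))
  obtain ⟨K, hK⟩ := ENat.ne_top_iff_exists.mp (hU ε hε)
  have hbd : ∀ N, p N → N.card ≤ K := fun N hN => by
    have := hle N hN
    rw [← hK] at this
    exact_mod_cast this
  obtain ⟨k, ⟨N, hN, rfl⟩, hmax⟩ : ∃ k, (∃ N, p N ∧ N.card = k) ∧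
      ∀ N', p N' → N'.card ≤ k := by
    refine ⟨Nat.findGreatest (fun m => ∃ N, p N ∧ N.card = m) K, ?_, ?_⟩
    · exact Nat.findGreatest_spec (P := fun m => ∃ N, p N ∧ N.card = m) (Nat.zero_le K)
        ⟨∅, ⟨by simp, by simp⟩, rfl⟩
    · intro N' hN'
      exact Nat.le_findGreatest (P := fun m => ∃ N, p N ∧ N.card = m) (hbd N' hN')
        ⟨N', hN', rfl⟩
  have hconv : ∀ u v, ENNReal.ofReal ε < l2Dist ν h u v ↔
      ENNReal.ofReal (ε ^ 2) < l2DistSq ν h u v := fun u v => by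
    rw [← not_le, l2Dist_le_ofReal hε.le, not_le]
  refine ⟨N, hN.1, fun u hu v hv huv => (hconv u v).mp (hN.2 hu hv huv), ?_, ?_⟩
  · intro u hu
    by_contra! hcon
    have hcon' : ∀ v ∈ N, ENNReal.ofReal ε < l2Dist ν h u v := fun v hv =>
      (hconv u v).mpr (hcon v hv)
    have hself : l2DistSq ν h u u = 0 := by simp [l2DistSq]
    have huN : u ∉ N := fun hmem => by
      have := hcon u hmem
      rw [hself] at this
      exact not_lt_bot this
    have hp : p (insert u N) := by
      refine ⟨by simpa [Set.insert_subset_iff] using ⟨hu, hN.1⟩, ?_⟩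
      rw [Finset.coe_insert]
      refine hN.2.insert fun v hv _ => ⟨hcon' v hv, ?_⟩
      rw [l2Dist_comm]
      exact hcon' v hv
    have := hmax _ hp
    rw [Finset.card_insert_of_notMem huN] at this
    omega
  · have : packingNumber ν h U ε = N.card := by
      refine le_antisymm ?_ (hle N hN)
      refine iSup_le fun N' => iSup_le fun h1 => iSup_le fun h2 => ?_
      exact_mod_cast hmax N' ⟨h1, h2⟩
    rw [packingEntropy, this, ENat.toNat_natCast]

theorem packingEntropy_nonneg (ε : ℝ) : 0 ≤ packingEntropy ν h U ε := Real.log_natCast_nonneg _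

theorem packingEntropy_antitoneOn (hU : TotallyBoundedL2 ν h U) :
    AntitoneOn (packingEntropy ν h U) (Set.Ioi 0) := by
  intro a ha b hb hab
  have hle : packingNumber ν h U b ≤ packingNumber ν h U a := by
    refine iSup_le fun N => iSup_le fun h1 => iSup_le fun h2 => ?_
    exact le_iSup_of_le N (le_iSup_of_le h1 (le_iSup_of_le
      (h2.mono' fun u v huv => (ENNReal.ofReal_le_ofReal hab).trans_lt huv) le_rfl))
  have hnat : (packingNumber ν h U b).toNat ≤ (packingNumber ν h U a).toNat :=
    ENat.toNat_le_toNat hle (hU a ha)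
  unfold packingEntropy
  -- Cardinality zero arises for empty `U`; then `Real.log 0 = 0` and monotonicity of the logarithm
  -- is not available.
  rcases Nat.eq_zero_or_pos (packingNumber ν h U b).toNat with h0 | h0
  · rw [h0]; simpa using Real.log_natCast_nonneg _
  · exact Real.log_le_log (by exact_mod_cast h0) (by exact_mod_cast hnat)

end Packing

/-! ### Entropy functions -/

section Entropy

variable {E M : ℝ → ℝ}

theorem eventually_nhdsGT_zero {p : ℝ → Prop} (h : ∀ᶠ ε in 𝓝[>] (0 : ℝ), p ε) :
    ∃ δ : ℝ, 0 < δ ∧ ∀ ε, 0 < ε → ε < δ → p ε := by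
  obtain ⟨δ, hδ, hsub⟩ := mem_nhdsGT_iff_exists_Ioo_subset.mp h
  exact ⟨δ, hδ, fun ε h0 h1 => hsub ⟨h0, h1⟩⟩

/-- Richness gains a factor `q > 1` at each rescaling by `α`. The iteration is done for `|M|`, and
only then compared with `E`, so that the comparison constants are lost once and not at every step.
-/
theorem exists_geometric_growth (hE0 : ∀ ε, 0 ≤ E ε) (hM : M =Θ[𝓝[>] (0 : ℝ)] E)
    (hrich : IsRich M) :
    ∃ α q c δ : ℝ, 0 < α ∧ α < 1 ∧ 1 < q ∧ 0 < c ∧ 0 < δ ∧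
      ∀ ε, 0 < ε → ε < δ → 0 < E ε ∧ ∀ k : ℕ, c * q ^ k * E ε ≤ E (α ^ k * ε) := by
  obtain ⟨α, hα0, hα1, hlim⟩ := hrich
  obtain ⟨q, hq1, hq⟩ := EReal.lt_iff_exists_real_btwn.mp hlim
  have hq1' : 1 < q := by exact_mod_cast hq1
  have hev := eventually_lt_of_lt_liminf hq
  obtain ⟨c₁, hc₁, hb₁⟩ := hM.1.exists_pos
  obtain ⟨c₂, hc₂, hb₂⟩ := hM.2.exists_pos
  obtain ⟨δ, hδ, hall⟩ := eventually_nhdsGT_zero (hev.and (hb₁.bound.and hb₂.bound))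
  have hstep : ∀ ε, 0 < ε → ε < δ → 0 < |M ε| ∧ q * |M ε| ≤ |M (α * ε)| := by
    intro ε h0 h1
    have h2 : q < M (α * ε) / M ε := by exact_mod_cast (hall ε h0 h1).1
    -- With `x / 0 = 0`, a zero of `M` would make the quotient `0`, below `q`.
    have hne : M ε ≠ 0 := by
      intro h
      rw [h, div_zero] at h2
      linarith
    have hp := abs_pos.mpr hne
    refine ⟨hp, ?_⟩
    have h3 := h2.le.trans (le_abs_self _)
    rwa [abs_div, le_div_iff₀ hp] at h3
  have hpow : ∀ ε, 0 < ε → ε < δ → ∀ k : ℕ, q ^ k * |M ε| ≤ |M (α ^ k * ε)| := by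
    intro ε h0 h1 k
    induction k with
    | zero => simp
    | succ k ih =>
      have hk1 : α ^ k * ε < δ :=
        (mul_le_of_le_one_left h0.le (pow_le_one₀ hα0.le hα1.le)).trans_lt h1
      have h4 := (hstep _ (by positivity) hk1).2
      rw [pow_succ', pow_succ', mul_assoc, mul_assoc]
      exact (mul_le_mul_of_nonneg_left ih (by linarith)).trans h4
  refine ⟨α, q, 1 / (c₁ * c₂), δ, hα0, hα1, hq1', by positivity, hδ, fun ε h0 h1 => ⟨?_, ?_⟩⟩
  · have h5 := (hall ε h0 h1).2.1
    rw [Real.norm_eq_abs, Real.norm_eq_abs, abs_of_nonneg (hE0 ε)] at h5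
    have h6 := (hstep ε h0 h1).1.trans_le h5
    exact pos_of_mul_pos_right h6 hc₁.le
  · intro k
    have hk0 : 0 < α ^ k * ε := by positivity
    have hk1 : α ^ k * ε < δ :=
      (mul_le_of_le_one_left h0.le (pow_le_one₀ hα0.le hα1.le)).trans_lt h1
    have h5 := (hall _ hk0 hk1).2.1
    have h6 := (hall ε h0 h1).2.2
    rw [Real.norm_eq_abs, Real.norm_eq_abs, abs_of_nonneg (hE0 _)] at h5 h6
    have h7 := hpow ε h0 h1 k
    have hqk : 0 < q ^ k := by positivity
    rw [div_mul_eq_mul_div, one_mul, div_mul_eq_mul_div, div_le_iff₀ (by positivity)]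
    calc q ^ k * E ε ≤ q ^ k * (c₂ * |M ε|) := by gcongr
      _ = c₂ * (q ^ k * |M ε|) := by ring
      _ ≤ c₂ * (c₁ * E (α ^ k * ε)) := mul_le_mul_of_nonneg_left (h7.trans h5) hc₂.le
      _ = _ := by ring

/-- Shrinking the radius by a fixed factor multiplies the entropy by any prescribed constant. The
lower bound uses this to make the packing outnumber the net. -/
theorem exists_scale_mul_le (hE0 : ∀ ε, 0 ≤ E ε) (hM : M =Θ[𝓝[>] (0 : ℝ)] E)
    (hrich : IsRich M) (K : ℝ) :
    ∃ γ : ℝ, 0 < γ ∧ ∀ᶠ ε in 𝓝[>] (0 : ℝ), K * E ε ≤ E (γ * ε) := by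
  obtain ⟨α, q, c, δ, hα0, hα1, hq, hc, hδ, hall⟩ := exists_geometric_growth hE0 hM hrich
  obtain ⟨k, hk⟩ := pow_unbounded_of_one_lt (K / c) hq
  refine ⟨α ^ k, by positivity, ?_⟩
  filter_upwards [Ioo_mem_nhdsGT hδ] with ε hε
  refine le_trans (mul_le_mul_of_nonneg_right ?_ (hE0 ε)) ((hall ε hε.1 hε.2).2 k)
  rw [div_lt_iff₀ hc] at hk
  linarith

theorem tendsto_entropy_atTop (hE0 : ∀ ε, 0 ≤ E ε) (hanti : AntitoneOn E (Set.Ioi 0))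
    (hM : M =Θ[𝓝[>] (0 : ℝ)] E) (hrich : IsRich M) : Tendsto E (𝓝[>] (0 : ℝ)) atTop := by
  obtain ⟨α, q, c, δ, hα0, hα1, hq, hc, hδ, hall⟩ := exists_geometric_growth hE0 hM hrich
  rw [tendsto_atTop]
  intro B
  have hδ2 : 0 < δ / 2 := by positivity
  obtain ⟨hpos, hgrow⟩ := hall (δ / 2) hδ2 (by linarith)
  obtain ⟨k, hk⟩ := pow_unbounded_of_one_lt (B / (c * E (δ / 2))) hq
  have hp : 0 < α ^ k * (δ / 2) := by positivity
  filter_upwards [Ioo_mem_nhdsGT hp] with ε hε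
  refine le_trans ?_ ((hgrow k).trans (hanti hε.1 hp hε.2.le))
  rw [div_lt_iff₀ (by positivity)] at hk
  linarith

theorem exists_le_mul_of_orderRegular (hE0 : ∀ ε, 0 ≤ E ε) (hM : M =Θ[𝓝[>] (0 : ℝ)] E)
    (hreg : IsOrderRegular M) {c : ℝ} (hc : 0 < c) :
    ∃ C : ℝ, 0 < C ∧ ∀ᶠ ε in 𝓝[>] (0 : ℝ), E (c * ε) ≤ C * E ε := by
  have htend : Tendsto (fun ε : ℝ => c * ε) (𝓝[>] 0) (𝓝[>] 0) := by
    refine tendsto_nhdsWithin_iff.mpr ⟨?_, ?_⟩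
    · have : Tendsto (fun ε : ℝ => c * ε) (𝓝 0) (𝓝 (c * 0)) := tendsto_id.const_mul c
      rw [mul_zero] at this
      exact this.mono_left nhdsWithin_le_nhds
    · filter_upwards [self_mem_nhdsWithin] with ε hε
      exact mul_pos hc hε
  have h1 : (fun ε => E (c * ε)) =O[𝓝[>] (0 : ℝ)] E :=
    ((hM.2.comp_tendsto htend).trans (hreg c hc).1).trans hM.1
  obtain ⟨C, hC, hb⟩ := h1.exists_pos
  refine ⟨C, hC, hb.bound.mono fun ε hε => ?_⟩
  rwa [Real.norm_eq_abs, Real.norm_eq_abs, abs_of_nonneg (hE0 _), abs_of_nonneg (hE0 _)] at hε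

/-- The solution is the infimum of the up-closed set where `E ε ≤ n ε²`. The entropy may jump there,
so it is compared with the radii `2 ε` and `ε / 2` on either side, at the cost of a constant from
order regularity and a factor 4. -/
theorem exists_solution (hE0 : ∀ ε, 0 ≤ E ε) (hanti : AntitoneOn E (Set.Ioi 0))
    (hM : M =Θ[𝓝[>] (0 : ℝ)] E) (hrich : IsRich M) (hreg : IsOrderRegular M) :
    ∃ ε : ℕ → ℝ, (∀ᶠ n in atTop, 0 < ε n) ∧
      (fun n => E (ε n)) =Θ[atTop] fun n : ℕ => (n : ℝ) * ε n ^ 2 := by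
  have htop := tendsto_entropy_atTop hE0 hanti hM hrich
  obtain ⟨δ, hδ, h1⟩ := eventually_nhdsGT_zero (htop.eventually_ge_atTop 1)
  let A : ℕ → Set ℝ := fun n => {ε | 0 < ε ∧ E ε ≤ n * ε ^ 2}
  have hbdd : ∀ n, BddBelow (A n) := fun n => ⟨0, fun ε hε => hε.1.le⟩
  have hup : ∀ n a b, a ∈ A n → a ≤ b → b ∈ A n := by
    intro n a b ha hab
    have hb : 0 < b := ha.1.trans_le hab
    refine ⟨hb, (hanti ha.1 hb hab).trans (ha.2.trans ?_)⟩
    have := ha.1.le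
    gcongr
  have hmem : ∀ ε, 0 < ε → ∀ᶠ n : ℕ in atTop, ε ∈ A n := by
    intro ε hε
    filter_upwards [eventually_ge_atTop ⌈E ε / ε ^ 2⌉₊] with n hn
    refine ⟨hε, ?_⟩
    rw [← div_le_iff₀ (by positivity)]
    exact Nat.ceil_le.mp hn
  -- Below `δ` the entropy is at least 1, so membership forces `1 ≤ n ε²`, which fails for `ε < 1 /
  -- (n + 1)`. This keeps the infimum positive.
  have hlow : ∀ n : ℕ, ∀ ε ∈ A n, min (δ / 2) (1 / (n + 1)) ≤ ε := by
    intro n ε hε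
    by_contra! hlt
    rw [lt_min_iff] at hlt
    have h2 := (h1 ε hε.1 (by linarith)).trans hε.2
    have hn : (0 : ℝ) < n + 1 := by positivity
    have h3 : ε * (n + 1) < 1 := by
      have := hlt.2
      rwa [lt_div_iff₀ hn] at this
    have h4 : ε < 1 := by nlinarith [hε.1, Nat.cast_nonneg (α := ℝ) n]
    nlinarith [hε.1, Nat.cast_nonneg (α := ℝ) n, mul_pos hε.1 hε.1,
      mul_nonneg (Nat.cast_nonneg (α := ℝ) n) hε.1.le]
  have hne : ∀ᶠ n : ℕ in atTop, (A n).Nonempty := (hmem 1 one_pos).mono fun n hn => ⟨1, hn⟩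
  have hpos : ∀ᶠ n : ℕ in atTop, 0 < sInf (A n) := by
    filter_upwards [hne] with n hn
    have : (0 : ℝ) < min (δ / 2) (1 / (n + 1)) := by positivity
    exact this.trans_le (le_csInf hn (hlow n))
  have hzero : Tendsto (fun n => sInf (A n)) atTop (𝓝[>] 0) := by
    refine tendsto_nhdsWithin_iff.mpr ⟨?_, hpos⟩
    rw [Metric.tendsto_atTop']
    intro η hη
    obtain ⟨n₀, hn₀⟩ := eventually_atTop.mp ((hmem (η / 2) (by positivity)).and hpos)
    refine ⟨n₀, fun n hn => ?_⟩
    obtain ⟨h2, h3⟩ := hn₀ n hn.le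
    rw [Real.dist_eq, sub_zero, abs_of_pos h3]
    linarith [csInf_le (hbdd n) h2]
  have hout : ∀ n, ∀ a, 0 < a → a < sInf (A n) → (n : ℝ) * a ^ 2 ≤ E a := by
    intro n a ha hlt
    by_contra! hcon
    exact absurd (csInf_le (hbdd n) (show a ∈ A n from ⟨ha, hcon.le⟩)) (not_le.mpr hlt)
  have hin : ∀ n, (A n).Nonempty → ∀ a, sInf (A n) < a → a ∈ A n := by
    intro n hn a ha
    obtain ⟨b, hb, hba⟩ := exists_lt_of_csInf_lt hn ha
    exact hup n b a hb hba.le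
  -- The factor `1/4` carries `2 ε` to `ε / 2`, straddling the infimum.
  obtain ⟨C, hC, hCev⟩ := exists_le_mul_of_orderRegular hE0 hM hreg (c := 1 / 4) (by norm_num)
  have htwo : Tendsto (fun n => 2 * sInf (A n)) atTop (𝓝[>] 0) := by
    have h2 := tendsto_nhdsWithin_iff.mp hzero
    refine tendsto_nhdsWithin_iff.mpr ⟨by simpa using h2.1.const_mul 2, ?_⟩
    filter_upwards [hpos] with n hn
    exact mul_pos two_pos hn
  refine ⟨fun n => sInf (A n), hpos, ?_, ?_⟩
  · refine IsBigO.of_bound (4 * C) ?_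
    filter_upwards [hpos, hne, htwo.eventually hCev] with n h0 h2 h3
    have h4 := (hin n h2 (2 * sInf (A n)) (by linarith)).2
    have h5 : E (sInf (A n)) ≤ E (1 / 4 * (2 * sInf (A n))) :=
      hanti (show (0 : ℝ) < _ by linarith) h0 (by linarith)
    rw [Real.norm_eq_abs, Real.norm_eq_abs, abs_of_nonneg (hE0 _), abs_of_nonneg (by positivity)]
    calc E (sInf (A n)) ≤ C * E (2 * sInf (A n)) := h5.trans h3
      _ ≤ C * (n * (2 * sInf (A n)) ^ 2) := by gcongr
      _ = _ := by ring
  · refine IsBigO.of_bound (4 * C) ?_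
    filter_upwards [hpos, htwo.eventually hCev] with n h0 h3
    have h6 : E (2 * sInf (A n)) ≤ E (sInf (A n)) :=
      hanti h0 (show (0 : ℝ) < _ by linarith) (by linarith)
    have h7 := hout n (1 / 4 * (2 * sInf (A n))) (by linarith) (by linarith)
    rw [Real.norm_eq_abs, Real.norm_eq_abs, abs_of_nonneg (hE0 _), abs_of_nonneg (by positivity)]
    nlinarith [mul_le_mul_of_nonneg_left h6 hC.le]

/-- Along indices with `ε n ≥ η` the entropy stays below `E η`, while `n ε²` is at least `n η²` and
diverges. -/
theorem tendsto_zero_of_solution (hE0 : ∀ ε, 0 ≤ E ε) (hanti : AntitoneOn E (Set.Ioi 0))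
    {ε : ℕ → ℝ} (hε : ∀ᶠ n in atTop, 0 < ε n)
    (hsol : (fun n => E (ε n)) =Θ[atTop] fun n : ℕ => (n : ℝ) * ε n ^ 2) :
    Tendsto ε atTop (𝓝[>] 0) := by
  refine tendsto_nhdsWithin_iff.mpr ⟨?_, hε⟩
  obtain ⟨C, hC, hb⟩ := hsol.2.exists_pos
  rw [Metric.tendsto_atTop']
  intro η hη
  obtain ⟨n₀, hn₀⟩ := eventually_atTop.mp ((hb.bound.and hε).and
    (eventually_gt_atTop ⌈C * E η / η ^ 2⌉₊))
  refine ⟨n₀, fun n hn => ?_⟩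
  obtain ⟨⟨h1, h2⟩, h3⟩ := hn₀ n hn.le
  rw [Real.norm_eq_abs, Real.norm_eq_abs, abs_of_nonneg (hE0 _),
    abs_of_nonneg (by positivity)] at h1
  rw [Real.dist_eq, sub_zero, abs_of_pos h2]
  by_contra! hcon
  have h4 : E (ε n) ≤ E η := hanti hη h2 hcon
  have h5 : C * E η / η ^ 2 < n := (Nat.lt_of_ceil_lt h3)
  rw [div_lt_iff₀ (by positivity)] at h5
  have h6 : (n : ℝ) * η ^ 2 ≤ n * ε n ^ 2 := by gcongr
  nlinarith [mul_le_mul_of_nonneg_left h4 hC.le]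

end Entropy

/-! ### Location-scale families of densities -/

/-- The density of `m + s ε` when `ε` has density `f`. -/
noncomputable def lsPDF (f : ℝ → ℝ) (m s y : ℝ) : ℝ := f ((y - m) / s) / s

/-- The regularity properties of an error density which determine the minimax rate: positivity,
and a square integrable envelope for the Lipschitz constants of the log-densities of the
associated location-scale family on compact parameter sets. -/
structure IsRegularError (f : ℝ → ℝ) : Prop where
  measurable : Measurable f
  pos : ∀ y, 0 < f y
  lintegral_eq_one : ∫⁻ y, ENNReal.ofReal (f y) = 1
  lower : ∀ R : ℝ, ∃ c : ℝ, 0 < c ∧ ∀ y, |y| ≤ R → c ≤ f y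
  envelope : ∀ J b : ℝ, 1 < b → ∃ (G : ℝ → ℝ) (C : ℝ), Measurable G ∧ (∀ y, 0 ≤ G y) ∧ 0 ≤ C ∧
    (∀ m m' s s' : ℝ, |m| ≤ J → |m'| ≤ J → b⁻¹ ≤ s → s ≤ b → b⁻¹ ≤ s' → s' ≤ b → ∀ y,
      |Real.log (lsPDF f m s y) - Real.log (lsPDF f m' s' y)| ≤
        (|m - m'| + |s - s'|) * G y) ∧
    ∀ m s : ℝ, |m| ≤ J → b⁻¹ ≤ s → s ≤ b →
      ∫⁻ y, ENNReal.ofReal (G y ^ 2) * ENNReal.ofReal (lsPDF f m s y) ≤ ENNReal.ofReal C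

/-- The substitution is a measurable equivalence, so `k` need not be measurable. -/
theorem lintegral_affine (k : ℝ → ENNReal) (m : ℝ) {s : ℝ} (hs : 0 < s) :
    ∫⁻ e, k (m + s * e) = ENNReal.ofReal s⁻¹ * ∫⁻ y, k y := by
  have h1 : ∫⁻ e, k (m + s * e) = ∫⁻ y, k (m + y) ∂(Measure.map (s * ·) volume) :=
    (lintegral_map_equiv (fun y => k (m + y))
      (Homeomorph.mulLeft₀ s hs.ne').toMeasurableEquiv).symm
  rw [h1, Real.map_volume_mul_left hs.ne', lintegral_smul_measure,
    lintegral_add_left_eq_self k m, abs_of_pos (inv_pos.mpr hs), smul_eq_mul]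

theorem lintegral_lsPDF_mul {f : ℝ → ℝ} (k : ℝ → ENNReal) (m : ℝ) {s : ℝ} (hs : 0 < s) :
    ∫⁻ y, k y * ENNReal.ofReal (lsPDF f m s y) = ∫⁻ e, k (m + s * e) * ENNReal.ofReal (f e) := by
  have h := lintegral_affine (fun y => k y * ENNReal.ofReal (f ((y - m) / s))) m hs
  have h2 : ∀ e, (m + s * e - m) / s = e := fun e => by field_simp; ring
  simp only [h2] at h
  rw [h, ← lintegral_const_mul' _ _ ENNReal.ofReal_ne_top]
  refine lintegral_congr fun y => ?_
  rw [lsPDF, div_eq_mul_inv, mul_comm (f _), ENNReal.ofReal_mul (inv_pos.mpr hs).le]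
  ring

/-- The conditional density of the response given the covariate. -/
noncomputable def condPDF {X : Type*} (f : ℝ → ℝ) (μ σ : X → ℝ) (z : X × ℝ) : ℝ :=
  lsPDF f (μ z.1) (σ z.1) z.2

theorem condPDF_pos {X : Type*} {f : ℝ → ℝ} {μ σ : X → ℝ} (hf : ∀ y, 0 < f y)
    (hσ : ∀ x, 0 < σ x) (z : X × ℝ) : 0 < condPDF f μ σ z :=
  div_pos (hf _) (hσ _)

section Model

variable {X : Type*} [MeasurableSpace X] {ν : Measure X} {f : ℝ → ℝ} {μ μ' σ σ' h : X → ℝ}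

theorem measurable_condPDF (hf : Measurable f) (hμ : Measurable μ) (hσ : Measurable σ) :
    Measurable (condPDF f μ σ) :=
  (hf.comp ((measurable_snd.sub (hμ.comp measurable_fst)).div (hσ.comp measurable_fst))).div
    (hσ.comp measurable_fst)

theorem isProbabilityMeasure_errorLaw (hf : IsRegularError f) :
    IsProbabilityMeasure (errorLaw f) :=
  ⟨by rw [errorLaw, withDensity_apply _ MeasurableSet.univ, Measure.restrict_univ,
    hf.lintegral_eq_one]⟩

theorem isProbabilityMeasure_withDensity (hh : IsProbDensity ν h) :
    IsProbabilityMeasure (ν.withDensity fun x => ENNReal.ofReal (h x)) :=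
  ⟨by rw [withDensity_apply _ MeasurableSet.univ, Measure.restrict_univ, hh.2.2]⟩

theorem measurable_obs (hμ : Measurable μ) (hσ : Measurable σ) :
    Measurable fun p : X × ℝ => (p.1, μ p.1 + σ p.1 * p.2) :=
  measurable_fst.prodMk ((hμ.comp measurable_fst).add
    ((hσ.comp measurable_fst).mul measurable_snd))

theorem isProbabilityMeasure_obsLaw (hf : IsRegularError f) (hμ : Measurable μ)
    (hσ : Measurable σ) (hh : IsProbDensity ν h) : IsProbabilityMeasure (obsLaw ν f μ σ h) := by
  have := isProbabilityMeasure_errorLaw hf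
  have := isProbabilityMeasure_withDensity hh
  exact Measure.isProbabilityMeasure_map (measurable_obs hμ hσ).aemeasurable

/-- Tonelli together with the substitution `y = μ(x) + σ(x) e` on each fibre. The iterated form
avoids any finiteness condition on `ν`. -/
theorem lintegral_obsLaw (hf : IsRegularError f) (hμ : Measurable μ)
    (hσ : Measurable σ) (hσ0 : ∀ x, 0 < σ x) (hh : IsProbDensity ν h) {k : X × ℝ → ENNReal}
    (hk : Measurable k) :
    ∫⁻ z, k z ∂(obsLaw ν f μ σ h) = ∫⁻ x, ENNReal.ofReal (h x) *
      (∫⁻ y, k (x, y) * ENNReal.ofReal (condPDF f μ σ (x, y))) ∂ν := by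
  have := isProbabilityMeasure_errorLaw hf
  have := isProbabilityMeasure_withDensity hh
  rw [obsLaw, lintegral_map hk (measurable_obs hμ hσ),
    lintegral_prod (fun p : X × ℝ => k (p.1, μ p.1 + σ p.1 * p.2))
      (hk.comp (measurable_obs hμ hσ)).aemeasurable]
  have hin : ∀ x, ∫⁻ e, k (x, μ x + σ x * e) ∂(errorLaw f) =
      ∫⁻ y, k (x, y) * ENNReal.ofReal (condPDF f μ σ (x, y)) := by
    intro x
    have hkx : Measurable fun e => k (x, μ x + σ x * e) := by fun_prop
    simp only [condPDF]
    rw [lintegral_lsPDF_mul (fun y => k (x, y)) (μ x) (hσ0 x), errorLaw,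
      lintegral_withDensity_eq_lintegral_mul _ hf.measurable.ennreal_ofReal hkx]
    exact lintegral_congr fun e => mul_comm _ _
  simp only [hin]
  have hm : Measurable fun x => ∫⁻ y, k (x, y) * ENNReal.ofReal (condPDF f μ σ (x, y)) :=
    (hk.mul (measurable_condPDF hf.measurable hμ hσ).ennreal_ofReal).lintegral_prod_right'
  rw [lintegral_withDensity_eq_lintegral_mul _ hh.1.ennreal_ofReal hm]
  rfl

/-- The common factor `h` cancels: the likelihood ratio involves the conditional densities alone.
This is why the estimator can ignore the covariate density. -/
theorem obsLaw_eq_withDensity (hf : IsRegularError f) (hμ : Measurable μ) (hσ : Measurable σ)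
    (hσ0 : ∀ x, 0 < σ x) (hμ' : Measurable μ') (hσ' : Measurable σ') (hσ0' : ∀ x, 0 < σ' x)
    (hh : IsProbDensity ν h) :
    obsLaw ν f μ' σ' h = (obsLaw ν f μ σ h).withDensity fun z =>
      ENNReal.ofReal (condPDF f μ' σ' z / condPDF f μ σ z) := by
  have hp := measurable_condPDF hf.measurable hμ hσ
  have hp' := measurable_condPDF hf.measurable hμ' hσ'
  have hr : Measurable fun z => ENNReal.ofReal (condPDF f μ' σ' z / condPDF f μ σ z) :=
    (hp'.div hp).ennreal_ofReal
  ext s hs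
  rw [withDensity_apply _ hs, ← lintegral_indicator hs, ← lintegral_indicator_one hs,
    lintegral_obsLaw hf hμ hσ hσ0 hh (hr.indicator hs),
    lintegral_obsLaw hf hμ' hσ' hσ0' hh (measurable_one.indicator hs)]
  refine lintegral_congr fun x => ?_
  congr 1
  refine lintegral_congr fun y => ?_
  by_cases hxy : (x, y) ∈ s
  · rw [Set.indicator_of_mem hxy, Set.indicator_of_mem hxy, Pi.one_apply, one_mul,
      ← ENNReal.ofReal_mul (div_pos (condPDF_pos hf.pos hσ0' _) (condPDF_pos hf.pos hσ0 _)).le,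
      div_mul_cancel₀ _ (condPDF_pos hf.pos hσ0 _).ne']
  · simp [hxy]

/-- Makes the divergence quadratic in the log-ratio. Under `p`, the weight `1 + r` becomes `p + p'`,
so second moments of the envelope under the two laws suffice and no bound on `r` itself is needed.
-/
theorem neg_log_sub_one_add_le {r : ℝ} (hr : 0 < r) :
    -Real.log r - 1 + r ≤ Real.log r ^ 2 * (1 + r) := by
  have h1 := Real.log_le_sub_one_of_pos hr
  have h2 := Real.one_sub_inv_le_log_of_pos hr
  have h3 : r - 1 ≤ r * Real.log r := by
    have := mul_le_mul_of_nonneg_left h2 hr.le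
    rwa [mul_sub, mul_one, mul_inv_cancel₀ hr.ne'] at this
  rcases le_total 0 (Real.log r) with h | h
  · nlinarith [mul_nonneg h (sub_nonneg.mpr h3), sq_nonneg (Real.log r)]
  · nlinarith [mul_nonneg (neg_nonneg.mpr h) (sub_nonneg.mpr h1),
      mul_nonneg (sq_nonneg (Real.log r)) hr.le]

/-- The Kullback-Leibler divergence between two laws of the model is at most of the order of the
squared `L₂` distance of the parameters. -/
theorem exists_kl_le (hf : IsRegularError f) (J : ℝ) {b : ℝ} (hb : 1 < b) :
    ∃ K : ℝ, 0 ≤ K ∧ ∀ (μ μ' σ σ' h : X → ℝ), Measurable μ → Measurable μ' → Measurable σ →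
      Measurable σ' → (∀ x, |μ x| ≤ J) → (∀ x, |μ' x| ≤ J) → (∀ x, b⁻¹ ≤ σ x ∧ σ x ≤ b) →
      (∀ x, b⁻¹ ≤ σ' x ∧ σ' x ≤ b) → IsProbDensity ν h →
      Integrable (fun z => Real.log (condPDF f μ' σ' z / condPDF f μ σ z)) (obsLaw ν f μ σ h) ∧
      ∀ D : ℝ, 0 ≤ D → l2DistSq ν h μ μ' + l2DistSq ν h σ σ' ≤ ENNReal.ofReal D →
        -∫ z, Real.log (condPDF f μ' σ' z / condPDF f μ σ z) ∂(obsLaw ν f μ σ h) ≤ K * D := by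
  obtain ⟨G, C, hGm, hG0, hC0, hlip, hGC⟩ := hf.envelope J b hb
  have hb0 : 0 < b⁻¹ := inv_pos.mpr (by linarith)
  -- One factor 2 comes from `(a + b)² ≤ 2a² + 2b²`, the other from integrating the envelope under
  -- both laws.
  refine ⟨4 * C, by positivity, ?_⟩
  intro μ μ' σ σ' h hμ hμ' hσ hσ' hμJ hμJ' hσb hσb' hh
  have hσ0 : ∀ x, 0 < σ x := fun x => hb0.trans_le (hσb x).1
  have hσ0' : ∀ x, 0 < σ' x := fun x => hb0.trans_le (hσb' x).1
  set p := condPDF f μ σ with hp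
  set p' := condPDF f μ' σ' with hp'
  have hpm : Measurable p := measurable_condPDF hf.measurable hμ hσ
  have hpm' : Measurable p' := measurable_condPDF hf.measurable hμ' hσ'
  have hp0 : ∀ z, 0 < p z := condPDF_pos hf.pos hσ0
  have hp0' : ∀ z, 0 < p' z := condPDF_pos hf.pos hσ0'
  have hr0 : ∀ z, 0 < p' z / p z := fun z => div_pos (hp0' z) (hp0 z)
  have hrm : Measurable fun z => p' z / p z := hpm'.div hpm
  set P := obsLaw ν f μ σ h with hP
  have hPprob : IsProbabilityMeasure P := isProbabilityMeasure_obsLaw hf hμ hσ hh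
  have hr1 : ∫⁻ z, ENNReal.ofReal (p' z / p z) ∂P = 1 := by
    have h1 := obsLaw_eq_withDensity hf hμ hσ hσ0 hμ' hσ' hσ0' hh
    have := isProbabilityMeasure_obsLaw hf hμ' hσ' hh
    have h2 : obsLaw ν f μ' σ' h Set.univ = 1 := measure_univ
    rwa [h1, withDensity_apply _ MeasurableSet.univ, Measure.restrict_univ] at h2
  have hrint : Integrable (fun z => p' z / p z) P := by
    refine ⟨hrm.aestronglyMeasurable, ?_⟩
    rw [hasFiniteIntegral_iff_ofReal (ae_of_all _ fun d => (hr0 d).le), hr1]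
    exact ENNReal.one_lt_top
  have hrval : ∫ z, p' z / p z ∂P = 1 := by
    rw [integral_eq_lintegral_of_nonneg_ae (ae_of_all _ fun d => (hr0 d).le)
      hrm.aestronglyMeasurable, hr1, ENNReal.toReal_one]
  have hlog : ∀ z, |Real.log (p' z / p z)| ≤
      (|μ z.1 - μ' z.1| + |σ z.1 - σ' z.1|) * G z.2 := by
    intro z
    rw [Real.log_div (hp0' z).ne' (hp0 z).ne', abs_sub_comm]
    exact hlip _ _ _ _ (hμJ _) (hμJ' _) (hσb _).1 (hσb _).2 (hσb' _).1 (hσb' _).2 _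
  have hG2 : ∫⁻ z, ENNReal.ofReal (G z.2 ^ 2) ∂P ≤ ENNReal.ofReal C := by
    rw [hP, lintegral_obsLaw hf hμ hσ hσ0 hh (k := fun z => ENNReal.ofReal (G z.2 ^ 2))
      (((hGm.comp measurable_snd).pow_const 2).ennreal_ofReal)]
    calc _ ≤ ∫⁻ x, ENNReal.ofReal (h x) * ENNReal.ofReal C ∂ν := by
          refine lintegral_mono fun x => ?_
          exact mul_le_mul_right (hGC _ _ (hμJ x) (hσb x).1 (hσb x).2) _
      _ = ENNReal.ofReal C := by
          rw [lintegral_mul_const _ hh.1.ennreal_ofReal, hh.2.2, one_mul]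
  have hG2int : Integrable (fun z : X × ℝ => G z.2 ^ 2) P := by
    refine ⟨((hGm.comp measurable_snd).pow_const 2).aestronglyMeasurable, ?_⟩
    rw [hasFiniteIntegral_iff_ofReal (ae_of_all _ fun d => sq_nonneg _)]
    exact hG2.trans_lt ENNReal.ofReal_lt_top
  have hlogint : Integrable (fun z => Real.log (p' z / p z)) P := by
    have hdom : Integrable (fun z : X × ℝ => (2 * J + 2 * b) * (1 + G z.2 ^ 2)) P :=
      ((integrable_const 1).add hG2int).const_mul _
    refine hdom.mono' hrm.log.aestronglyMeasurable (ae_of_all _ fun z => (hlog z).trans ?_)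
    have h1 : |μ z.1 - μ' z.1| ≤ 2 * J := by
      linarith [abs_sub (μ z.1) (μ' z.1), hμJ z.1, hμJ' z.1]
    have h2 : |σ z.1 - σ' z.1| ≤ 2 * b := by
      rw [abs_le]
      constructor <;> linarith [hσb z.1, hσb' z.1, hσ0 z.1, hσ0' z.1]
    have h3 : G z.2 ≤ 1 + G z.2 ^ 2 := by nlinarith [sq_nonneg (G z.2 - 1)]
    have h4 := abs_nonneg (μ z.1 - μ' z.1)
    exact mul_le_mul (by linarith) h3 (hG0 _) (by linarith)
  refine ⟨hlogint, fun D hD0 hD => ?_⟩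
  have hnn : ∀ z, 0 ≤ -Real.log (p' z / p z) - 1 + p' z / p z := fun z => by
    linarith [Real.log_le_sub_one_of_pos (hr0 z)]
  have hneg : Integrable (fun z => -Real.log (p' z / p z)) P := hlogint.neg
  have hnl : Integrable (fun z => -Real.log (p' z / p z) - 1) P :=
    hneg.sub (integrable_const _)
  -- Adding the mean-zero term `r - 1` makes the integrand nonnegative without changing the
  -- divergence.
  have hval : ∫ z, (-Real.log (p' z / p z) - 1 + p' z / p z) ∂P =
      -∫ z, Real.log (p' z / p z) ∂P := by
    rw [integral_add hnl hrint, integral_sub hneg (integrable_const _), integral_neg, hrval]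
    simp
  rw [← hval, integral_eq_lintegral_of_nonneg_ae (ae_of_all _ hnn)
    (hnl.add hrint).aestronglyMeasurable]
  refine ENNReal.toReal_le_of_le_ofReal (by positivity) ?_
  let Δ : X → ℝ := fun x => (μ x - μ' x) ^ 2 + (σ x - σ' x) ^ 2
  have hΔ0 : ∀ x, 0 ≤ Δ x := fun x => by positivity
  have hΔm : Measurable Δ := ((hμ.sub hμ').pow_const 2).add ((hσ.sub hσ').pow_const 2)
  let k : X × ℝ → ENNReal := fun z =>
    ENNReal.ofReal (2 * Δ z.1) * ENNReal.ofReal (G z.2 ^ 2) * ENNReal.ofReal (1 + p' z / p z)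
  have hkm : Measurable k :=
    (((hΔm.comp measurable_fst).const_mul 2).ennreal_ofReal.mul
      ((hGm.comp measurable_snd).pow_const 2).ennreal_ofReal).mul (hrm.const_add 1).ennreal_ofReal
  have hpt : ∀ z, ENNReal.ofReal (-Real.log (p' z / p z) - 1 + p' z / p z) ≤ k z := by
    intro z
    simp only [k]
    rw [← ENNReal.ofReal_mul (by have := hΔ0 z.1; positivity), ← ENNReal.ofReal_mul
      (by have := hΔ0 z.1; positivity)]
    refine ENNReal.ofReal_le_ofReal ((neg_log_sub_one_add_le (hr0 z)).trans ?_)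
    refine mul_le_mul_of_nonneg_right ?_ (by linarith [hr0 z])
    have h1 : Real.log (p' z / p z) ^ 2 ≤
        ((|μ z.1 - μ' z.1| + |σ z.1 - σ' z.1|) * G z.2) ^ 2 := by
      rw [← sq_abs (Real.log _)]
      exact pow_le_pow_left₀ (abs_nonneg _) (hlog z) 2
    refine h1.trans ?_
    rw [mul_pow]
    refine mul_le_mul_of_nonneg_right ?_ (sq_nonneg _)
    simp only [Δ]
    rw [← sq_abs (μ z.1 - μ' z.1), ← sq_abs (σ z.1 - σ' z.1)]
    nlinarith [sq_nonneg (|μ z.1 - μ' z.1| - |σ z.1 - σ' z.1|)]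
  refine (lintegral_mono hpt).trans ?_
  rw [hP, lintegral_obsLaw hf hμ hσ hσ0 hh hkm]
  have hinner : ∀ x, ∫⁻ y, k (x, y) * ENNReal.ofReal (condPDF f μ σ (x, y)) ≤
      ENNReal.ofReal (2 * Δ x) * ENNReal.ofReal (2 * C) := by
    intro x
    have hsplit : ∀ y, k (x, y) * ENNReal.ofReal (condPDF f μ σ (x, y)) =
        ENNReal.ofReal (2 * Δ x) *
          (ENNReal.ofReal (G y ^ 2) * ENNReal.ofReal (lsPDF f (μ x) (σ x) y) +
          ENNReal.ofReal (G y ^ 2) * ENNReal.ofReal (lsPDF f (μ' x) (σ' x) y)) := by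
      intro y
      have h1 : ENNReal.ofReal (1 + p' (x, y) / p (x, y)) * ENNReal.ofReal (p (x, y)) =
          ENNReal.ofReal (lsPDF f (μ x) (σ x) y) + ENNReal.ofReal (lsPDF f (μ' x) (σ' x) y) := by
        have e1 : lsPDF f (μ x) (σ x) y = p (x, y) := rfl
        have e2 : lsPDF f (μ' x) (σ' x) y = p' (x, y) := rfl
        rw [e1, e2, ← ENNReal.ofReal_mul (by linarith [hr0 (x, y)]),
          ← ENNReal.ofReal_add (hp0 _).le (hp0' _).le, add_mul, one_mul,
          div_mul_cancel₀ _ (hp0 _).ne']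
      simp only [k]
      rw [mul_assoc, h1]
      ring
    have hm1 : Measurable fun y => ENNReal.ofReal (G y ^ 2) *
        ENNReal.ofReal (lsPDF f (μ x) (σ x) y) :=
      (hGm.pow_const 2).ennreal_ofReal.mul (hpm.comp measurable_prodMk_left).ennreal_ofReal
    rw [lintegral_congr hsplit, lintegral_const_mul' _ _ ENNReal.ofReal_ne_top,
      lintegral_add_left hm1, two_mul C, ENNReal.ofReal_add hC0 hC0]
    exact mul_le_mul_right (add_le_add (hGC _ _ (hμJ x) (hσb x).1 (hσb x).2)
      (hGC _ _ (hμJ' x) (hσb' x).1 (hσb' x).2)) _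
  have hdist : ∫⁻ x, ENNReal.ofReal (Δ x * h x) ∂ν = l2DistSq ν h μ μ' + l2DistSq ν h σ σ' := by
    rw [l2DistSq, l2DistSq, ← lintegral_add_left
      (f := fun x => ENNReal.ofReal ((μ x - μ' x) ^ 2 * h x)) (((hμ.sub hμ').pow_const 2).mul hh.1).ennreal_ofReal]
    refine lintegral_congr fun x => ?_
    rw [← ENNReal.ofReal_add (mul_nonneg (sq_nonneg _) (hh.2.1 x))
      (mul_nonneg (sq_nonneg _) (hh.2.1 x)), ← add_mul]
  calc _ ≤ ∫⁻ x, ENNReal.ofReal (4 * C) * ENNReal.ofReal (Δ x * h x) ∂ν := by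
        refine lintegral_mono fun x => (mul_le_mul_right (hinner x) _).trans (le_of_eq ?_)
        have := hΔ0 x
        rw [← ENNReal.ofReal_mul (by positivity), ← ENNReal.ofReal_mul (hh.2.1 x),
          ← ENNReal.ofReal_mul (by positivity)]
        congr 1
        ring
    _ ≤ ENNReal.ofReal (4 * C) * ENNReal.ofReal D := by
        rw [lintegral_const_mul' _ _ ENNReal.ofReal_ne_top, hdist]
        exact mul_le_mul_right hD _
    _ = ENNReal.ofReal (4 * C * D) := (ENNReal.ofReal_mul (by positivity)).symm

end Model

/-! ### Lower bound -/

section Lower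

variable {X : Type*} [MeasurableSpace X] {ν : Measure X} {f : ℝ → ℝ}

theorem l2DistSq_le_two_mul {h u v w : X → ℝ} (hh : IsProbDensity ν h) (hu : Measurable u)
    (hw : Measurable w) :
    l2DistSq ν h u v ≤ 2 * l2DistSq ν h u w + 2 * l2DistSq ν h v w := by
  have hm : Measurable fun x => ENNReal.ofReal ((u x - w x) ^ 2 * h x) :=
    (((hu.sub hw).pow_const 2).mul hh.1).ennreal_ofReal
  rw [l2DistSq, l2DistSq, l2DistSq, ← lintegral_const_mul' _ _ ENNReal.ofNat_ne_top,
    ← lintegral_const_mul' _ _ ENNReal.ofNat_ne_top, ← lintegral_add_left (hm.const_mul 2)]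
  refine lintegral_mono fun x => ?_
  have h2 : (2 : ENNReal) = ENNReal.ofReal 2 := by simp
  have hx := hh.2.1 x
  rw [h2, ← ENNReal.ofReal_mul zero_le_two, ← ENNReal.ofReal_mul zero_le_two,
    ← ENNReal.ofReal_add (by positivity) (by positivity)]
  refine ENNReal.ofReal_le_ofReal ?_
  nlinarith [mul_nonneg (sq_nonneg ((u x - w x) + (v x - w x))) hx]

theorem measurable_l2DistSq [SFinite ν] {D : Type*} [MeasurableSpace D] {h u : X → ℝ}
    {m : D → X → ℝ} (hh : Measurable h) (hu : Measurable u)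
    (hm : Measurable (Function.uncurry m)) : Measurable fun d => l2DistSq ν h u (m d) := by
  have : Measurable fun p : D × X => ENNReal.ofReal ((u p.2 - m p.1 p.2) ^ 2 * h p.2) :=
    ((((hu.comp measurable_snd).sub hm).pow_const 2).mul
      (hh.comp measurable_snd)).ennreal_ofReal
  exact this.lintegral_prod_right'

theorem sum_real_le_one {Ω ι : Type*} [MeasurableSpace Ω] (P : Measure Ω) [IsProbabilityMeasure P]
    (s : Finset ι) {A : ι → Set Ω} (hA : ∀ i ∈ s, MeasurableSet (A i))
    (hd : (s : Set ι).PairwiseDisjoint A) : ∑ i ∈ s, P.real (A i) ≤ 1 := by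
  rw [← measureReal_biUnion_finset hd hA]
  exact measureReal_le_one

/-- Only `μ` varies here. If the estimator were within `η / 2` of each `u ∈ N` with probability
above `1/2`, then transferring these disjoint events to the neighbouring laws in `N'` would exceed
the total mass available to them. -/
theorem ofReal_le_minimaxRisk [SFinite ν] {U S H : Set (X → ℝ)} (hf : IsRegularError f) {J b : ℝ}
    (hb : 0 < b) (hU : ∀ μ ∈ U, Measurable μ) (hUb : ∀ μ ∈ U, ∀ x, |μ x| ≤ J) {σ h : X → ℝ}
    (hσS : σ ∈ S) (hσ : Measurable σ) (hσb : ∀ x, b⁻¹ ≤ σ x ∧ σ x ≤ b) (hhH : h ∈ H)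
    (hh : IsProbDensity ν h) {K : ℝ}
    (hKL : ∀ (μ μ' σ σ' h : X → ℝ), Measurable μ → Measurable μ' → Measurable σ →
      Measurable σ' → (∀ x, |μ x| ≤ J) → (∀ x, |μ' x| ≤ J) → (∀ x, b⁻¹ ≤ σ x ∧ σ x ≤ b) →
      (∀ x, b⁻¹ ≤ σ' x ∧ σ' x ≤ b) → IsProbDensity ν h →
      Integrable (fun z => Real.log (condPDF f μ' σ' z / condPDF f μ σ z)) (obsLaw ν f μ σ h) ∧
      ∀ D : ℝ, 0 ≤ D → l2DistSq ν h μ μ' + l2DistSq ν h σ σ' ≤ ENNReal.ofReal D →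
        -∫ z, Real.log (condPDF f μ' σ' z / condPDF f μ σ z) ∂(obsLaw ν f μ σ h) ≤ K * D)
    (hK : 0 ≤ K) {n : ℕ} {δ η : ℝ} {N N' : Finset (X → ℝ)} (hN : (N : Set (X → ℝ)) ⊆ U)
    (hN' : (N' : Set (X → ℝ)) ⊆ U)
    (hpack : (N : Set (X → ℝ)).Pairwise fun u v => ENNReal.ofReal (η ^ 2) < l2DistSq ν h u v)
    (hcov : ∀ u ∈ U, ∃ v ∈ N', l2DistSq ν h u v ≤ ENNReal.ofReal (δ ^ 2)) (hNpos : 0 < N.card)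
    (hcard : Real.exp (4 * (1 + n * (K * δ ^ 2))) * N'.card ≤ N.card / 4) :
    ENNReal.ofReal (η ^ 2 / 8) ≤ minimaxRisk ν f U S H n := by
  classical
  refine le_iInf fun m => le_iInf fun hm => ?_
  have hσ0 : ∀ x, 0 < σ x := fun x => (inv_pos.mpr hb).trans_le (hσb x).1
  -- Chosen so that the error `(1 + n κ) / t` of the change of measure is exactly `1/4`.
  set t : ℝ := 4 * (1 + n * (K * δ ^ 2)) with ht
  have ht0 : 0 < t := by positivity
  let P : (X → ℝ) → Measure (Fin n → X × ℝ) := fun μ =>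
    Measure.pi fun _ : Fin n => obsLaw ν f μ σ h
  have hprob : ∀ μ ∈ U, IsProbabilityMeasure (obsLaw ν f μ σ h) := fun μ hμ =>
    isProbabilityMeasure_obsLaw hf (hU μ hμ) hσ hh
  have hPprob : ∀ μ ∈ U, IsProbabilityMeasure (P μ) := fun μ hμ => by
    have := hprob μ hμ
    infer_instance
  let A : (X → ℝ) → Set (Fin n → X × ℝ) := fun μ =>
    {d | l2DistSq ν h μ (m d) < ENNReal.ofReal (η ^ 2 / 4)}
  have hAm : ∀ μ ∈ U, MeasurableSet (A μ) := fun μ hμ =>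
    measurableSet_lt (measurable_l2DistSq hh.1 (hU μ hμ) hm) measurable_const
  -- With threshold `η² / 4`, the quasi-triangle inequality with factor 2 returns exactly `η²`,
  -- contradicting the strict separation.
  have hdisj : (N : Set (X → ℝ)).PairwiseDisjoint A := by
    intro u hu v hv huv
    refine Set.disjoint_left.mpr fun d hdu hdv => ?_
    have h1 : l2DistSq ν h u v ≤ ENNReal.ofReal (η ^ 2) := by
      refine (l2DistSq_le_two_mul hh (hU u (hN hu))
        (hm.comp measurable_prodMk_left : Measurable (m d))).trans ?_
      have h2 : (2 : ENNReal) = ENNReal.ofReal 2 := by simp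
      calc _ ≤ 2 * ENNReal.ofReal (η ^ 2 / 4) + 2 * ENNReal.ofReal (η ^ 2 / 4) :=
            add_le_add (mul_le_mul_right (le_of_lt hdu) _) (mul_le_mul_right (le_of_lt hdv) _)
        _ = ENNReal.ofReal (η ^ 2) := by
            rw [h2, ← ENNReal.ofReal_mul zero_le_two, ← ENNReal.ofReal_add (by positivity)
              (by positivity)]
            congr 1
            ring
    exact absurd (hpack hu hv huv) (not_lt.mpr h1)
  choose! k hkN hkd using hcov
  have hchange : ∀ u ∈ N, (P u).real (A u) ≤ Real.exp t * (P (k u)).real (A u) + 1 / 4 := by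
    intro u hu
    have huU := hN hu
    have hkU := hN' (hkN u huU)
    have := hprob u huU
    have := hprob (k u) hkU
    obtain ⟨h_int, hkl⟩ := hKL u (k u) σ σ h (hU _ huU) (hU _ hkU) hσ hσ (hUb _ huU) (hUb _ hkU)
      hσb hσb hh
    have h0 : l2DistSq ν h σ σ = 0 := by simp [l2DistSq]
    have hkl' := hkl (δ ^ 2) (sq_nonneg _) (by rw [h0, add_zero]; exact hkd u huU)
    have h1 := pi_real_le_exp_mul_add (obsLaw ν f u σ h) (obsLaw ν f (k u) σ h)
      ((measurable_condPDF hf.measurable (hU _ hkU) hσ).div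
        (measurable_condPDF hf.measurable (hU _ huU) hσ))
      (fun z => div_pos (condPDF_pos hf.pos hσ0 z) (condPDF_pos hf.pos hσ0 z))
      (obsLaw_eq_withDensity hf (hU _ huU) hσ hσ0 (hU _ hkU) hσ hσ0 hh) h_int hkl' n
      (hAm u huU) ht0
    refine h1.trans (add_le_add_right (le_of_eq ?_) _)
    rw [ht]
    have : (1 : ℝ) + n * (K * δ ^ 2) ≠ 0 := by positivity
    field_simp
  -- Enlarging to the sum over all `v ∈ N'` makes the bound independent of `|N|`: each law gives
  -- disjoint events total mass at most 1.
  have hsum : ∑ u ∈ N, (P (k u)).real (A u) ≤ N'.card := by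
    calc ∑ u ∈ N, (P (k u)).real (A u) ≤ ∑ u ∈ N, ∑ v ∈ N', (P v).real (A u) :=
          Finset.sum_le_sum fun u hu =>
            Finset.single_le_sum (f := fun v => (P v).real (A u))
              (fun _ _ => measureReal_nonneg) (hkN u (hN hu))
      _ = ∑ v ∈ N', ∑ u ∈ N, (P v).real (A u) := Finset.sum_comm
      _ ≤ ∑ _v ∈ N', (1 : ℝ) := Finset.sum_le_sum fun v hv => by
          have := hPprob v (hN' hv)
          exact sum_real_le_one (P v) N (fun u hu => hAm u (hN hu)) hdisj
      _ = N'.card := by simp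
  have htotal : ∑ u ∈ N, (P u).real (A u) ≤ ∑ _u ∈ N, (1 / 2 : ℝ) := by
    calc ∑ u ∈ N, (P u).real (A u) ≤ ∑ u ∈ N, (Real.exp t * (P (k u)).real (A u) + 1 / 4) :=
          Finset.sum_le_sum hchange
      _ = Real.exp t * ∑ u ∈ N, (P (k u)).real (A u) + N.card / 4 := by
          rw [Finset.sum_add_distrib, ← Finset.mul_sum, Finset.sum_const, nsmul_eq_mul]
          ring
      _ ≤ Real.exp t * N'.card + N.card / 4 := by gcongr
      _ ≤ N.card / 4 + N.card / 4 := by gcongr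
      _ = _ := by rw [Finset.sum_const, nsmul_eq_mul]; ring
  obtain ⟨u, hu, hu2⟩ := Finset.exists_le_of_sum_le (Finset.card_pos.mp hNpos) htotal
  have huU := hN hu
  have := hPprob u huU
  have hcompl : ENNReal.ofReal (1 / 2) ≤ P u (A u)ᶜ := by
    rw [← ofReal_measureReal, probReal_compl_eq_one_sub (hAm u huU)]
    exact ENNReal.ofReal_le_ofReal (by linarith)
  have hrisk : ENNReal.ofReal (η ^ 2 / 8) ≤ risk ν f n m u σ h := by
    calc ENNReal.ofReal (η ^ 2 / 8) = ENNReal.ofReal (η ^ 2 / 4) * ENNReal.ofReal (1 / 2) := by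
          rw [← ENNReal.ofReal_mul (by positivity)]
          congr 1
          ring
      _ ≤ ENNReal.ofReal (η ^ 2 / 4) * P u (A u)ᶜ := mul_le_mul_right hcompl _
      _ ≤ ∫⁻ d in (A u)ᶜ, l2DistSq ν h u (m d) ∂(P u) := by
          rw [← setLIntegral_const]
          exact setLIntegral_mono (measurable_l2DistSq hh.1 (hU u huU) hm) fun d hd =>
            not_lt.mp hd
      _ ≤ risk ν f n m u σ h := setLIntegral_le_lintegral _ _
  exact hrisk.trans (le_iSup₂_of_le u huU (le_iSup₂_of_le σ hσS (le_iSup₂_of_le h hhH le_rfl)))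

theorem exists_minimaxRisk_ge [SFinite ν] {U S H : Set (X → ℝ)} (hf : IsRegularError f)
    {J b : ℝ} (hb : 1 < b) (hU : ∀ μ ∈ U, Measurable μ) (hUb : ∀ μ ∈ U, ∀ x, |μ x| ≤ J)
    {σ h : X → ℝ} (hσS : σ ∈ S) (hσ : Measurable σ) (hσb : ∀ x, b⁻¹ ≤ σ x ∧ σ x ≤ b)
    (hhH : h ∈ H) (hh : IsProbDensity ν h) (hTB : TotallyBoundedL2 ν h U) {M : ℝ → ℝ}
    (hM : M =Θ[𝓝[>] (0 : ℝ)] packingEntropy ν h U) (hrich : IsRich M) {ε : ℕ → ℝ}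
    (hε : SolvesEntropyEquation ν h U ε) :
    ∃ c : ℝ, 0 < c ∧ ∀ᶠ n in atTop, ENNReal.ofReal (c * ε n ^ 2) ≤ minimaxRisk ν f U S H n := by
  obtain ⟨K, hK, hKL⟩ := exists_kl_le (ν := ν) hf J hb
  have hE0 := packingEntropy_nonneg (ν := ν) (h := h) (U := U)
  have hanti := packingEntropy_antitoneOn hTB
  have hε0 := tendsto_zero_of_solution hE0 hanti hε.1 hε.2
  have htop := (tendsto_entropy_atTop hE0 hanti hM hrich).comp hε0
  obtain ⟨C, hC, hCb⟩ := hε.2.2.exists_pos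
  -- The packing must satisfy `log |N| ≥ 4 + 4 n K ε² + log |N'| + log 4`. Here `n ε² ≤ C E(ε)`
  -- contributes `4KC`, `log |N'| = E(ε)` contributes 1, and `4 + log 4 ≤ E(ε)` eventually
  -- contributes the other 1.
  obtain ⟨γ, hγ, hγev⟩ := exists_scale_mul_le hE0 hM hrich (2 + 4 * K * C)
  refine ⟨γ ^ 2 / 8, by positivity, ?_⟩
  filter_upwards [hε.1, hε0.eventually hγev, hCb.bound,
    htop.eventually_ge_atTop (4 + Real.log 4)] with n h0 h1 h2 h3
  simp only [Function.comp] at h3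
  rw [Real.norm_eq_abs, Real.norm_eq_abs, abs_of_nonneg (hE0 _),
    abs_of_nonneg (by positivity)] at h2
  obtain ⟨N, hN, hpack, -, hNlog⟩ := exists_packing hTB (mul_pos hγ h0)
  obtain ⟨N', hN', -, hcov, hNlog'⟩ := exists_packing hTB h0
  have hlog4 : 0 ≤ Real.log 4 := Real.log_nonneg (by norm_num)
  have hEN : 0 < Real.log N.card := by
    rw [← hNlog]
    have : 0 ≤ 4 * K * C := by positivity
    nlinarith
  have hNpos : 0 < N.card := by
    rcases Nat.eq_zero_or_pos N.card with h4 | h4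
    · rw [h4] at hEN; simp at hEN
    · exact h4
  have hNpos' : 0 < N'.card := by
    rcases Nat.eq_zero_or_pos N'.card with h4 | h4
    · rw [hNlog', h4] at h3
      simp at h3
      linarith
    · exact h4
  have hcard : Real.exp (4 * (1 + n * (K * ε n ^ 2))) * N'.card ≤ N.card / 4 := by
    have hc' : (0 : ℝ) < N'.card := by exact_mod_cast hNpos'
    have hc : (0 : ℝ) < N.card := by exact_mod_cast hNpos
    rw [← Real.log_le_log_iff (by positivity) (by positivity),
      Real.log_mul (Real.exp_pos _).ne' hc'.ne', Real.log_exp, Real.log_div hc.ne' (by norm_num),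
      ← hNlog, ← hNlog']
    nlinarith [mul_le_mul_of_nonneg_left h2 hK]
  have := ofReal_le_minimaxRisk (H := H) hf (by linarith) hU hUb hσS hσ hσb hhH hh hKL hK hN hN'
    hpack hcov hNpos hcard
  refine le_trans (le_of_eq ?_) this
  congr 1
  ring

end Lower

/-! ### Inversion of distribution functions -/

section Quantile

variable {f : ℝ → ℝ}

/-- The distribution function of the error grows at least linearly away from its quantile. -/
theorem exists_cdf_growth (hf : IsRegularError f) {τ : ℝ} (hτ0 : 0 < τ) (hτ1 : τ < 1)
    (hq : quantile (errorLaw f) τ = 0) (R : ℝ) :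
    ∃ c : ℝ, 0 < c ∧ ∀ u : ℝ, |u| ≤ R →
      (0 < u → τ + c * u ≤ (errorLaw f).real (Set.Iic u)) ∧
      (u < 0 → (errorLaw f).real (Set.Iic u) ≤ τ + c * u) := by
  have hprob := isProbabilityMeasure_errorLaw hf
  obtain ⟨c, hc, hfc⟩ := hf.lower R
  set F : ℝ → ℝ := fun u => (errorLaw f).real (Set.Iic u) with hF
  have hinc : ∀ u v, |u| ≤ R → |v| ≤ R → u ≤ v → F u + c * (v - u) ≤ F v := by
    intro u v hu hv huv
    have h1 : F v = F u + (errorLaw f).real (Set.Ioc u v) := by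
      rw [hF]
      simp only
      rw [← measureReal_union (Set.Iic_disjoint_Ioc le_rfl) measurableSet_Ioc,
        Set.Iic_union_Ioc_eq_Iic huv]
    rw [h1]
    gcongr
    have h2 : ENNReal.ofReal (c * (v - u)) ≤ errorLaw f (Set.Ioc u v) := by
      rw [errorLaw, withDensity_apply _ measurableSet_Ioc, ENNReal.ofReal_mul hc.le,
        ← Real.volume_Ioc, ← setLIntegral_const]
      refine setLIntegral_mono hf.measurable.ennreal_ofReal fun y hy =>
        ENNReal.ofReal_le_ofReal (hfc y ?_)
      rw [abs_le] at hu hv ⊢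
      exact ⟨hu.1.trans hy.1.le, hy.2.trans hv.2⟩
    have h3 := ENNReal.toReal_mono (measure_ne_top _ _) h2
    rwa [ENNReal.toReal_ofReal (mul_nonneg hc.le (sub_nonneg.mpr huv))] at h3
  set A : Set ℝ := {y : ℝ | ENNReal.ofReal τ ≤ errorLaw f (Set.Iic y)} with hA
  have hAiff : ∀ y, y ∈ A ↔ τ ≤ F y := fun y =>
    ENNReal.ofReal_le_iff_le_toReal (measure_ne_top _ _)
  have hmono : Monotone F := fun a b hab =>
    measureReal_mono (Set.Iic_subset_Iic.mpr hab) (measure_ne_top _ _)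
  have hne : A.Nonempty := by
    have h1 := tendsto_measure_Iic_atTop (errorLaw f)
    rw [measure_univ] at h1
    have h2 : ENNReal.ofReal τ < 1 := by
      rw [← ENNReal.ofReal_one]
      exact (ENNReal.ofReal_lt_ofReal_iff one_pos).mpr hτ1
    obtain ⟨y, hy⟩ := (h1.eventually_const_lt h2).exists
    exact ⟨y, hy.le⟩
  have hbdd : BddBelow A := by
    obtain ⟨y, hy⟩ :=
      ((ProbabilityTheory.tendsto_cdf_atBot (errorLaw f)).eventually_lt_const hτ0).exists
    rw [ProbabilityTheory.cdf_eq_real] at hy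
    refine ⟨y, fun a ha => ?_⟩
    by_contra! hlt
    exact absurd (((hAiff a).mp ha).trans (hmono hlt.le)) (not_le.mpr hy)
  have hinf : sInf A = 0 := hq
  -- The infimum determines the side of `τ` only at points away from 0, so the increment is taken
  -- from `u / 2` to `u`, halving the constant.
  refine ⟨c / 2, by positivity, fun u hu => ⟨fun h0 => ?_, fun h0 => ?_⟩⟩
  · obtain ⟨a, ha, hau⟩ := exists_lt_of_csInf_lt hne (show sInf A < u / 2 by rw [hinf]; linarith)
    have h1 := ((hAiff a).mp ha).trans (hmono hau.le)
    have h2 := hinc (u / 2) u (by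
      rw [abs_of_pos (by linarith)]; rw [abs_of_pos h0] at hu; linarith) hu (by linarith)
    change τ + c / 2 * u ≤ F u
    linarith
  · have h1 : u / 2 ∉ A := notMem_of_lt_csInf (by rw [hinf]; linarith) hbdd
    rw [hAiff, not_le] at h1
    have h2 := hinc u (u / 2) hu (by
      rw [abs_of_neg (by linarith)]; rw [abs_of_neg h0] at hu; linarith) (by linarith)
    change F u ≤ τ + c / 2 * u
    linarith

/-- The `τ`-th quantile of the distribution function `F`, truncated to `[-J, J]`. -/
noncomputable def truncQuantile (τ J : ℝ) (F : ℝ → ENNReal) : ℝ :=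
  -J + (volume {t | t ∈ Set.Ioc (-J) J ∧ F t < ENNReal.ofReal τ}).toReal

/-- The sublevel set contains `(-J, m - δ/c)` and lies in `(-J, m + δ/c]`, so its length fixes the
quantile up to `δ / c`. No monotonicity of `F'` is needed. -/
theorem abs_truncQuantile_sub_le {τ J m c δ : ℝ} (hτ : 0 < τ) (hc : 0 < c) (hδ : 0 ≤ δ)
    (hm : |m| ≤ J) {F : ℝ → ℝ} {F' : ℝ → ENNReal} (hF0 : ∀ t, 0 ≤ F t)
    (hup : ∀ t ∈ Set.Ioc (-J) J, m < t → τ + c * (t - m) ≤ F t)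
    (hdown : ∀ t ∈ Set.Ioc (-J) J, t < m → F t ≤ τ + c * (t - m))
    (h1 : ∀ t, F' t ≤ ENNReal.ofReal (F t) + ENNReal.ofReal δ)
    (h2 : ∀ t, ENNReal.ofReal (F t) ≤ F' t + ENNReal.ofReal δ) :
    |truncQuantile τ J F' - m| ≤ δ / c := by
  rw [abs_le] at hm
  set B : Set ℝ := {t | t ∈ Set.Ioc (-J) J ∧ F' t < ENNReal.ofReal τ} with hB
  have hdc : 0 ≤ δ / c := by positivity
  have hsub1 : B ⊆ Set.Ioc (-J) (m + δ / c) := by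
    rintro t ⟨ht, hlt⟩
    refine ⟨ht.1, ?_⟩
    by_contra! hcon
    have h3 : τ + c * (t - m) ≤ F t := hup t ht (by linarith)
    have h4 : ENNReal.ofReal (F t) ≤ ENNReal.ofReal (τ + δ) := by
      rw [ENNReal.ofReal_add hτ.le hδ]
      exact (h2 t).trans (add_le_add_left hlt.le _)
    have h5 := (ENNReal.ofReal_le_ofReal_iff (by linarith)).mp h4
    have h6 : δ / c < t - m := by linarith
    rw [div_lt_iff₀ hc] at h6
    linarith
  have hsub2 : Set.Ioo (-J) (m - δ / c) ⊆ B := by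
    intro t ht
    have htm : t < m := by linarith [ht.2]
    have htJ : t ∈ Set.Ioc (-J) J := ⟨ht.1, by linarith⟩
    refine ⟨htJ, ?_⟩
    have h3 := hdown t htJ htm
    have h6 : δ / c < m - t := by linarith [ht.2]
    rw [div_lt_iff₀ hc] at h6
    refine (h1 t).trans_lt ?_
    rw [← ENNReal.ofReal_add (hF0 t) hδ, ENNReal.ofReal_lt_ofReal_iff hτ]
    linarith
  have hv1 : (volume B).toReal ≤ m + δ / c + J := by
    refine ENNReal.toReal_le_of_le_ofReal (by linarith) ((measure_mono hsub1).trans ?_)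
    rw [Real.volume_Ioc, sub_neg_eq_add]
  have hBfin : volume B ≠ ⊤ := ((measure_mono hsub1).trans_lt (by
    rw [Real.volume_Ioc]; exact ENNReal.ofReal_lt_top)).ne
  have hv2 : m - δ / c + J ≤ (volume B).toReal := by
    rw [← ENNReal.ofReal_le_iff_le_toReal hBfin]
    refine le_trans (le_of_eq ?_) (measure_mono hsub2)
    rw [Real.volume_Ioo, sub_neg_eq_add]
  rw [truncQuantile, abs_le]
  constructor <;> linarith

/-- Defining the quantile as a length and not as an infimum pays off here: the measure of a section
is measurable in the parameter. -/
theorem measurable_truncQuantile {D : Type*} [MeasurableSpace D] {F : D → ℝ → ENNReal} (τ J : ℝ)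
    (hF : Measurable (Function.uncurry F)) : Measurable fun d => truncQuantile τ J (F d) := by
  have hs : MeasurableSet {p : D × ℝ | p.2 ∈ Set.Ioc (-J) J ∧
      Function.uncurry F p < ENNReal.ofReal τ} :=
    (measurable_snd measurableSet_Ioc).inter (measurableSet_lt hF measurable_const)
  exact ((measurable_measure_prodMk_left (ν := volume) hs).ennreal_toReal).const_add (-J)

end Quantile

/-! ### Total variation and Hellinger distance -/

/-- Cauchy-Schwarz for `|p - q| = |√p - √q| (√p + √q)`; the second factor has squared `L₂` norm at
most 4. -/
theorem sq_lintegral_abs_sub_le {Ω : Type*} [MeasurableSpace Ω] {ν : Measure Ω} {p q : Ω → ℝ}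
    (hp : Measurable p) (hq : Measurable q) (hp0 : ∀ y, 0 ≤ p y) (hq0 : ∀ y, 0 ≤ q y)
    (hp1 : ∫⁻ y, ENNReal.ofReal (p y) ∂ν = 1) (hq1 : ∫⁻ y, ENNReal.ofReal (q y) ∂ν = 1) :
    (∫⁻ y, ENNReal.ofReal |p y - q y| ∂ν) ^ 2 ≤
      4 * ∫⁻ y, ENNReal.ofReal ((√(p y) - √(q y)) ^ 2) ∂ν := by
  have hu : Measurable fun y => ENNReal.ofReal |√(p y) - √(q y)| :=
    (hp.sqrt.sub hq.sqrt).abs.ennreal_ofReal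
  have hv : Measurable fun y => ENNReal.ofReal (√(p y) + √(q y)) :=
    (hp.sqrt.add hq.sqrt).ennreal_ofReal
  have hCS := ENNReal.lintegral_mul_le_Lp_mul_Lq ν Real.HolderConjugate.two_two hu.aemeasurable
    hv.aemeasurable
  have hprod : ∀ y, ((fun y => ENNReal.ofReal |√(p y) - √(q y)|) *
      fun y => ENNReal.ofReal (√(p y) + √(q y))) y = ENNReal.ofReal |p y - q y| := by
    intro y
    rw [Pi.mul_apply, ← ENNReal.ofReal_mul (abs_nonneg _)]
    congr 1
    have h1 : 0 ≤ √(p y) + √(q y) := by positivity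
    have h2 : p y - q y = (√(p y) - √(q y)) * (√(p y) + √(q y)) := by
      nlinarith [Real.sq_sqrt (hp0 y), Real.sq_sqrt (hq0 y)]
    rw [h2, abs_mul, abs_of_nonneg h1]
  simp only [ENNReal.rpow_ofNat] at hCS
  rw [lintegral_congr hprod] at hCS
  have hvv : ∫⁻ y, ENNReal.ofReal (√(p y) + √(q y)) ^ 2 ∂ν ≤ 4 := by
    calc ∫⁻ y, ENNReal.ofReal (√(p y) + √(q y)) ^ 2 ∂ν
        ≤ ∫⁻ y, (2 * ENNReal.ofReal (p y) + 2 * ENNReal.ofReal (q y)) ∂ν := by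
          refine lintegral_mono fun y => ?_
          have h2 : (2 : ENNReal) = ENNReal.ofReal 2 := by simp
          rw [h2, ← ENNReal.ofReal_mul zero_le_two, ← ENNReal.ofReal_mul zero_le_two,
            ← ENNReal.ofReal_add (mul_nonneg zero_le_two (hp0 y))
              (mul_nonneg zero_le_two (hq0 y)),
            ← ENNReal.ofReal_pow (by positivity)]
          refine ENNReal.ofReal_le_ofReal ?_
          nlinarith [Real.sq_sqrt (hp0 y), Real.sq_sqrt (hq0 y), sq_nonneg (√(p y) - √(q y))]
      _ = 4 := by
          rw [lintegral_add_left (hp.ennreal_ofReal.const_mul 2),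
            lintegral_const_mul _ hp.ennreal_ofReal, lintegral_const_mul _ hq.ennreal_ofReal,
            hp1, hq1]
          norm_num
  have huu : ∫⁻ y, ENNReal.ofReal |√(p y) - √(q y)| ^ 2 ∂ν =
      ∫⁻ y, ENNReal.ofReal ((√(p y) - √(q y)) ^ 2) ∂ν := by
    refine lintegral_congr fun y => ?_
    rw [← ENNReal.ofReal_pow (abs_nonneg _), sq_abs]
  have hsq : ∀ a : ENNReal, (a ^ (1 / 2 : ℝ)) ^ 2 = a := fun a => by
    rw [← ENNReal.rpow_ofNat, ← ENNReal.rpow_mul]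
    norm_num
  calc _ ≤ ((∫⁻ y, ENNReal.ofReal |√(p y) - √(q y)| ^ 2 ∂ν) ^ (1 / 2 : ℝ) *
        (∫⁻ y, ENNReal.ofReal (√(p y) + √(q y)) ^ 2 ∂ν) ^ (1 / 2 : ℝ)) ^ 2 :=
        pow_le_pow_left' hCS 2
    _ = (∫⁻ y, ENNReal.ofReal |√(p y) - √(q y)| ^ 2 ∂ν) *
        ∫⁻ y, ENNReal.ofReal (√(p y) + √(q y)) ^ 2 ∂ν := by rw [mul_pow, hsq, hsq]
    _ ≤ _ := by
        rw [huu, mul_comm]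
        exact mul_le_mul_left hvv _

theorem setLIntegral_ofReal_le_add {Ω : Type*} [MeasurableSpace Ω] {ν : Measure Ω} {p q : Ω → ℝ}
    (hq : Measurable q) (s : Set Ω) :
    ∫⁻ y in s, ENNReal.ofReal (p y) ∂ν ≤
      ∫⁻ y in s, ENNReal.ofReal (q y) ∂ν + ∫⁻ y, ENNReal.ofReal |p y - q y| ∂ν := by
  calc ∫⁻ y in s, ENNReal.ofReal (p y) ∂ν
      ≤ ∫⁻ y in s, (ENNReal.ofReal (q y) + ENNReal.ofReal |p y - q y|) ∂ν :=
        lintegral_mono fun y => (ENNReal.ofReal_le_ofReal (by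
          linarith [le_abs_self (p y - q y)])).trans ENNReal.ofReal_add_le
    _ = ∫⁻ y in s, ENNReal.ofReal (q y) ∂ν + ∫⁻ y in s, ENNReal.ofReal |p y - q y| ∂ν :=
        lintegral_add_left hq.ennreal_ofReal _
    _ ≤ _ := add_le_add_right (setLIntegral_le_lintegral _ _) _

/-! ### Upper bound -/

section Upper

variable {X : Type*} [MeasurableSpace X] {ν : Measure X} {f : ℝ → ℝ} {J : Type*} [Fintype J]

/-- The conditional distribution function of the predictive mixture of conditional densities. -/
noncomputable def predCDF (g : J → X × ℝ → ℝ) {i : ℕ} (d : Fin i → X × ℝ) (x : X) (t : ℝ) :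
    ENNReal :=
  ∫⁻ y in Set.Iic t, ENNReal.ofReal (mixPred g d (x, y))

/-- The truncated conditional quantile of the predictive mixture. -/
noncomputable def predEst (τ B : ℝ) (g : J → X × ℝ → ℝ) {i : ℕ} (d : Fin i → X × ℝ) (x : X) : ℝ :=
  truncQuantile τ B (predCDF g d x)

/-- The average of the predictive quantile estimators based on the initial segments of the
sample. -/
noncomputable def avgEst (τ B : ℝ) (g : J → X × ℝ → ℝ) {n : ℕ} (d : Fin n → X × ℝ) (x : X) : ℝ :=
  (∑ i : Fin n, predEst τ B g (fun k : Fin i => d (Fin.castLE i.isLt.le k)) x) / n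

theorem measurable_predEst (τ B : ℝ) {g : J → X × ℝ → ℝ} (hg : ∀ j, Measurable (g j)) (i : ℕ) :
    Measurable fun p : (Fin i → X × ℝ) × X => predEst τ B g p.1 p.2 := by
  refine measurable_truncQuantile τ B (F := fun p : (Fin i → X × ℝ) × X => predCDF g p.1 p.2) ?_
  have hmix : Measurable fun q : (((Fin i → X × ℝ) × X) × ℝ) × ℝ =>
      ENNReal.ofReal (mixPred g q.1.1.1 (q.1.1.2, q.2)) := by
    have hpair : Measurable fun q : (((Fin i → X × ℝ) × X) × ℝ) × ℝ =>
        ((q.1.1.1, (q.1.1.2, q.2)) : (Fin i → X × ℝ) × (X × ℝ)) := by fun_prop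
    exact (Measurable.comp (g := fun p : (Fin i → X × ℝ) × (X × ℝ) => mixPred g p.1 p.2)
      (measurable_mixPred hg i) hpair).ennreal_ofReal
  have hs : MeasurableSet {q : (((Fin i → X × ℝ) × X) × ℝ) × ℝ | q.2 ≤ q.1.2} :=
    measurableSet_le measurable_snd (measurable_snd.comp measurable_fst)
  have h_int := (hmix.indicator hs).lintegral_prod_right' (ν := volume)
  have heq : Function.uncurry (fun p : (Fin i → X × ℝ) × X => predCDF g p.1 p.2) = fun p =>
      ∫⁻ y, {q : (((Fin i → X × ℝ) × X) × ℝ) × ℝ | q.2 ≤ q.1.2}.indicator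
        (fun q => ENNReal.ofReal (mixPred g q.1.1.1 (q.1.1.2, q.2))) (p, y) := by
    funext p
    simp only [Function.uncurry, predCDF]
    rw [← lintegral_indicator measurableSet_Iic]
    rfl
  rw [heq]
  exact h_int

theorem measurable_predEst_comp_castLE (τ B : ℝ) {g : J → X × ℝ → ℝ} (hg : ∀ j, Measurable (g j))
    {i n : ℕ} (hi : i ≤ n) :
    Measurable fun p : (Fin n → X × ℝ) × X =>
      predEst τ B g (fun k : Fin i => p.1 (Fin.castLE hi k)) p.2 := by
  have hpair : Measurable fun p : (Fin n → X × ℝ) × X =>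
      ((fun k : Fin i => p.1 (Fin.castLE hi k), p.2) : (Fin i → X × ℝ) × X) :=
    (measurable_pi_lambda _ fun k =>
      (measurable_pi_apply (Fin.castLE hi k)).comp measurable_fst).prodMk measurable_snd
  have hcomp := (measurable_predEst τ B hg i).comp hpair
  simp only [Function.comp_def] at hcomp
  exact hcomp

theorem measurable_avgEst (τ B : ℝ) {g : J → X × ℝ → ℝ} (hg : ∀ j, Measurable (g j)) (n : ℕ) :
    Measurable (Function.uncurry (avgEst τ B g : (Fin n → X × ℝ) → X → ℝ)) := by
  have hsum : Measurable fun p : (Fin n → X × ℝ) × X =>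
      ∑ i : Fin n, predEst τ B g (fun k : Fin i => p.1 (Fin.castLE i.isLt.le k)) p.2 :=
    Finset.measurable_fun_sum _ fun i _ => measurable_predEst_comp_castLE τ B hg i.isLt.le
  exact hsum.div_const _

/-- Dividing every candidate by the same `p` scales all likelihoods equally, and the normalisation
cancels it. The estimator is therefore free of the true density, while its analysis can use ratios
to the truth. -/
theorem mixPred_div_mul {Z : Type*} {g : J → Z → ℝ} {p : Z → ℝ} (hp : ∀ z, 0 < p z) {i : ℕ}
    (d : Fin i → Z) (z : Z) :
    mixPred (fun j z => g j z / p z) d z * p z = mixPred g d z := by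
  have hP : (∏ k, p (d k)) ≠ 0 := (Finset.prod_pos fun k _ => hp _).ne'
  have hz := (hp z).ne'
  simp only [mixPred, mixLik, Finset.prod_div_distrib]
  have h1 : ∀ j, (∏ k, g j (d k)) / (∏ k, p (d k)) * (g j z / p z) =
      ((∏ k, g j (d k)) * g j z) / ((∏ k, p (d k)) * p z) := fun j => by field_simp
  simp only [h1]
  rw [← Finset.sum_div, ← Finset.sum_div]
  field_simp

theorem lintegral_lsPDF (hf : IsRegularError f) (m : ℝ) {s : ℝ} (hs : 0 < s) :
    ∫⁻ y, ENNReal.ofReal (lsPDF f m s y) = 1 := by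
  have h := lintegral_lsPDF_mul (f := f) (fun _ => 1) m hs
  simpa [hf.lintegral_eq_one] using h

theorem setLIntegral_Iic_lsPDF (m : ℝ) {s : ℝ} (hs : 0 < s) (t : ℝ) :
    ∫⁻ y in Set.Iic t, ENNReal.ofReal (lsPDF f m s y) = errorLaw f (Set.Iic ((t - m) / s)) := by
  have h := lintegral_lsPDF_mul (f := f) ((Set.Iic t).indicator 1) m hs
  rw [errorLaw, withDensity_apply _ measurableSet_Iic, ← lintegral_indicator measurableSet_Iic,
    ← lintegral_indicator measurableSet_Iic]
  have hmem : ∀ e, m + s * e ≤ t ↔ e ≤ (t - m) / s := fun e => by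
    rw [le_div_iff₀ hs]
    constructor <;> intro h <;> linarith
  have e1 : ∀ y, (Set.Iic t).indicator 1 y * ENNReal.ofReal (lsPDF f m s y) =
      (Set.Iic t).indicator (fun y => ENNReal.ofReal (lsPDF f m s y)) y := fun y => by
    by_cases hy : y ≤ t <;> simp [Set.indicator, hy]
  have e2 : ∀ e, (Set.Iic t).indicator 1 (m + s * e) * ENNReal.ofReal (f e) =
      (Set.Iic ((t - m) / s)).indicator (fun e => ENNReal.ofReal (f e)) e := fun e => by
    by_cases he : e ≤ (t - m) / s
    · simp [Set.indicator, he, (hmem e).mpr he]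
    · simp [Set.indicator, he, mt (hmem e).mp he]
  simpa only [e1, e2] using h

/-- The error of the predictive quantile is controlled by the Hellinger distance between the true
and the predictive conditional densities. -/
theorem exists_predEst_sq_le (hf : IsRegularError f) {τ : ℝ} (hτ0 : 0 < τ) (hτ1 : τ < 1)
    (hq : quantile (errorLaw f) τ = 0) (B : ℝ) {b : ℝ} (hb : 1 < b) :
    ∃ C : ℝ, 0 < C ∧ ∀ (J : Type _) [Fintype J] [Nonempty J] (m s : J → X → ℝ) (μ σ : X → ℝ),
      (∀ j, Measurable (m j)) → (∀ j, Measurable (s j)) → (∀ j x, 0 < s j x) → Measurable μ →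
      Measurable σ → (∀ x, |μ x| ≤ B) → (∀ x, b⁻¹ ≤ σ x ∧ σ x ≤ b) →
      ∀ (i : ℕ) (d : Fin i → X × ℝ) (x : X),
      ENNReal.ofReal ((μ x - predEst τ B (fun j => condPDF f (m j) (s j)) d x) ^ 2) ≤
        ENNReal.ofReal C * ∫⁻ y, ENNReal.ofReal ((1 - √(mixPred (fun j z =>
          condPDF f (m j) (s j) z / condPDF f μ σ z) d (x, y))) ^ 2) *
          ENNReal.ofReal (condPDF f μ σ (x, y)) := by
  -- For `t` in the truncation window, `|t - μ x| ≤ 2B` and `1 / σ x ≤ b`, which gives the range `2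
  -- B b` of standardised arguments.
  obtain ⟨c₀, hc₀, hgrow⟩ := exists_cdf_growth hf hτ0 hτ1 hq (2 * B * b)
  have hb0 : 0 < b := by linarith
  set c := c₀ / b with hc
  have hc0 : 0 < c := by positivity
  refine ⟨4 / c ^ 2, by positivity, ?_⟩
  intro J _ _ m s μ σ hm hs hs0 hμ hσ hμB hσb i d x
  have hσ0 : ∀ x, 0 < σ x := fun x => (inv_pos.mpr hb0).trans_le (hσb x).1
  have hprob := isProbabilityMeasure_errorLaw hf
  set g : J → X × ℝ → ℝ := fun j => condPDF f (m j) (s j) with hg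
  set p : X × ℝ → ℝ := condPDF f μ σ with hp
  have hgm : ∀ j, Measurable (g j) := fun j => measurable_condPDF hf.measurable (hm j) (hs j)
  have hg0 : ∀ j z, 0 < g j z := fun j z => condPDF_pos hf.pos (hs0 j) z
  have hpm : Measurable p := measurable_condPDF hf.measurable hμ hσ
  have hp0 : ∀ z, 0 < p z := fun z => condPDF_pos hf.pos hσ0 z
  set ρ : ℝ → ℝ := fun y => mixPred (fun j z => g j z / p z) d (x, y) with hρ
  have hρ0 : ∀ y, 0 < ρ y := fun y => mixPred_pos (fun j z => div_pos (hg0 j z) (hp0 z)) d _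
  set q : ℝ → ℝ := fun y => mixPred g d (x, y) with hqdef
  have hq0 : ∀ y, 0 < q y := fun y => mixPred_pos hg0 d _
  have hqm : Measurable q := Measurable.comp
    (g := fun p : (Fin i → X × ℝ) × (X × ℝ) => mixPred g p.1 p.2) (f := fun y => (d, (x, y)))
    (measurable_mixPred hgm i) (by fun_prop)
  have hpxm : Measurable fun y => p (x, y) := hpm.comp measurable_prodMk_left
  have hqρ : ∀ y, q y = ρ y * p (x, y) := fun y => (mixPred_div_mul hp0 d (x, y)).symm
  have hp1 : ∫⁻ y, ENNReal.ofReal (p (x, y)) = 1 := lintegral_lsPDF hf (μ x) (hσ0 x)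
  have hq1 : ∫⁻ y, ENNReal.ofReal (q y) = 1 := by
    -- Lebesgue measure on the fibre over `x` serves as reference measure, so the normalisation of
    -- mixtures applies conditionally.
    have h1 := lintegral_mixPred hgm hg0 (P := (volume : Measure ℝ).map (Prod.mk x))
      (fun j => by
        rw [lintegral_map (hgm j).ennreal_ofReal measurable_prodMk_left]
        exact lintegral_lsPDF hf (m j x) (hs0 j x)) d
    rwa [lintegral_map (f := fun z => ENNReal.ofReal (mixPred g d z))
      (((measurable_mixPred hgm i).comp
      (measurable_prodMk_left (x := d))).ennreal_ofReal) measurable_prodMk_left] at h1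
  set T := ∫⁻ y, ENNReal.ofReal |p (x, y) - q y| with hT
  have hTfin : T ≠ ⊤ := by
    have h1 : T ≤ ∫⁻ y, (ENNReal.ofReal (p (x, y)) + ENNReal.ofReal (q y)) := by
      refine lintegral_mono fun y => ?_
      rw [← ENNReal.ofReal_add (hp0 _).le (hq0 y).le]
      refine ENNReal.ofReal_le_ofReal ?_
      rw [abs_le]
      constructor <;> linarith [hp0 (x, y), hq0 y]
    rw [lintegral_add_left hpxm.ennreal_ofReal, hp1, hq1] at h1
    exact (h1.trans_lt (by norm_num)).ne
  have hhell : T ^ 2 ≤ 4 * ∫⁻ y, ENNReal.ofReal ((1 - √(ρ y)) ^ 2) * ENNReal.ofReal (p (x, y)) := by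
    refine (sq_lintegral_abs_sub_le hpxm hqm (fun y => (hp0 _).le) (fun y => (hq0 y).le)
      hp1 hq1).trans (le_of_eq ?_)
    congr 1
    refine lintegral_congr fun y => ?_
    rw [← ENNReal.ofReal_mul (sq_nonneg _), hqρ y, Real.sqrt_mul (hρ0 y).le]
    congr 1
    nlinarith [Real.sq_sqrt (hp0 (x, y)).le]
  have habs : |predEst τ B g d x - μ x| ≤ T.toReal / c := by
    -- The true and predictive distribution functions differ everywhere by at most the `L₁` distance
    -- `T`.
    refine abs_truncQuantile_sub_le (F := fun t => (errorLaw f).real (Set.Iic ((t - μ x) / σ x)))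
      hτ0 hc0 ENNReal.toReal_nonneg (hμB x) (fun t => measureReal_nonneg) ?_ ?_ ?_ ?_
    · intro t ht hmt
      have hB := abs_le.mp (hμB x)
      have h0 : 0 < (t - μ x) / σ x := div_pos (by linarith) (hσ0 x)
      have hle : (t - μ x) / b ≤ (t - μ x) / σ x :=
        div_le_div_of_nonneg_left (by linarith) (hσ0 x) (hσb x).2
      have hR : |(t - μ x) / σ x| ≤ 2 * B * b := by
        rw [abs_of_pos h0, div_le_iff₀ (hσ0 x)]
        have h1 : 1 ≤ b * σ x := by
          have := mul_le_mul_of_nonneg_left (hσb x).1 hb0.le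
          rwa [mul_inv_cancel₀ hb0.ne'] at this
        nlinarith [ht.2, hB.1, hB.2, hmt]
      have h2 := (hgrow _ hR).1 h0
      have h3 : c * (t - μ x) = c₀ * ((t - μ x) / b) := by rw [hc]; ring
      rw [h3]
      nlinarith [mul_le_mul_of_nonneg_left hle hc₀.le]
    · intro t ht hmt
      have hB := abs_le.mp (hμB x)
      have h0 : (t - μ x) / σ x < 0 := div_neg_of_neg_of_pos (by linarith) (hσ0 x)
      have hle : (t - μ x) / σ x ≤ (t - μ x) / b := by
        have h4 : (μ x - t) / b ≤ (μ x - t) / σ x :=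
          div_le_div_of_nonneg_left (by linarith) (hσ0 x) (hσb x).2
        have h5 : ∀ w, (t - μ x) / w = -((μ x - t) / w) := fun w => by ring
        rw [h5, h5]
        linarith
      have hR : |(t - μ x) / σ x| ≤ 2 * B * b := by
        rw [abs_of_neg h0, ← neg_div, div_le_iff₀ (hσ0 x)]
        have h1 : 1 ≤ b * σ x := by
          have := mul_le_mul_of_nonneg_left (hσb x).1 hb0.le
          rwa [mul_inv_cancel₀ hb0.ne'] at this
        nlinarith [ht.1, hB.1, hB.2, hmt]
      have h2 := (hgrow _ hR).2 h0
      have h3 : c * (t - μ x) = c₀ * ((t - μ x) / b) := by rw [hc]; ring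
      rw [h3]
      nlinarith [mul_le_mul_of_nonneg_left hle hc₀.le]
    · intro t
      rw [ENNReal.ofReal_toReal hTfin, ofReal_measureReal,
        ← setLIntegral_Iic_lsPDF (f := f) (μ x) (hσ0 x) t, hT]
      have h1 := setLIntegral_ofReal_le_add (ν := volume) (p := q) hpxm (Set.Iic t)
      simp only [abs_sub_comm (q _)] at h1
      exact h1
    · intro t
      rw [ENNReal.ofReal_toReal hTfin, ofReal_measureReal,
        ← setLIntegral_Iic_lsPDF (f := f) (μ x) (hσ0 x) t, hT]
      exact setLIntegral_ofReal_le_add (ν := volume) (p := fun y => p (x, y)) hqm (Set.Iic t)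
  have hsq : (μ x - predEst τ B g d x) ^ 2 ≤ 1 / c ^ 2 * T.toReal ^ 2 := by
    rw [← sq_abs, abs_sub_comm]
    refine (pow_le_pow_left₀ (abs_nonneg _) habs 2).trans (le_of_eq ?_)
    rw [div_pow]
    ring
  calc ENNReal.ofReal ((μ x - predEst τ B g d x) ^ 2)
      ≤ ENNReal.ofReal (1 / c ^ 2 * T.toReal ^ 2) := ENNReal.ofReal_le_ofReal hsq
    _ = ENNReal.ofReal (1 / c ^ 2) * T ^ 2 := by
        rw [ENNReal.ofReal_mul (by positivity), ENNReal.ofReal_pow ENNReal.toReal_nonneg,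
          ENNReal.ofReal_toReal hTfin]
    _ ≤ ENNReal.ofReal (1 / c ^ 2) * (4 * ∫⁻ y, ENNReal.ofReal ((1 - √(ρ y)) ^ 2) *
        ENNReal.ofReal (p (x, y))) := mul_le_mul_right hhell _
    _ = _ := by
        rw [← mul_assoc]
        congr 1
        have h4 : (4 : ENNReal) = ENNReal.ofReal 4 := by simp
        rw [h4, ← ENNReal.ofReal_mul (by positivity)]
        congr 1
        ring

theorem l2DistSq_average_le {h u : X → ℝ} (hh : IsProbDensity ν h) (hu : Measurable u) {n : ℕ}
    (hn : 0 < n) {v : Fin n → X → ℝ} (hv : ∀ i, Measurable (v i)) :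
    l2DistSq ν h u (fun x => (∑ i, v i x) / n) ≤
      ENNReal.ofReal (1 / n) * ∑ i, l2DistSq ν h u (v i) := by
  have hn' : (0 : ℝ) < n := by exact_mod_cast hn
  simp only [l2DistSq]
  rw [← lintegral_finsetSum (f := fun i x => ENNReal.ofReal ((u x - v i x) ^ 2 * h x)) _
    fun i _ => (((hu.sub (hv i)).pow_const 2).mul hh.1).ennreal_ofReal,
    ← lintegral_const_mul' _ _ ENNReal.ofReal_ne_top]
  refine lintegral_mono fun x => ?_
  have hx := hh.2.1 x
  rw [← ENNReal.ofReal_sum_of_nonneg fun i _ => mul_nonneg (sq_nonneg _) hx,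
    ← ENNReal.ofReal_mul (by positivity)]
  refine ENNReal.ofReal_le_ofReal ?_
  rw [← Finset.sum_mul, ← mul_assoc]
  refine mul_le_mul_of_nonneg_right ?_ hx
  have h1 : u x - (∑ i, v i x) / n = (∑ i, (u x - v i x)) / n := by
    rw [Finset.sum_sub_distrib]
    simp only [Finset.sum_const, Finset.card_univ, Fintype.card_fin, nsmul_eq_mul]
    field_simp
  have h2 := sq_sum_le_card_mul_sum_sq (s := Finset.univ) (f := fun i : Fin n => u x - v i x)
  simp only [Finset.card_univ, Fintype.card_fin] at h2
  rw [h1, div_pow, div_le_iff₀ (by positivity)]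
  refine h2.trans (le_of_eq ?_)
  field_simp

end Upper

/-! ### Risk of the averaged estimator and choice of the nets -/

section UpperRisk

variable {X : Type*} [MeasurableSpace X] {ν : Measure X} {f : ℝ → ℝ}

/-- Risk of the averaged predictive quantile estimator based on finitely many candidates. -/
theorem risk_avgEst_le [SFinite ν] {J : Type*} [Fintype J] (hf : IsRegularError f) {τ B C : ℝ}
    (hC : 0 < C) {m s : J → X → ℝ} {μ σ h : X → ℝ} (hm : ∀ j, Measurable (m j))
    (hs : ∀ j, Measurable (s j)) (hs0 : ∀ j x, 0 < s j x) (hμ : Measurable μ)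
    (hσ : Measurable σ) (hσ0 : ∀ x, 0 < σ x) (hh : IsProbDensity ν h)
    (hpt : ∀ (i : ℕ) (d : Fin i → X × ℝ) (x : X),
      ENNReal.ofReal ((μ x - predEst τ B (fun j => condPDF f (m j) (s j)) d x) ^ 2) ≤
        ENNReal.ofReal C * ∫⁻ y, ENNReal.ofReal ((1 - √(mixPred (fun j z =>
          condPDF f (m j) (s j) z / condPDF f μ σ z) d (x, y))) ^ 2) *
          ENNReal.ofReal (condPDF f μ σ (x, y)))
    (h_int : ∀ j, Integrable (fun z => Real.log (condPDF f (m j) (s j) z / condPDF f μ σ z))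
      (obsLaw ν f μ σ h)) {j₀ : J} {κ : ℝ}
    (hκ : -∫ z, Real.log (condPDF f (m j₀) (s j₀) z / condPDF f μ σ z) ∂(obsLaw ν f μ σ h) ≤ κ)
    {n : ℕ} (hn : 0 < n) :
    risk ν f n (avgEst τ B fun j => condPDF f (m j) (s j)) μ σ h ≤
      ENNReal.ofReal (C * ((Real.log (Fintype.card J) + n * κ) / n)) := by
  set g : J → X × ℝ → ℝ := fun j => condPDF f (m j) (s j) with hg
  set p : X × ℝ → ℝ := condPDF f μ σ with hp
  set r : J → X × ℝ → ℝ := fun j z => g j z / p z with hr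
  set P := obsLaw ν f μ σ h with hP
  have hPprob : IsProbabilityMeasure P := isProbabilityMeasure_obsLaw hf hμ hσ hh
  have hgm : ∀ j, Measurable (g j) := fun j => measurable_condPDF hf.measurable (hm j) (hs j)
  have hpm : Measurable p := measurable_condPDF hf.measurable hμ hσ
  have hrm : ∀ j, Measurable (r j) := fun j => (hgm j).div hpm
  have hr0 : ∀ j z, 0 < r j z := fun j z =>
    div_pos (condPDF_pos hf.pos (hs0 j) z) (condPDF_pos hf.pos hσ0 z)
  have hone : ∀ j, ∫⁻ z, ENNReal.ofReal (r j z) ∂P = 1 := by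
    intro j
    have h1 := obsLaw_eq_withDensity (ν := ν) hf hμ hσ hσ0 (hm j) (hs j) (hs0 j) hh
    have := isProbabilityMeasure_obsLaw hf (hm j) (hs j) hh
    have h2 : obsLaw ν f (m j) (s j) h Set.univ = 1 := measure_univ
    rwa [h1, withDensity_apply _ MeasurableSet.univ, Measure.restrict_univ] at h2
  have hpredm : ∀ (i : ℕ) (d : Fin i → X × ℝ), Measurable fun x => predEst τ B g d x := by
    intro i d
    have hcomp := (measurable_predEst τ B hgm i).comp (measurable_prodMk_left (x := d))
    simp only [Function.comp_def] at hcomp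
    exact hcomp
  have hlossm : ∀ i : ℕ, Measurable fun d : Fin i → X × ℝ => l2DistSq ν h μ (predEst τ B g d) :=
    fun i => measurable_l2DistSq hh.1 hμ (by
      rw [Function.uncurry_def]
      exact measurable_predEst τ B hgm i)
  have hloss : ∀ (i : ℕ) (d : Fin i → X × ℝ), l2DistSq ν h μ (predEst τ B g d) ≤
      ENNReal.ofReal C * ∫⁻ z, ENNReal.ofReal ((1 - √(mixPred r d z)) ^ 2) ∂P := by
    intro i d
    have hmix : Measurable fun z => ENNReal.ofReal ((1 - √(mixPred r d z)) ^ 2) := by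
      have h1 := (measurable_mixPred hrm i).comp (measurable_prodMk_left (x := d))
      simp only [Function.comp_def] at h1
      exact ((h1.sqrt.const_sub 1).pow_const 2).ennreal_ofReal
    rw [hP, lintegral_obsLaw hf hμ hσ hσ0 hh hmix,
      ← lintegral_const_mul' _ _ ENNReal.ofReal_ne_top, l2DistSq]
    refine lintegral_mono fun x => ?_
    rw [ENNReal.ofReal_mul (sq_nonneg _), mul_left_comm, mul_comm]
    exact mul_le_mul_right (hpt i d x) _
  have hcum := sum_hellinger_mixPred_le hrm hr0 P hone h_int hκ n
  have hn' : (0 : ℝ) < n := by exact_mod_cast hn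
  calc risk ν f n (avgEst τ B g) μ σ h
      ≤ ∫⁻ d, ENNReal.ofReal (1 / n) * ∑ i : Fin n, l2DistSq ν h μ
          (predEst τ B g fun k : Fin i => d (Fin.castLE i.isLt.le k))
          ∂(Measure.pi fun _ : Fin n => P) :=
        lintegral_mono fun d => l2DistSq_average_le hh hμ hn fun i => hpredm i _
    _ = ENNReal.ofReal (1 / n) * ∑ i : Fin n, ∫⁻ d, l2DistSq ν h μ (predEst τ B g d)
          ∂(Measure.pi fun _ : Fin i => P) := by
        rw [lintegral_const_mul' _ _ ENNReal.ofReal_ne_top, lintegral_finsetSum]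
        · congr 1
          refine Finset.sum_congr rfl fun i _ => ?_
          -- The `i`-th summand depends on the first `i` coordinates only, whose law is the `i`-fold
          -- product.
          exact (measurePreserving_comp_castLE i.isLt.le P).lintegral_comp (hlossm i)
        · intro i _
          exact (hlossm i).comp (measurePreserving_comp_castLE i.isLt.le P).measurable
    _ ≤ ENNReal.ofReal (1 / n) * ∑ i : Fin n, ENNReal.ofReal C * ∫⁻ d,
          ∫⁻ z, ENNReal.ofReal ((1 - √(mixPred r d z)) ^ 2) ∂P
          ∂(Measure.pi fun _ : Fin i => P) := by
        refine mul_le_mul_right (Finset.sum_le_sum fun i _ => ?_) _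
        rw [← lintegral_const_mul' _ _ ENNReal.ofReal_ne_top]
        exact lintegral_mono (hloss i)
    _ ≤ ENNReal.ofReal (1 / n) * (ENNReal.ofReal C *
          ENNReal.ofReal (Real.log (Fintype.card J) + n * κ)) := by
        rw [← Finset.mul_sum, Fin.sum_univ_eq_sum_range (fun i => ∫⁻ d : Fin i → X × ℝ,
          ∫⁻ z, ENNReal.ofReal ((1 - √(mixPred r d z)) ^ 2) ∂P
          ∂(Measure.pi fun _ : Fin i => P)) n]
        exact mul_le_mul_right (mul_le_mul_right hcum _) _
    _ = _ := by
        rw [← ENNReal.ofReal_mul hC.le, ← ENNReal.ofReal_mul (by positivity)]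
        congr 1
        field_simp

theorem l2DistSq_le_mul {h h₀ u v : X → ℝ} {C : ℝ} (hC : 0 ≤ C) (hdom : ∀ x, h x ≤ C * h₀ x) :
    l2DistSq ν h u v ≤ ENNReal.ofReal C * l2DistSq ν h₀ u v := by
  rw [l2DistSq, l2DistSq, ← lintegral_const_mul' _ _ ENNReal.ofReal_ne_top]
  refine lintegral_mono fun x => ?_
  rw [← ENNReal.ofReal_mul hC]
  refine ENNReal.ofReal_le_ofReal ?_
  nlinarith [mul_le_mul_of_nonneg_left (hdom x) (sq_nonneg (u x - v x))]

/-- The candidates are pairs from `ε_n`-nets of `U` and `S`; the entropy assumption on `S` keeps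
their log-cardinality `O(n ε_n²)`. Domination by `h₀` makes the approximation error uniform over
`H`, although the nets are built in `L₂(h₀)`. -/
theorem exists_minimaxRisk_le [SFinite ν] {U S H : Set (X → ℝ)} (hf : IsRegularError f)
    {τ : ℝ} (hτ0 : 0 < τ) (hτ1 : τ < 1) (hq : quantile (errorLaw f) τ = 0)
    {B b : ℝ} (hb : 1 < b) (hU : ∀ μ ∈ U, Measurable μ) (hUb : ∀ μ ∈ U, ∀ x, |μ x| ≤ B)
    (hUne : U.Nonempty) (hSne : S.Nonempty) (hS : ∀ σ ∈ S, Measurable σ)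
    (hSb : ∀ σ ∈ S, ∀ x, b⁻¹ ≤ σ x ∧ σ x ≤ b) (hH : ∀ h ∈ H, IsProbDensity ν h) {h₀ : X → ℝ}
    {C₀ : ℝ} (hdom : ∀ h ∈ H, ∀ x, h x ≤ C₀ * h₀ x) (hh₀ : ∀ x, 0 ≤ h₀ x)
    (hTU : TotallyBoundedL2 ν h₀ U) (hTS : TotallyBoundedL2 ν h₀ S)
    (hSU : packingEntropy ν h₀ S =O[𝓝[>] (0 : ℝ)] packingEntropy ν h₀ U) {ε : ℕ → ℝ}
    (hε : SolvesEntropyEquation ν h₀ U ε) :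
    ∃ C : ℝ, 0 < C ∧ ∀ᶠ n in atTop, minimaxRisk ν f U S H n ≤ ENNReal.ofReal (C * ε n ^ 2) := by
  classical
  obtain ⟨K, hK, hKL⟩ := exists_kl_le (ν := ν) hf B hb
  obtain ⟨C₁, hC₁, hpred⟩ := exists_predEst_sq_le (X := X) hf hτ0 hτ1 hq B hb
  have hE0 := packingEntropy_nonneg (ν := ν) (h := h₀) (U := U)
  have hES0 := packingEntropy_nonneg (ν := ν) (h := h₀) (U := S)
  have hε0 := tendsto_zero_of_solution hE0 (packingEntropy_antitoneOn hTU) hε.1 hε.2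
  obtain ⟨C₂, hC₂, hb₂⟩ := hε.2.1.exists_pos
  obtain ⟨C₃, hC₃, hb₃⟩ := hSU.exists_pos
  set C₄ := max C₀ 0 with hC₄
  have hC₄0 : 0 ≤ C₄ := le_max_right _ _
  have hdom' : ∀ h ∈ H, ∀ x, h x ≤ C₄ * h₀ x := fun h hh x =>
    (hdom h hh x).trans (mul_le_mul_of_nonneg_right (le_max_left _ _) (hh₀ x))
  -- `(1 + C₃) C₂` bounds the joint entropy of the nets, and `K · 2 C₄` the divergence from the
  -- nearest pair.
  refine ⟨C₁ * ((1 + C₃) * C₂ + K * (2 * C₄)), by positivity, ?_⟩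
  filter_upwards [hε.1, hb₂.bound, hε0.eventually hb₃.bound, eventually_gt_atTop 0]
    with n h0 h2 h3 hn
  have hn' : (0 : ℝ) < n := by exact_mod_cast hn
  rw [Real.norm_eq_abs, Real.norm_eq_abs, abs_of_nonneg (hE0 _),
    abs_of_nonneg (by positivity)] at h2
  rw [Real.norm_eq_abs, Real.norm_eq_abs, abs_of_nonneg (hE0 _),
    abs_of_nonneg (hES0 _)] at h3
  obtain ⟨N, hN, -, hcov, hNlog⟩ := exists_packing hTU h0
  obtain ⟨N', hN', -, hcov', hNlog'⟩ := exists_packing hTS h0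
  let J := ↥(N ×ˢ N')
  let m : J → X → ℝ := fun j => j.1.1
  let s : J → X → ℝ := fun j => j.1.2
  have hmU : ∀ j, m j ∈ U := fun j => hN (Finset.mem_product.mp j.2).1
  have hsS : ∀ j, s j ∈ S := fun j => hN' (Finset.mem_product.mp j.2).2
  have hb0 : 0 < b := by linarith
  have hpos : ∀ σ ∈ S, ∀ x, 0 < σ x := fun σ hσ x =>
    (inv_pos.mpr hb0).trans_le (hSb σ hσ x).1
  obtain ⟨u₀, hu₀⟩ := hUne
  obtain ⟨σ₀, hσ₀⟩ := hSne
  obtain ⟨v, hv, -⟩ := hcov u₀ hu₀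
  obtain ⟨v', hv', -⟩ := hcov' σ₀ hσ₀
  have hJne : Nonempty J := ⟨⟨(v, v'), Finset.mk_mem_product hv hv'⟩⟩
  have hcard : Real.log (Fintype.card J) ≤ (1 + C₃) * C₂ * (n * ε n ^ 2) := by
    have h4 : Fintype.card J = N.card * N'.card := by
      rw [Fintype.card_coe, Finset.card_product]
    have h5 : (N.card : ℝ) ≠ 0 := by exact_mod_cast (Finset.card_pos.mpr ⟨v, hv⟩).ne'
    have h6 : (N'.card : ℝ) ≠ 0 := by exact_mod_cast (Finset.card_pos.mpr ⟨v', hv'⟩).ne'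
    rw [h4, Nat.cast_mul, Real.log_mul h5 h6, ← hNlog, ← hNlog']
    nlinarith [mul_le_mul_of_nonneg_left h2 hC₃.le]
  refine iInf₂_le_of_le (avgEst τ B fun j => condPDF f (m j) (s j))
    (measurable_avgEst τ B (fun j => measurable_condPDF hf.measurable (hU _ (hmU j))
      (hS _ (hsS j))) n) ?_
  refine iSup₂_le fun μ hμ => iSup₂_le fun σ hσ => iSup₂_le fun h hh => ?_
  obtain ⟨w, hw, hwd⟩ := hcov μ hμ
  obtain ⟨w', hw', hwd'⟩ := hcov' σ hσ
  let j₀ : J := ⟨(w, w'), Finset.mk_mem_product hw hw'⟩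
  have hkl := fun j : J => hKL μ (m j) σ (s j) h (hU _ hμ) (hU _ (hmU j)) (hS _ hσ)
    (hS _ (hsS j)) (hUb _ hμ) (hUb _ (hmU j)) (hSb _ hσ) (hSb _ (hsS j)) (hH _ hh)
  have hD : l2DistSq ν h μ w + l2DistSq ν h σ w' ≤ ENNReal.ofReal (2 * C₄ * ε n ^ 2) := by
    calc _ ≤ ENNReal.ofReal C₄ * ENNReal.ofReal (ε n ^ 2) +
          ENNReal.ofReal C₄ * ENNReal.ofReal (ε n ^ 2) :=
          add_le_add
            ((l2DistSq_le_mul hC₄0 (hdom' h hh)).trans (mul_le_mul_right hwd _))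
            ((l2DistSq_le_mul hC₄0 (hdom' h hh)).trans (mul_le_mul_right hwd' _))
      _ = _ := by
          rw [← ENNReal.ofReal_mul hC₄0, ← ENNReal.ofReal_add (by positivity) (by positivity)]
          congr 1
          ring
  have hκ := (hkl j₀).2 _ (by positivity) hD
  refine (risk_avgEst_le hf hC₁ (fun j => hU _ (hmU j)) (fun j => hS _ (hsS j))
    (fun j => hpos _ (hsS j)) (hU _ hμ) (hS _ hσ) (hpos _ hσ) (hH _ hh)
    (hpred J m s μ σ (fun j => hU _ (hmU j)) (fun j => hS _ (hsS j)) (fun j => hpos _ (hsS j))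
      (hU _ hμ) (hS _ hσ) (hUb _ hμ) (hSb _ hσ)) (fun j => (hkl j).1) hκ hn).trans ?_
  refine ENNReal.ofReal_le_ofReal ?_
  rw [mul_assoc C₁]
  refine mul_le_mul_of_nonneg_left ?_ hC₁.le
  rw [div_le_iff₀ hn']
  nlinarith

end UpperRisk

/-! ### Regularity of the error densities -/

section Regularity

variable {f : ℝ → ℝ}

theorem log_lsPDF (hpos : ∀ y, 0 < f y) (m : ℝ) {s : ℝ} (hs : 0 < s) (y : ℝ) :
    Real.log (lsPDF f m s y) = Real.log (f ((y - m) / s)) - Real.log s :=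
  Real.log_div (hpos _).ne' hs.ne'

theorem abs_log_sub_log_le {b s s' : ℝ} (hb : 0 < b) (hs : b⁻¹ ≤ s) (hs' : b⁻¹ ≤ s') :
    |Real.log s - Real.log s'| ≤ b * |s - s'| := by
  have key : ∀ u v : ℝ, b⁻¹ ≤ u → b⁻¹ ≤ v → Real.log u - Real.log v ≤ b * |u - v| := by
    intro u v hu hv
    have hu0 : 0 < u := (inv_pos.mpr hb).trans_le hu
    have hv0 : 0 < v := (inv_pos.mpr hb).trans_le hv
    rw [← Real.log_div hu0.ne' hv0.ne']
    have h1 := Real.log_le_sub_one_of_pos (div_pos hu0 hv0)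
    have h2 : u / v - 1 = v⁻¹ * (u - v) := by field_simp
    have h3 : v⁻¹ ≤ b := inv_le_of_inv_le₀ hb hv
    rw [h2] at h1
    refine h1.trans ?_
    calc v⁻¹ * (u - v) ≤ v⁻¹ * |u - v| :=
          mul_le_mul_of_nonneg_left (le_abs_self _) (inv_pos.mpr hv0).le
      _ ≤ b * |u - v| := mul_le_mul_of_nonneg_right h3 (abs_nonneg _)
  rw [abs_le]
  constructor
  · have := key s' s hs' hs
    rw [abs_sub_comm] at this
    linarith
  · exact key s s' hs hs'

theorem abs_standardize_sub_le {b m m' s s' y : ℝ} (hb : 0 < b) (hs : b⁻¹ ≤ s)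
    (hs' : b⁻¹ ≤ s') :
    |(y - m) / s - (y - m') / s'| ≤ b * (|m - m'| + |(y - m') / s'| * |s - s'|) := by
  have hs0 : 0 < s := (inv_pos.mpr hb).trans_le hs
  have hs0' : 0 < s' := (inv_pos.mpr hb).trans_le hs'
  have h1 : (y - m) / s - (y - m') / s' = s⁻¹ * ((m' - m) + (y - m') / s' * (s' - s)) := by
    field_simp
    ring
  rw [h1, abs_mul, abs_of_pos (inv_pos.mpr hs0)]
  refine mul_le_mul (inv_le_of_inv_le₀ hb hs) ?_ (abs_nonneg _) hb.le
  refine (abs_add_le _ _).trans ?_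
  rw [abs_mul, abs_sub_comm m' m, abs_sub_comm s' s]

theorem abs_standardize_le {b J m s y : ℝ} (hb : 0 < b) (hs : b⁻¹ ≤ s) (hm : |m| ≤ J) :
    |(y - m) / s| ≤ b * (|y| + J) := by
  have hs0 : 0 < s := (inv_pos.mpr hb).trans_le hs
  rw [abs_div, abs_of_pos hs0, div_eq_mul_inv, mul_comm]
  refine mul_le_mul (inv_le_of_inv_le₀ hb hs) ?_ (abs_nonneg _) hb.le
  exact (abs_sub _ _).trans (by linarith)

/-- A density with locally Lipschitz logarithm, with at most linear growth of the Lipschitz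
constants, and with a finite fourth moment is regular. -/
theorem isRegularError_of_log_lipschitz (hm : Measurable f) (hpos : ∀ y, 0 < f y)
    (hone : ∫⁻ y, ENNReal.ofReal (f y) = 1) {K : ℝ} (hK : 0 ≤ K)
    (hlip : ∀ u v, |Real.log (f u) - Real.log (f v)| ≤ K * (1 + |u| + |v|) * |u - v|)
    (hmom : ∫⁻ y, ENNReal.ofReal (y ^ 4) * ENNReal.ofReal (f y) ≠ ⊤) : IsRegularError f where
  measurable := hm
  pos := hpos
  lintegral_eq_one := hone
  lower := by
    intro R
    refine ⟨Real.exp (Real.log (f 0) - K * (1 + R) * R), Real.exp_pos _, fun y hy => ?_⟩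
    rw [← Real.le_log_iff_exp_le (hpos y)]
    have h1 := hlip 0 y
    simp only [abs_zero, add_zero, zero_sub, abs_neg] at h1
    have h2 : K * (1 + |y|) * |y| ≤ K * (1 + R) * R := by
      have := abs_nonneg y
      have : 0 ≤ R := this.trans hy
      gcongr
    linarith [le_abs_self (Real.log (f 0) - Real.log (f y))]
  envelope := by
    intro J b hb
    have hb0 : 0 < b := by linarith
    -- The growth factor `2b(1 + Y)` times the displacement `b²(1 + Y) D` gives `2 K b³`; the term
    -- `b` comes from `log s`. The envelope is thus quadratic in `|y|`, and its square needs a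
    -- fourth moment.
    set A := 2 * K * b ^ 3 + b with hA
    have hA0 : 0 ≤ A := by positivity
    set M := (∫⁻ y, ENNReal.ofReal (y ^ 4) * ENNReal.ofReal (f y)).toReal with hM
    refine ⟨fun y => A * (1 + |J| + |y|) ^ 2,
      A ^ 2 * 8 * ((1 + 2 * |J|) ^ 4 + b ^ 4 * M), by fun_prop, fun y => by positivity,
      by positivity, ?_, ?_⟩
    · intro m m' s s' hm hm' hs hsb hs' hsb' y
      have hs0 : 0 < s := (inv_pos.mpr hb0).trans_le hs
      have hs0' : 0 < s' := (inv_pos.mpr hb0).trans_le hs'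
      have hJ : 0 ≤ J := (abs_nonneg m).trans hm
      rw [log_lsPDF hpos _ hs0, log_lsPDF hpos _ hs0', abs_of_nonneg hJ]
      set u := (y - m) / s with hu
      set v := (y - m') / s' with hv
      set D := |m - m'| + |s - s'| with hD
      set Y := J + |y| with hY
      have hY0 : 0 ≤ Y := by positivity
      have hD0 : 0 ≤ D := by positivity
      have hu1 : |u| ≤ b * Y := (abs_standardize_le hb0 hs hm).trans (by rw [hY, add_comm])
      have hv1 : |v| ≤ b * Y := (abs_standardize_le hb0 hs' hm').trans (by rw [hY, add_comm])
      have huv : |u - v| ≤ b ^ 2 * (1 + Y) * D := by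
        refine (abs_standardize_sub_le hb0 hs hs').trans ?_
        have h1 : |v| * |s - s'| ≤ b * Y * |s - s'| :=
          mul_le_mul_of_nonneg_right hv1 (abs_nonneg _)
        have h2 : |m - m'| ≤ b * |m - m'| := le_mul_of_one_le_left (abs_nonneg _) hb.le
        have h3 : |m - m'| + |v| * |s - s'| ≤ b * (1 + Y) * D := by
          have e1 : 0 ≤ b * Y * |m - m'| := by positivity
          have e2 : 0 ≤ b * |s - s'| := by positivity
          rw [hD]
          nlinarith
        calc _ ≤ b * (b * (1 + Y) * D) := mul_le_mul_of_nonneg_left h3 hb0.le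
          _ = _ := by ring
      have hsum : 1 + |u| + |v| ≤ 2 * b * (1 + Y) := by nlinarith
      have hlog : |Real.log s - Real.log s'| ≤ b * D :=
        (abs_log_sub_log_le hb0 hs hs').trans (mul_le_mul_of_nonneg_left (by
          rw [hD]; linarith [abs_nonneg (m - m')]) hb0.le)
      have h4 : |Real.log (f u) - Real.log (f v)| ≤
          K * (2 * b * (1 + Y)) * (b ^ 2 * (1 + Y) * D) :=
        (hlip u v).trans (mul_le_mul (mul_le_mul_of_nonneg_left hsum hK) huv (abs_nonneg _)
          (by positivity))
      have h5 : b * D ≤ b * D * (1 + Y) ^ 2 :=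
        le_mul_of_one_le_right (by positivity) (by nlinarith)
      calc |Real.log (f u) - Real.log s - (Real.log (f v) - Real.log s')|
          = |(Real.log (f u) - Real.log (f v)) - (Real.log s - Real.log s')| := by
            congr 1
            ring
        _ ≤ |Real.log (f u) - Real.log (f v)| + |Real.log s - Real.log s'| := abs_sub _ _
        _ ≤ K * (2 * b * (1 + Y)) * (b ^ 2 * (1 + Y) * D) + b * D * (1 + Y) ^ 2 :=
            add_le_add h4 (hlog.trans h5)
        _ = D * (A * (1 + J + |y|) ^ 2) := by rw [hA, hY]; ring
    · intro m s hm' hs hsb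
      have hs0 : 0 < s := (inv_pos.mpr hb0).trans_le hs
      rw [lintegral_lsPDF_mul _ _ hs0]
      have hpt : ∀ e, ENNReal.ofReal ((A * (1 + |J| + |m + s * e|) ^ 2) ^ 2) *
          ENNReal.ofReal (f e) ≤
          ENNReal.ofReal (A ^ 2 * 8 * (1 + 2 * |J|) ^ 4) * ENNReal.ofReal (f e) +
          ENNReal.ofReal (A ^ 2 * 8 * b ^ 4) *
            (ENNReal.ofReal (e ^ 4) * ENNReal.ofReal (f e)) := by
        intro e
        rw [← mul_assoc, ← ENNReal.ofReal_mul (p := A ^ 2 * 8 * b ^ 4) (by positivity), ← add_mul,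
          ← ENNReal.ofReal_add (by positivity) (by positivity)]
        refine mul_le_mul_left (ENNReal.ofReal_le_ofReal ?_) _
        have h1 : |m + s * e| ≤ |J| + b * |e| := by
          refine (abs_add_le _ _).trans (add_le_add (hm'.trans (le_abs_self J)) ?_)
          rw [abs_mul, abs_of_pos hs0]
          exact mul_le_mul_of_nonneg_right hsb (abs_nonneg _)
        have h2 : (1 + |J| + |m + s * e|) ^ 4 ≤ ((1 + 2 * |J|) + b * |e|) ^ 4 :=
          pow_le_pow_left₀ (by positivity) (by linarith) 4
        have h3 := add_pow_le (show 0 ≤ 1 + 2 * |J| by positivity)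
          (show 0 ≤ b * |e| by positivity) 4
        have h4 : (b * |e|) ^ 4 = b ^ 4 * e ^ 4 := by
          rw [mul_pow, Even.pow_abs (by decide)]
        rw [h4] at h3
        norm_num at h3
        calc (A * (1 + |J| + |m + s * e|) ^ 2) ^ 2 = A ^ 2 * (1 + |J| + |m + s * e|) ^ 4 := by ring
          _ ≤ A ^ 2 * (8 * ((1 + 2 * |J|) ^ 4 + b ^ 4 * e ^ 4)) :=
              mul_le_mul_of_nonneg_left (h2.trans h3) (sq_nonneg _)
          _ = _ := by ring
      refine (lintegral_mono hpt).trans ?_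
      rw [lintegral_add_left (hm.ennreal_ofReal.const_mul _),
        lintegral_const_mul' _ _ ENNReal.ofReal_ne_top,
        lintegral_const_mul' _ _ ENNReal.ofReal_ne_top, hone, mul_one,
        ← ENNReal.ofReal_toReal hmom, ← ENNReal.ofReal_mul (by positivity),
        ← ENNReal.ofReal_add (by positivity) (by positivity)]
      exact ENNReal.ofReal_le_ofReal (le_of_eq (by ring))

end Regularity

/-! ### Integrals of densities glued from two half-lines -/

section HalfLine

theorem lintegral_eq_add_half_lines {k : ℝ → ENNReal} (η : ℝ) :
    ∫⁻ y, k y = (∫⁻ w in Set.Ioi (0 : ℝ), k (η + w)) + ∫⁻ w in Set.Ioi (0 : ℝ), k (η - w) := by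
  have h1 : ∫⁻ w in Set.Ioi (0 : ℝ), k (η + w) = ∫⁻ y in Set.Ioi η, k y := by
    rw [← lintegral_indicator measurableSet_Ioi, ← lintegral_indicator measurableSet_Ioi,
      ← lintegral_add_left_eq_self ((Set.Ioi η).indicator fun y => k y) η]
    refine lintegral_congr fun w => ?_
    simp [Set.indicator]
  have h2 : ∫⁻ w in Set.Ioi (0 : ℝ), k (η - w) = ∫⁻ y in Set.Iio η, k y := by
    rw [← lintegral_indicator measurableSet_Ioi, ← lintegral_indicator measurableSet_Iio,
      ← lintegral_sub_left_eq_self ((Set.Iio η).indicator fun y => k y) η]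
    refine lintegral_congr fun w => ?_
    simp [Set.indicator]
  rw [h1, h2, ← lintegral_add_compl k measurableSet_Ioi, Set.compl_Ioi,
    setLIntegral_congr Iio_ae_eq_Iic]

theorem lintegral_Ioi_scale (k : ℝ → ENNReal) {c : ℝ} (hc : 0 < c) :
    ∫⁻ w in Set.Ioi (0 : ℝ), k (c * w) = ENNReal.ofReal c⁻¹ * ∫⁻ w in Set.Ioi (0 : ℝ), k w := by
  have h := lintegral_affine ((Set.Ioi (0 : ℝ)).indicator k) 0 hc
  rw [← lintegral_indicator measurableSet_Ioi, ← lintegral_indicator measurableSet_Ioi, ← h]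
  refine lintegral_congr fun w => ?_
  by_cases hw : 0 < w
  · simp [Set.indicator, hw, mul_pos hc hw]
  · simp [Set.indicator, hw, mul_pos_iff_of_pos_left hc]

theorem lintegral_fourth_moment_ne_top {f : ℝ → ℝ} (hm : Measurable f) (η : ℝ)
    (hone : ∫⁻ y, ENNReal.ofReal (f y) = 1)
    (hright : ∫⁻ w in Set.Ioi (0 : ℝ), ENNReal.ofReal (w ^ 4) * ENNReal.ofReal (f (η + w)) ≠ ⊤)
    (hleft : ∫⁻ w in Set.Ioi (0 : ℝ), ENNReal.ofReal (w ^ 4) * ENNReal.ofReal (f (η - w)) ≠ ⊤) :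
    ∫⁻ y, ENNReal.ofReal (y ^ 4) * ENNReal.ofReal (f y) ≠ ⊤ := by
  have hpt : ∀ y, ENNReal.ofReal (y ^ 4) * ENNReal.ofReal (f y) ≤
      ENNReal.ofReal (8 * η ^ 4) * ENNReal.ofReal (f y) +
      ENNReal.ofReal 8 * (ENNReal.ofReal ((y - η) ^ 4) * ENNReal.ofReal (f y)) := by
    intro y
    rw [← mul_assoc, ← ENNReal.ofReal_mul (p := 8) (by norm_num), ← add_mul,
      ← ENNReal.ofReal_add (by positivity) (by positivity)]
    refine mul_le_mul_left (ENNReal.ofReal_le_ofReal ?_) _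
    have h1 := add_pow_le (abs_nonneg η) (abs_nonneg (y - η)) 4
    rw [Even.pow_abs (by decide), Even.pow_abs (by decide)] at h1
    have h2 : y ^ 4 ≤ (|η| + |y - η|) ^ 4 := by
      rw [← Even.pow_abs (by decide) y]
      refine pow_le_pow_left₀ (abs_nonneg _) ?_ 4
      have := abs_add_le η (y - η)
      rwa [add_sub_cancel] at this
    norm_num at h1
    linarith
  refine ((lintegral_mono hpt).trans_lt ?_).ne
  rw [lintegral_add_left (hm.ennreal_ofReal.const_mul _),
    lintegral_const_mul' _ _ ENNReal.ofReal_ne_top,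
    lintegral_const_mul' _ _ ENNReal.ofReal_ne_top, hone, mul_one,
    lintegral_eq_add_half_lines η]
  have e1 : ∀ w : ℝ, (η + w - η) ^ 4 = w ^ 4 := fun w => by ring
  have e2 : ∀ w : ℝ, (η - w - η) ^ 4 = w ^ 4 := fun w => by ring
  simp only [e1, e2]
  exact ENNReal.add_lt_top.mpr ⟨ENNReal.ofReal_lt_top, ENNReal.mul_lt_top ENNReal.ofReal_lt_top
    (ENNReal.add_lt_top.mpr ⟨hright.lt_top, hleft.lt_top⟩)⟩

end HalfLine

/-! ### Truncated gamma, Laplace and normal-Laplace errors -/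

section Families

/-- As a maximum of linear functions with slopes in `[-1, 1]`, the loss is visibly nonnegative and
1-Lipschitz. -/
theorem checkLoss_eq_max (κ y : ℝ) : checkLoss κ y = max (κ * y) ((κ - 1) * y) := by
  unfold checkLoss
  split_ifs with h
  · rw [max_eq_right (by linarith)]; ring
  · rw [max_eq_left (by linarith)]; ring

theorem checkLoss_nonneg {κ : ℝ} (hκ0 : 0 < κ) (hκ1 : κ < 1) (y : ℝ) : 0 ≤ checkLoss κ y := by
  rw [checkLoss_eq_max]
  rcases le_total 0 y with h | h
  · exact le_max_of_le_left (mul_nonneg hκ0.le h)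
  · exact le_max_of_le_right (mul_nonneg_of_nonpos_of_nonpos (by linarith) h)

theorem abs_checkLoss_sub_le {κ : ℝ} (hκ0 : 0 < κ) (hκ1 : κ < 1) (x y : ℝ) :
    |checkLoss κ x - checkLoss κ y| ≤ |x - y| := by
  rw [checkLoss_eq_max, checkLoss_eq_max]
  refine (abs_max_sub_max_le_max _ _ _ _).trans (max_le ?_ ?_)
  · rw [← mul_sub, abs_mul, abs_of_pos hκ0]
    exact mul_le_of_le_one_left (abs_nonneg _) hκ1.le
  · rw [← mul_sub, abs_mul, abs_of_neg (by linarith)]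
    exact mul_le_of_le_one_left (abs_nonneg _) (by linarith)

theorem measurable_checkLoss (κ : ℝ) : Measurable (checkLoss κ) := by
  have : checkLoss κ = fun y => max (κ * y) ((κ - 1) * y) := funext (checkLoss_eq_max κ)
  rw [this]
  fun_prop

theorem checkLoss_right {κ w : ℝ} (hw : 0 < w) : checkLoss κ w = κ * w := by
  simp [checkLoss, not_lt.mpr hw.le, mul_comm]

theorem checkLoss_left {κ w : ℝ} (hw : 0 < w) : checkLoss κ (-w) = (1 - κ) * w := by
  rw [checkLoss, if_pos (by linarith)]
  ring

/-- The profile `(a + w)^a e^{-(a + w)}` of the truncated gamma density. -/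
noncomputable def gammaProfile (a w : ℝ) : ℝ := (a + w) ^ a * Real.exp (-(a + w))

theorem gammaProfile_pos {a w : ℝ} (ha : 0 ≤ a) (hw : 0 ≤ w) : 0 < gammaProfile a w := by
  refine mul_pos ?_ (Real.exp_pos _)
  rcases ha.eq_or_lt with h | h
  · rw [← h, Real.rpow_zero]; exact one_pos
  · exact Real.rpow_pos_of_pos (by linarith) _

theorem measurable_gammaProfile (a : ℝ) : Measurable (gammaProfile a) := by
  unfold gammaProfile
  fun_prop

theorem acdtgPDF_eq (η s a κ y : ℝ) : acdtgPDF η s a κ y =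
    κ * (1 - κ) / (s * upperGamma (a + 1) a) * gammaProfile a (checkLoss κ ((y - η) / s)) := by
  rw [acdtgPDF, gammaProfile, mul_assoc]

theorem integrableOn_rpow_mul_exp_neg {a t : ℝ} (ha : 0 ≤ a) (ht : 0 ≤ t) :
    IntegrableOn (fun x : ℝ => x ^ t * Real.exp (-x)) (Set.Ioi a) := by
  have h := Real.GammaIntegral_convergent (s := t + 1) (by linarith)
  simp only [add_sub_cancel_right] at h
  refine (h.mono_set (Set.Ioi_subset_Ioi ha)).congr_fun (fun x _ => mul_comm _ _)
    measurableSet_Ioi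

theorem lintegral_Ioi_comp_add (k : ℝ → ENNReal) (a : ℝ) :
    ∫⁻ w in Set.Ioi (0 : ℝ), k (a + w) = ∫⁻ x in Set.Ioi a, k x := by
  rw [← lintegral_indicator measurableSet_Ioi, ← lintegral_indicator measurableSet_Ioi,
    ← lintegral_add_left_eq_self ((Set.Ioi a).indicator fun y => k y) a]
  refine lintegral_congr fun w => ?_
  simp [Set.indicator]

theorem lintegral_gammaProfile {a : ℝ} (ha : 0 ≤ a) :
    ∫⁻ w in Set.Ioi (0 : ℝ), ENNReal.ofReal (gammaProfile a w) =
      ENNReal.ofReal (upperGamma (a + 1) a) := by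
  have h := lintegral_Ioi_comp_add (fun x => ENNReal.ofReal (x ^ a * Real.exp (-x))) a
  simp only [gammaProfile]
  rw [h, upperGamma, add_sub_cancel_right,
    ofReal_integral_eq_lintegral_ofReal (integrableOn_rpow_mul_exp_neg ha ha)]
  refine (ae_restrict_mem measurableSet_Ioi).mono fun x hx => ?_
  have hx0 : 0 ≤ x := ha.trans (le_of_lt hx)
  exact mul_nonneg (Real.rpow_nonneg hx0 _) (Real.exp_pos _).le

theorem upperGamma_pos {a : ℝ} (ha : 0 ≤ a) : 0 < upperGamma (a + 1) a := by
  rw [upperGamma, add_sub_cancel_right, setIntegral_pos_iff_support_of_nonneg_ae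
    ((ae_restrict_mem measurableSet_Ioi).mono fun x hx =>
      mul_nonneg (Real.rpow_nonneg (ha.trans (le_of_lt hx)) _) (Real.exp_pos _).le)
    (integrableOn_rpow_mul_exp_neg ha ha)]
  have hsub : Set.Ioi a ⊆ Function.support (fun x : ℝ => x ^ a * Real.exp (-x)) ∩ Set.Ioi a :=
    fun x hx => ⟨(mul_pos (Real.rpow_pos_of_pos (ha.trans_lt hx) _) (Real.exp_pos _)).ne', hx⟩
  refine lt_of_lt_of_le ?_ (measure_mono hsub)
  simp

theorem lintegral_pow_mul_gammaProfile_ne_top {a : ℝ} (ha : 0 ≤ a) :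
    ∫⁻ w in Set.Ioi (0 : ℝ), ENNReal.ofReal (w ^ 4) * ENNReal.ofReal (gammaProfile a w) ≠ ⊤ := by
  have h := lintegral_Ioi_comp_add (fun x => ENNReal.ofReal (x ^ (a + 4) * Real.exp (-x))) a
  have hfin : ∫⁻ x in Set.Ioi a, ENNReal.ofReal (x ^ (a + 4) * Real.exp (-x)) < ⊤ := by
    have h1 := (integrableOn_rpow_mul_exp_neg ha (show 0 ≤ a + 4 by linarith)).2
    rwa [hasFiniteIntegral_iff_ofReal ((ae_restrict_mem measurableSet_Ioi).mono fun x hx =>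
      mul_nonneg (Real.rpow_nonneg (ha.trans (le_of_lt hx)) _) (Real.exp_pos _).le)] at h1
  rw [← h] at hfin
  refine ((setLIntegral_mono' measurableSet_Ioi fun w hw => ?_).trans_lt hfin).ne
  have hw0 : 0 < w := hw
  rw [← ENNReal.ofReal_mul (by positivity)]
  refine ENNReal.ofReal_le_ofReal ?_
  have haw : 0 < a + w := by linarith
  rw [gammaProfile, Real.rpow_add haw, ← mul_assoc]
  refine mul_le_mul_of_nonneg_right ?_ (Real.exp_pos _).le
  rw [mul_comm]
  refine mul_le_mul_of_nonneg_left ?_ (Real.rpow_nonneg haw.le _)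
  have : (a + w) ^ (4 : ℝ) = (a + w) ^ 4 := by exact_mod_cast Real.rpow_natCast (a + w) 4
  rw [this]
  exact pow_le_pow_left₀ hw0.le (by linarith) 4

/-- The term `a log(a + w)` has slope `a / (a + w) ≤ 1` for `w ≥ 0`, and the linear term adds
another 1. The case `a = 0` is separate, since the logarithm is then singular at `w = 0`. -/
theorem abs_log_gammaProfile_sub_le {a w w' : ℝ} (ha : 0 ≤ a) (hw : 0 ≤ w) (hw' : 0 ≤ w') :
    |Real.log (gammaProfile a w) - Real.log (gammaProfile a w')| ≤ 2 * |w - w'| := by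
  have hlog : ∀ v, 0 ≤ v → Real.log (gammaProfile a v) = a * Real.log (a + v) - (a + v) := by
    intro v hv
    rcases ha.eq_or_lt with h | h
    · subst h; simp [gammaProfile]
    · have hav : 0 < a + v := by linarith
      rw [gammaProfile, Real.log_mul (Real.rpow_pos_of_pos hav _).ne' (Real.exp_pos _).ne',
        Real.log_rpow hav, Real.log_exp]
      ring
  have key : ∀ u v, 0 ≤ u → 0 ≤ v →
      a * Real.log (a + u) - a * Real.log (a + v) ≤ |u - v| := by
    intro u v hu hv
    rcases ha.eq_or_lt with h | h
    · rw [← h]; simp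
    · have h1 := Real.log_le_sub_one_of_pos (show 0 < (a + u) / (a + v) by positivity)
      rw [Real.log_div (by positivity) (by positivity)] at h1
      have h2 : (a + u) / (a + v) - 1 = (u - v) / (a + v) := by field_simp; ring
      have h3 : (u - v) / (a + v) ≤ |u - v| / a :=
        div_le_div₀ (abs_nonneg _) (le_abs_self _) h (by linarith)
      rw [h2] at h1
      have h4 := h1.trans h3
      rw [le_div_iff₀ h] at h4
      linarith
  rw [hlog w hw, hlog w' hw']
  have k1 := key w w' hw hw'
  have k2 := key w' w hw' hw
  rw [abs_sub_comm w' w] at k2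
  have k3 := abs_le.mp (le_refl |w - w'|)
  rw [abs_le]
  constructor <;> linarith [k3.1, k3.2]

theorem isRegularError_acdtgPDF {η s a κ : ℝ} (hs : 0 < s) (ha : 0 ≤ a) (hκ0 : 0 < κ)
    (hκ1 : κ < 1) : IsRegularError (acdtgPDF η s a κ) := by
  have hΓ := upperGamma_pos ha
  have hκ' : 0 < 1 - κ := by linarith
  set c := κ * (1 - κ) / (s * upperGamma (a + 1) a) with hc
  have hc0 : 0 < c := by positivity
  have hnn := fun y => checkLoss_nonneg hκ0 hκ1 y
  have hfun : acdtgPDF η s a κ = fun y => c * gammaProfile a (checkLoss κ ((y - η) / s)) :=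
    funext fun y => acdtgPDF_eq η s a κ y
  have hm : Measurable (acdtgPDF η s a κ) := by
    rw [hfun]
    exact (((measurable_gammaProfile a).comp ((measurable_checkLoss κ).comp
      ((measurable_id.sub_const η).div_const s)))).const_mul c
  have hpos : ∀ y, 0 < acdtgPDF η s a κ y := fun y => by
    rw [hfun]
    exact mul_pos hc0 (gammaProfile_pos ha (hnn _))
  have hright : ∀ w, 0 < w → acdtgPDF η s a κ (η + w) = c * gammaProfile a (κ / s * w) := by
    intro w hw
    rw [hfun]
    simp only
    rw [add_sub_cancel_left, checkLoss_right (div_pos hw hs)]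
    congr 2
    ring
  have hleft : ∀ w, 0 < w →
      acdtgPDF η s a κ (η - w) = c * gammaProfile a ((1 - κ) / s * w) := by
    intro w hw
    rw [hfun]
    simp only
    rw [show (η - w - η) / s = -(w / s) by ring, checkLoss_left (div_pos hw hs)]
    congr 2
    ring
  have hhalf : ∀ q : ℝ, 0 < q →
      ∫⁻ w in Set.Ioi (0 : ℝ), ENNReal.ofReal (c * gammaProfile a (q * w)) =
        ENNReal.ofReal (q⁻¹ * (c * upperGamma (a + 1) a)) := by
    intro q hq
    rw [lintegral_Ioi_scale (fun w => ENNReal.ofReal (c * gammaProfile a w)) hq]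
    simp_rw [ENNReal.ofReal_mul hc0.le]
    rw [lintegral_const_mul' _ _ ENNReal.ofReal_ne_top, lintegral_gammaProfile ha,
      ← ENNReal.ofReal_mul hc0.le, ← ENNReal.ofReal_mul (by positivity)]
  have hhalf4 : ∀ q : ℝ, 0 < q →
      ∫⁻ w in Set.Ioi (0 : ℝ), ENNReal.ofReal (w ^ 4) *
        ENNReal.ofReal (c * gammaProfile a (q * w)) ≠ ⊤ := by
    intro q hq
    have hpt : ∀ w : ℝ, ENNReal.ofReal (w ^ 4) * ENNReal.ofReal (c * gammaProfile a (q * w)) =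
        (fun v => ENNReal.ofReal (c * q⁻¹ ^ 4) * (ENNReal.ofReal (v ^ 4) *
          ENNReal.ofReal (gammaProfile a v))) (q * w) := by
      intro w
      simp only
      rw [ENNReal.ofReal_mul hc0.le, ← mul_assoc, ← mul_assoc,
        ← ENNReal.ofReal_mul (p := w ^ 4) (by positivity),
        ← ENNReal.ofReal_mul (p := c * q⁻¹ ^ 4) (by positivity)]
      congr 2
      field_simp
    simp_rw [hpt]
    rw [lintegral_Ioi_scale (fun v => ENNReal.ofReal (c * q⁻¹ ^ 4) * (ENNReal.ofReal (v ^ 4) *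
          ENNReal.ofReal (gammaProfile a v))) hq, lintegral_const_mul' _ _ ENNReal.ofReal_ne_top]
    exact ENNReal.mul_ne_top ENNReal.ofReal_ne_top (ENNReal.mul_ne_top ENNReal.ofReal_ne_top
      (lintegral_pow_mul_gammaProfile_ne_top ha))
  have hone : ∫⁻ y, ENNReal.ofReal (acdtgPDF η s a κ y) = 1 := by
    have e1 : ∫⁻ w in Set.Ioi (0 : ℝ), ENNReal.ofReal (acdtgPDF η s a κ (η + w)) =
        ∫⁻ w in Set.Ioi (0 : ℝ), ENNReal.ofReal (c * gammaProfile a (κ / s * w)) :=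
      setLIntegral_congr_fun measurableSet_Ioi fun w hw => congrArg _ (hright w hw)
    have e2 : ∫⁻ w in Set.Ioi (0 : ℝ), ENNReal.ofReal (acdtgPDF η s a κ (η - w)) =
        ∫⁻ w in Set.Ioi (0 : ℝ), ENNReal.ofReal (c * gammaProfile a ((1 - κ) / s * w)) :=
      setLIntegral_congr_fun measurableSet_Ioi fun w hw => congrArg _ (hleft w hw)
    rw [lintegral_eq_add_half_lines η, e1, e2,
      hhalf _ (by positivity), hhalf _ (by positivity),
      ← ENNReal.ofReal_add (by positivity) (by positivity), ← ENNReal.ofReal_one]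
    congr 1
    -- The right and left half-lines carry masses `1 - κ` and `κ`.
    rw [hc]
    field_simp
    ring
  refine isRegularError_of_log_lipschitz hm hpos hone (K := 2 / s) (by positivity) ?_ ?_
  · intro u v
    rw [hfun]
    simp only
    rw [Real.log_mul hc0.ne' (gammaProfile_pos ha (hnn _)).ne',
      Real.log_mul hc0.ne' (gammaProfile_pos ha (hnn _)).ne', add_sub_add_left_eq_sub]
    refine (abs_log_gammaProfile_sub_le ha (hnn _) (hnn _)).trans ?_
    have h1 := abs_checkLoss_sub_le hκ0 hκ1 ((u - η) / s) ((v - η) / s)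
    have h2 : (u - η) / s - (v - η) / s = (u - v) / s := by ring
    rw [h2, abs_div, abs_of_pos hs] at h1
    have h3 : 2 / s * |u - v| ≤ 2 / s * (1 + |u| + |v|) * |u - v| := by
      refine mul_le_mul_of_nonneg_right (le_mul_of_one_le_right (by positivity) ?_)
        (abs_nonneg _)
      linarith [abs_nonneg u, abs_nonneg v]
    have h4 : 2 / s * |u - v| = 2 * (|u - v| / s) := by ring
    linarith
  · refine lintegral_fourth_moment_ne_top hm η hone ?_ ?_
    · rw [setLIntegral_congr_fun measurableSet_Ioi (fun w hw => by rw [hright w hw])]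
      exact hhalf4 _ (by positivity)
    · rw [setLIntegral_congr_fun measurableSet_Ioi (fun w hw => by rw [hleft w hw])]
      exact hhalf4 _ (by positivity)

/-- At shape 0 the power is identically 1 by the convention `0 ^ 0 = 1`, so the Laplace family needs
no separate treatment. -/
theorem aldPDF_eq_acdtgPDF (η s κ : ℝ) : aldPDF η s κ = acdtgPDF η s 0 κ := by
  have h : upperGamma (0 + 1) 0 = 1 := by
    simpa only [upperGamma, add_sub_cancel_right, Real.rpow_zero, one_mul] using
      integral_exp_neg_Ioi_zero
  funext y
  rw [aldPDF, acdtgPDF, h]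
  simp

/-- The connection condition equates the two prefactors. The log-density is then continuous at `η`
and has one formula in terms of `min` and `max`, which are 1-Lipschitz. -/
theorem cnlPDF_eq {η s κ β : ℝ} (hc : (1 - κ) / β = 2 * κ / √(2 * Real.pi)) (y : ℝ) :
    cnlPDF η s κ β y = 2 * κ / (√(2 * Real.pi) * s) *
      Real.exp (-(min (y - η) 0 ^ 2 / (2 * s ^ 2) + max (y - η) 0 / (β * s))) := by
  unfold cnlPDF
  split_ifs with h
  · rw [min_eq_left (by linarith), max_eq_right (by linarith)]
    congr 2
    ring
  · have h2 : (1 - κ) / (β * s) = 2 * κ / (√(2 * Real.pi) * s) := by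
      rw [← div_div, hc, div_div]
    rw [min_eq_right (by linarith), max_eq_left (by linarith), h2]
    congr 2
    ring

theorem isRegularError_cnlPDF {η s κ β : ℝ} (hs : 0 < s) (hκ0 : 0 < κ) (hκ1 : κ < 1)
    (hβ : 0 < β) (hc : (1 - κ) / β = 2 * κ / √(2 * Real.pi)) :
    IsRegularError (cnlPDF η s κ β) := by
  have hπ : 0 < √(2 * Real.pi) := Real.sqrt_pos.mpr (by positivity)
  set A := 2 * κ / (√(2 * Real.pi) * s) with hA
  have hA0 : 0 < A := by positivity
  have hA2 : A = (1 - κ) / (β * s) := by rw [← div_div, hc, div_div]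
  have hfun : cnlPDF η s κ β = fun y => A *
      Real.exp (-(min (y - η) 0 ^ 2 / (2 * s ^ 2) + max (y - η) 0 / (β * s))) :=
    funext fun y => cnlPDF_eq hc y
  have hm : Measurable (cnlPDF η s κ β) := by
    rw [hfun]
    fun_prop
  have hpos : ∀ y, 0 < cnlPDF η s κ β y := fun y => by
    rw [hfun]
    exact mul_pos hA0 (Real.exp_pos _)
  have hright : ∀ w, 0 < w →
      cnlPDF η s κ β (η + w) = A * Real.exp (-((β * s)⁻¹ * w)) := by
    intro w hw
    rw [hfun]
    simp only
    rw [add_sub_cancel_left, min_eq_right hw.le, max_eq_left hw.le]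
    congr 2
    ring
  have hleft : ∀ w, 0 < w →
      cnlPDF η s κ β (η - w) = A * Real.exp (-(1 / (2 * s ^ 2)) * w ^ 2) := by
    intro w hw
    rw [hfun]
    simp only
    rw [show η - w - η = -w by ring, min_eq_left (by linarith), max_eq_right (by linarith)]
    congr 2
    ring
  have hb : 0 < 1 / (2 * s ^ 2) := by positivity
  have hq : 0 < (β * s)⁻¹ := by positivity
  have hexp : ∫⁻ w in Set.Ioi (0 : ℝ), ENNReal.ofReal (cnlPDF η s κ β (η + w)) =
      ENNReal.ofReal (1 - κ) := by
    rw [setLIntegral_congr_fun (g := fun w => (fun v => ENNReal.ofReal A *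
      ENNReal.ofReal (Real.exp (-v))) ((β * s)⁻¹ * w)) measurableSet_Ioi (fun w hw => by
        rw [hright w hw, ENNReal.ofReal_mul hA0.le]),
      lintegral_Ioi_scale (fun v => ENNReal.ofReal A * ENNReal.ofReal (Real.exp (-v))) hq,
      lintegral_const_mul' _ _ ENNReal.ofReal_ne_top,
      ← ofReal_integral_eq_lintegral_ofReal (integrableOn_exp_neg_Ioi 0)
        (ae_of_all _ fun w => (Real.exp_pos _).le), integral_exp_neg_Ioi_zero,
      ENNReal.ofReal_one, mul_one, ← ENNReal.ofReal_mul (by positivity), hA2, inv_inv]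
    congr 1
    field_simp
  have hgauss : ∫⁻ w in Set.Ioi (0 : ℝ), ENNReal.ofReal (cnlPDF η s κ β (η - w)) =
      ENNReal.ofReal κ := by
    rw [setLIntegral_congr_fun (g := fun w => ENNReal.ofReal A *
      ENNReal.ofReal (Real.exp (-(1 / (2 * s ^ 2)) * w ^ 2))) measurableSet_Ioi (fun w hw => by
        rw [hleft w hw, ENNReal.ofReal_mul hA0.le]),
      lintegral_const_mul' _ _ ENNReal.ofReal_ne_top,
      ← ofReal_integral_eq_lintegral_ofReal (integrable_exp_neg_mul_sq hb).integrableOn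
        (ae_of_all _ fun w => (Real.exp_pos _).le), integral_gaussian_Ioi,
      ← ENNReal.ofReal_mul hA0.le]
    congr 1
    have h1 : √(Real.pi / (1 / (2 * s ^ 2))) = √(2 * Real.pi) * s := by
      rw [show Real.pi / (1 / (2 * s ^ 2)) = 2 * Real.pi * s ^ 2 by field_simp,
        Real.sqrt_mul (by positivity), Real.sqrt_sq hs.le]
    rw [h1, hA]
    field_simp
  have hone : ∫⁻ y, ENNReal.ofReal (cnlPDF η s κ β y) = 1 := by
    rw [lintegral_eq_add_half_lines η, hexp, hgauss, ← ENNReal.ofReal_add (by linarith) hκ0.le,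
      sub_add_cancel, ENNReal.ofReal_one]
  -- The Gaussian side has Lipschitz constants growing linearly, from `p² - p'² = (p + p')(p - p')`;
  -- the exponential side contributes `1 / (β s)`.
  refine isRegularError_of_log_lipschitz hm hpos hone
    (K := (1 + 2 * |η|) / (2 * s ^ 2) + 1 / (β * s)) (by positivity) ?_ ?_
  · intro u v
    rw [hfun]
    simp only
    rw [Real.log_mul hA0.ne' (Real.exp_pos _).ne', Real.log_mul hA0.ne' (Real.exp_pos _).ne',
      add_sub_add_left_eq_sub, Real.log_exp, Real.log_exp]
    have hmin := abs_min_sub_min_le_max (u - η) 0 (v - η) 0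
    have hmax := abs_max_sub_max_le_max (u - η) 0 (v - η) 0
    simp only [sub_sub_sub_cancel_right, sub_self, abs_zero, max_eq_left (abs_nonneg (u - v))]
      at hmin hmax
    set p := min (u - η) 0 with hp
    set p' := min (v - η) 0 with hp'
    set q := max (u - η) 0 with hqdef
    set q' := max (v - η) 0 with hqdef'
    have habs : ∀ t : ℝ, |min (t - η) 0| ≤ |t| + |η| := by
      intro t
      have h1 := abs_min_sub_min_le_max (t - η) 0 0 0
      simp only [min_self, sub_zero, abs_zero, max_eq_left (abs_nonneg (t - η))] at h1
      exact h1.trans (abs_sub _ _)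
    have hsq : |p ^ 2 - p' ^ 2| ≤ (|u| + |v| + 2 * |η|) * |u - v| := by
      rw [sq_sub_sq, abs_mul]
      refine mul_le_mul ?_ hmin (abs_nonneg _) (by positivity)
      exact (abs_add_le _ _).trans (by linarith [habs u, habs v])
    have h1 : -(p ^ 2 / (2 * s ^ 2) + q / (β * s)) - -(p' ^ 2 / (2 * s ^ 2) + q' / (β * s)) =
        -((p ^ 2 - p' ^ 2) / (2 * s ^ 2) + (q - q') / (β * s)) := by ring
    rw [h1, abs_neg]
    refine (abs_add_le _ _).trans ?_
    rw [abs_div, abs_div, abs_of_pos (show 0 < 2 * s ^ 2 by positivity),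
      abs_of_pos (show 0 < β * s by positivity)]
    have h2 : |p ^ 2 - p' ^ 2| / (2 * s ^ 2) ≤
        (1 + 2 * |η|) / (2 * s ^ 2) * (1 + |u| + |v|) * |u - v| := by
      rw [div_mul_eq_mul_div, div_mul_eq_mul_div]
      refine div_le_div_of_nonneg_right (hsq.trans ?_) (by positivity)
      refine mul_le_mul_of_nonneg_right ?_ (abs_nonneg _)
      nlinarith [abs_nonneg u, abs_nonneg v, abs_nonneg η,
        mul_nonneg (abs_nonneg η) (abs_nonneg u), mul_nonneg (abs_nonneg η) (abs_nonneg v)]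
    have h3 : |q - q'| / (β * s) ≤ 1 / (β * s) * (1 + |u| + |v|) * |u - v| := by
      rw [div_mul_eq_mul_div, div_mul_eq_mul_div, one_mul]
      refine div_le_div_of_nonneg_right (hmax.trans ?_) (by positivity)
      exact le_mul_of_one_le_left (abs_nonneg _) (by linarith [abs_nonneg u, abs_nonneg v])
    calc _ ≤ (1 + 2 * |η|) / (2 * s ^ 2) * (1 + |u| + |v|) * |u - v| +
          1 / (β * s) * (1 + |u| + |v|) * |u - v| := add_le_add h2 h3
      _ = _ := by ring
  · refine lintegral_fourth_moment_ne_top hm η hone ?_ ?_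
    · have hI := integrableOn_rpow_mul_exp_neg_mul_rpow (s := 4) (p := 1) (b := (β * s)⁻¹)
        (by norm_num) one_pos hq
      have hfin := (hI.const_mul A).2
      rw [hasFiniteIntegral_iff_ofReal ((ae_restrict_mem measurableSet_Ioi).mono fun x hx =>
        mul_nonneg hA0.le (mul_nonneg (Real.rpow_nonneg (le_of_lt hx) _)
          (Real.exp_pos _).le))] at hfin
      refine ((setLIntegral_mono' measurableSet_Ioi fun w hw => ?_).trans_lt hfin).ne
      have hw0 : 0 < w := hw
      have h4 : w ^ (4 : ℝ) = w ^ 4 := by exact_mod_cast Real.rpow_natCast w 4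
      rw [hright w hw, ← ENNReal.ofReal_mul (by positivity), h4, Real.rpow_one]
      refine ENNReal.ofReal_le_ofReal (le_of_eq ?_)
      ring_nf
    · have hI := integrableOn_rpow_mul_exp_neg_mul_sq hb (s := 4) (by norm_num)
      have hfin := (hI.const_mul A).2
      rw [hasFiniteIntegral_iff_ofReal ((ae_restrict_mem measurableSet_Ioi).mono fun x hx =>
        mul_nonneg hA0.le (mul_nonneg (Real.rpow_nonneg (le_of_lt hx) _)
          (Real.exp_pos _).le))] at hfin
      refine ((setLIntegral_mono' measurableSet_Ioi fun w hw => ?_).trans_lt hfin).ne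
      have hw0 : 0 < w := hw
      have h4 : w ^ (4 : ℝ) = w ^ 4 := by exact_mod_cast Real.rpow_natCast w 4
      rw [hleft w hw, ← ENNReal.ofReal_mul (by positivity), h4]
      refine ENNReal.ofReal_le_ofReal (le_of_eq ?_)
      ring

end Families

/-! ### Cauchy errors -/

section Cauchy

/-- Without a fourth moment the general criterion does not apply. However, the log-density is
Lipschitz in location and scale uniformly in `y`, so a constant envelope works. -/
theorem isRegularError_cauchyPDFReal (η : ℝ) {γ : NNReal} (hγ : 0 < γ) :
    IsRegularError (ProbabilityTheory.cauchyPDFReal η γ) := by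
  have hg : (0 : ℝ) < γ := by exact_mod_cast hγ
  have hpos := ProbabilityTheory.cauchyPDF_pos η hγ.ne'
  have hone := ProbabilityTheory.lintegral_cauchyPDF_eq_one η hγ.ne'
  have hlog : ∀ u, Real.log (ProbabilityTheory.cauchyPDFReal η γ u) =
      Real.log (Real.pi⁻¹ * γ) - Real.log ((u - η) ^ 2 + (γ : ℝ) ^ 2) := by
    intro u
    rw [ProbabilityTheory.cauchyPDFReal_def, Real.log_mul (by positivity) (by positivity),
      Real.log_inv]
    ring
  refine ⟨ProbabilityTheory.measurable_cauchyPDFReal η γ, hpos, hone, ?_, ?_⟩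
  · intro R
    refine ⟨Real.pi⁻¹ * γ * ((R + |η|) ^ 2 + (γ : ℝ) ^ 2)⁻¹, by positivity, fun y hy => ?_⟩
    rw [ProbabilityTheory.cauchyPDFReal_def]
    have h1 : (y - η) ^ 2 ≤ (R + |η|) ^ 2 := by
      rw [← sq_abs (y - η)]
      exact pow_le_pow_left₀ (abs_nonneg _) ((abs_sub _ _).trans (by linarith)) 2
    gcongr
  · intro J b hb
    have hb0 : 0 < b := by linarith
    set L₁ : ℝ := 2 + 2 * (1 + |η|) ^ 2 / (γ : ℝ) ^ 2 with hL₁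
    set L₂ : ℝ := 1 + b ^ 2 + 2 * b * |J| + 2 * |η| with hL₂
    have hL₁0 : 0 ≤ L₁ := by positivity
    have hL₂0 : 0 ≤ L₂ := by positivity
    have hquad : ∀ u : ℝ, (1 + |u|) ^ 2 ≤ L₁ * ((u - η) ^ 2 + (γ : ℝ) ^ 2) := by
      intro u
      have h1 : 1 + |u| ≤ (1 + |η|) + |u - η| := by
        have := abs_add_le (u - η) η
        rw [sub_add_cancel] at this
        linarith
      have h2 : (1 + |u|) ^ 2 ≤ ((1 + |η|) + |u - η|) ^ 2 :=
        pow_le_pow_left₀ (by positivity) h1 2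
      have h3 : ((1 + |η|) + |u - η|) ^ 2 ≤ 2 * (1 + |η|) ^ 2 + 2 * (u - η) ^ 2 := by
        rw [← sq_abs (u - η)]
        nlinarith [sq_nonneg ((1 + |η|) - |u - η|)]
      have h4 : L₁ * ((u - η) ^ 2 + (γ : ℝ) ^ 2) = 2 * (1 + |η|) ^ 2 + 2 * (u - η) ^ 2 +
          (2 * (γ : ℝ) ^ 2 + 2 * (1 + |η|) ^ 2 / (γ : ℝ) ^ 2 * (u - η) ^ 2) := by
        rw [hL₁]
        field_simp
        ring
      have h5 : 0 ≤ 2 * (γ : ℝ) ^ 2 + 2 * (1 + |η|) ^ 2 / (γ : ℝ) ^ 2 * (u - η) ^ 2 := by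
        positivity
      linarith
    -- `log x ≤ x - 1` reduces the difference to `(v - u)(v + u - 2η)` over the quadratic. Both
    -- factors are `O(1 + |u|)`, and `L₁` bounds `(1 + |u|)²` by the quadratic. The one-sided
    -- estimate suffices by symmetry.
    have hkey : ∀ m m' s s' : ℝ, |m| ≤ J → |m'| ≤ J → b⁻¹ ≤ s → s ≤ b → b⁻¹ ≤ s' → s' ≤ b →
        ∀ y, Real.log (((y - m') / s' - η) ^ 2 + (γ : ℝ) ^ 2) -
          Real.log (((y - m) / s - η) ^ 2 + (γ : ℝ) ^ 2) ≤
          b * L₁ * L₂ * (|m - m'| + |s - s'|) := by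
      intro m m' s s' hm hm' hs hsb hs' hsb' y
      have hs0 : 0 < s := (inv_pos.mpr hb0).trans_le hs
      have hs0' : 0 < s' := (inv_pos.mpr hb0).trans_le hs'
      have hJ : J ≤ |J| := le_abs_self J
      set u := (y - m) / s with hu
      set v := (y - m') / s' with hv
      set D := |m - m'| + |s - s'| with hD
      have hD0 : 0 ≤ D := by positivity
      have hA : 0 < (u - η) ^ 2 + (γ : ℝ) ^ 2 := by positivity
      have hA' : 0 < (v - η) ^ 2 + (γ : ℝ) ^ 2 := by positivity
      have huv : |v - u| ≤ b * D * (1 + |u|) := by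
        refine (abs_standardize_sub_le hb0 hs' hs).trans ?_
        rw [abs_sub_comm m' m, abs_sub_comm s' s, ← hu, mul_assoc]
        refine mul_le_mul_of_nonneg_left ?_ hb0.le
        rw [hD]
        nlinarith [abs_nonneg (m - m'), abs_nonneg (s - s'), abs_nonneg u,
          mul_nonneg (abs_nonneg (m - m')) (abs_nonneg u)]
      have hvb : |v| ≤ b ^ 2 * |u| + 2 * b * |J| := by
        have h1 : v = s'⁻¹ * (s * u + (m - m')) := by
          rw [hu, hv]
          field_simp
          ring
        rw [h1, abs_mul, abs_of_pos (inv_pos.mpr hs0')]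
        have h2 : |s * u + (m - m')| ≤ b * |u| + 2 * |J| := by
          refine (abs_add_le _ _).trans (add_le_add ?_ ?_)
          · rw [abs_mul, abs_of_pos hs0]
            exact mul_le_mul_of_nonneg_right hsb (abs_nonneg _)
          · exact (abs_sub _ _).trans (by linarith)
        calc s'⁻¹ * |s * u + (m - m')| ≤ b * (b * |u| + 2 * |J|) :=
              mul_le_mul (inv_le_of_inv_le₀ hb0 hs') h2 (abs_nonneg _) hb0.le
          _ = _ := by ring
      have hsum : |(v - η) + (u - η)| ≤ L₂ * (1 + |u|) := by
        have h1 : |(v - η) + (u - η)| ≤ |v| + |η| + (|u| + |η|) :=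
          (abs_add_le _ _).trans (add_le_add (abs_sub _ _) (abs_sub _ _))
        refine h1.trans ?_
        have h2 : 0 ≤ (2 * b * |J| + 2 * |η|) * |u| := by positivity
        have h3 : 0 ≤ b ^ 2 := by positivity
        rw [hL₂]
        nlinarith
      rw [← Real.log_div hA'.ne' hA.ne']
      refine (Real.log_le_sub_one_of_pos (div_pos hA' hA)).trans ?_
      have h1 : ((v - η) ^ 2 + (γ : ℝ) ^ 2) / ((u - η) ^ 2 + (γ : ℝ) ^ 2) - 1 =
          ((v - u) * ((v - η) + (u - η))) / ((u - η) ^ 2 + (γ : ℝ) ^ 2) := by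
        rw [eq_div_iff hA.ne', sub_mul, div_mul_cancel₀ _ hA.ne']
        ring
      rw [h1, div_le_iff₀ hA]
      calc (v - u) * ((v - η) + (u - η)) ≤ |v - u| * |(v - η) + (u - η)| := by
            rw [← abs_mul]; exact le_abs_self _
        _ ≤ (b * D * (1 + |u|)) * (L₂ * (1 + |u|)) :=
            mul_le_mul huv hsum (abs_nonneg _) (by positivity)
        _ = b * D * L₂ * (1 + |u|) ^ 2 := by ring
        _ ≤ b * D * L₂ * (L₁ * ((u - η) ^ 2 + (γ : ℝ) ^ 2)) :=
            mul_le_mul_of_nonneg_left (hquad u) (by positivity)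
        _ = _ := by ring
    refine ⟨fun _ => b * L₁ * L₂ + b, (b * L₁ * L₂ + b) ^ 2, measurable_const,
      fun _ => by positivity, by positivity, ?_, ?_⟩
    · intro m m' s s' hm hm' hs hsb hs' hsb' y
      have hs0 : 0 < s := (inv_pos.mpr hb0).trans_le hs
      have hs0' : 0 < s' := (inv_pos.mpr hb0).trans_le hs'
      rw [log_lsPDF hpos _ hs0, log_lsPDF hpos _ hs0', hlog, hlog]
      have k1 := hkey m m' s s' hm hm' hs hsb hs' hsb' y
      have k2 := hkey m' m s' s hm' hm hs' hsb' hs hsb y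
      rw [abs_sub_comm m' m, abs_sub_comm s' s] at k2
      have k3 := abs_le.mp (abs_log_sub_log_le hb0 hs hs')
      have k4 : 0 ≤ b * |m - m'| := by positivity
      rw [abs_le]
      constructor <;> linarith [k3.1, k3.2]
    · intro m s _ hs _
      have hs0 : 0 < s := (inv_pos.mpr hb0).trans_le hs
      rw [lintegral_lsPDF_mul _ _ hs0, lintegral_const_mul' _ _ ENNReal.ofReal_ne_top]
      exact le_of_eq ((congrArg _ hone).trans (mul_one _))

end Cauchy

/-! ### Assembly of the theorem -/

theorem IsErrorDensity.isRegularError {f : ℝ → ℝ} (hf : IsErrorDensity f) : IsRegularError f := by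
  cases hf with
  | ald η s κ hs hκ0 hκ1 =>
    rw [aldPDF_eq_acdtgPDF]
    exact isRegularError_acdtgPDF hs le_rfl hκ0 hκ1
  | acdtg η s a κ hs ha hκ0 hκ1 => exact isRegularError_acdtgPDF hs ha hκ0 hκ1
  | cnl η s κ β hs hκ0 hκ1 hβ hc => exact isRegularError_cnlPDF hs hκ0 hκ1 hβ hc
  | cauchy η s hs => exact isRegularError_cauchyPDFReal η hs

/-- Richness drives the entropy to infinity, whereas an empty class has entropy `Real.log 0 = 0`. -/
theorem nonempty_of_isRich {X : Type*} [MeasurableSpace X] {ν : Measure X} {h : X → ℝ}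
    {U : Set (X → ℝ)} (hTU : TotallyBoundedL2 ν h U) {M : ℝ → ℝ}
    (hM : M =Θ[𝓝[>] (0 : ℝ)] packingEntropy ν h U) (hrich : IsRich M) : U.Nonempty := by
  obtain ⟨ε, h1, h0⟩ := (((tendsto_entropy_atTop packingEntropy_nonneg
    (packingEntropy_antitoneOn hTU) hM hrich).eventually_gt_atTop 0).and
    self_mem_nhdsWithin).exists
  obtain ⟨N, hN, -, -, hlog⟩ := exists_packing hTU (show 0 < ε from h0)
  rcases N.eq_empty_or_nonempty with hne | ⟨u, hu⟩
  · rw [hlog, hne] at h1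
    simp at h1
  · exact ⟨u, hN hu⟩

end LocScale

theorem corollary1 {X : Type*} [MeasurableSpace X] (ν : Measure X) [SigmaFinite ν]
    -- error density with `τ`-th quantile zero
    (τ : ℝ) (hτ0 : 0 < τ) (hτ1 : τ < 1) (f : ℝ → ℝ) (hf : LocScale.IsErrorDensity f)
    (hq : LocScale.quantile (LocScale.errorLaw f) τ = 0)
    -- regression functions, scale functions, covariate densities
    (U S H : Set (X → ℝ))
    (hU : ∀ μ ∈ U, Measurable μ) (hUb : ∃ J : ℝ, ∀ μ ∈ U, ∀ x, |μ x| ≤ J)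
    (hSne : S.Nonempty) (hS : ∀ σ ∈ S, Measurable σ)
    (hSb : ∃ b : ℝ, 1 < b ∧ ∀ σ ∈ S, ∀ x, b⁻¹ ≤ σ x ∧ σ x ≤ b)
    (hH : ∀ h ∈ H, LocScale.IsProbDensity ν h)
    -- dominating density
    (h₀ : X → ℝ) (hh₀ : h₀ ∈ H) (hdom : ∃ C : ℝ, ∀ h ∈ H, ∀ x, h x ≤ C * h₀ x)
    -- entropy condition
    (hent : LocScale.EntropyCondition ν h₀ U S) :
    (∃ ε : ℕ → ℝ, LocScale.SolvesEntropyEquation ν h₀ U ε) ∧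
    ∀ ε : ℕ → ℝ, LocScale.SolvesEntropyEquation ν h₀ U ε →
      LocScale.HasSqRate (LocScale.minimaxRisk ν f U S H) ε := by
  obtain ⟨hTU, hTS, ⟨M, hM, hrich, hreg⟩, hSU⟩ := hent
  obtain ⟨J, hUJ⟩ := hUb
  obtain ⟨b, hb, hSb⟩ := hSb
  obtain ⟨C₀, hdom⟩ := hdom
  have hreg_f := hf.isRegularError
  refine ⟨LocScale.exists_solution LocScale.packingEntropy_nonneg
    (LocScale.packingEntropy_antitoneOn hTU) hM hrich hreg, fun ε hε => ?_⟩
  have hUne := LocScale.nonempty_of_isRich hTU hM hrich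
  obtain ⟨σ, hσ⟩ := id hSne
  obtain ⟨c, hc, hlow⟩ := LocScale.exists_minimaxRisk_ge hreg_f hb hU hUJ hσ (hS σ hσ) (hSb σ hσ)
    hh₀ (hH _ hh₀) hTU hM hrich hε
  obtain ⟨C, hC, hup⟩ := LocScale.exists_minimaxRisk_le hreg_f hτ0 hτ1 hq hb hU hUJ hUne hSne hS
    hSb hH hdom (hH _ hh₀).2.1 hTU hTS hSU hε
  exact ⟨c, C, hc, hC, hlow.and hup⟩
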